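/- Let $d\in\{1,2,3\}$, $\mathbb T^d=\mathbb R^d/\mathbb Z^d$, $\mathscr S=C^\infty(\mathbb T^d,\mathbb R)$, and let $\mathscr S'$ be the space of real distributions on $\mathbb T^d$. Fix a dyadic partition of unity: nonnegative radial $\rho_{-1},\rho_0\in C_c^\infty(\mathbb R^d)$ with $\operatorname{supp}\rho_{-1}\subset\{|y|\le \frac43\}$, $\operatorname{supp}\rho_0\subset\{\frac34\le|y|\le\frac83\}$ and $\rho_{-1}(x)+\sum_{q\ge 0}\rho_0(2^{-q}x)=1$ for all $x\in\mathbb R^d$. For $q\ge 0$ put $\rho_q=\rho_0(2^{-q}\,\cdot)$, and for $q\ge -1$ let $\Delta_q T=K_q*T$ with $K_q(x)=\sum_{m\in\mathbb Z^d}\rho_q(m)\cos(2\pi\langle x,m\rangle)$. For $\alpha\in\mathbb R$ let $$\|T\|_\alpha=\sup_{q\ge -1}2^{\alpha q}\|\Delta_q T\|_{L^\infty},\qquad \mathscr C^\alpha=\Big\{T\in\mathscr S' : \lim_{q\to\infty}2^{\alpha q}\|\Delta_qT\|_{L^\infty}=0\Big\},$$ and let $C_U\mathscr C^\alpha$ be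 the set of continuous functions $[0,U]\to(\mathscr C^\alpha,\|\cdot\|_\alpha)$. Let $P_0T=T$ and, for $r>0$, $P_rT=\eta_r*T$ with $\eta_r(x)=\sum_{m\in\mathbb Z^d}e^{-r|2\pi m|^4}\cos(2\pi\langle x,m\rangle)$. For $\alpha>0$ the elements of $\mathscr C^\alpha$ are continuous functions, and their cube is the pointwise cube. The integral of an $\mathscr S'$-valued function is defined by pairing with test functions. Let $\alpha\in(0,2-\frac d2)$, $g_1\in\mathscr C^\alpha$ and $g_2\in\bigcap_{U\ge 0}C_U\mathscr C^\alpha$. For $\beta\in(0,+\infty]$, a mild solution on $[0,\beta)$ is a function $f\in\bigcap_{U\in[0,\beta)}C_U\mathscr C^\alpha$ such that for all $r\in[0,\beta)$ $$f(r)=P_rg_1+g_2(r)+\int_0^rP_{r-q}\big(\Delta(f(q)^3-f(q))\big)\,dq,$$ where $\Delta$ without index is the Laplacian. Then there are $\beta\in(0,+\infty]$ and a mild solution $f$ on $[0,\beta)$ such that: 1. (uniqueness and maximality) if $h$ is a mild solution on $[0,\beta')$ with $\beta'\in(0,+\infty]$, then $\beta'\le\beta$ and $h=f$ on $[0,\beta')$;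 in particular $f$ is the only mild solution on $[0,\beta)$; 2. (blow-up) if $\beta<+\infty$, then $\lim_{q\to\beta^-}\|f(q)\|_\alpha=+\infty$. -/

import Mathlib

open MeasureTheory Filter Topology
open scoped ContDiff

namespace CahnHilliard

/-- The projection `ℝ^d → 𝕋^d = ℝ^d / ℤ^d`. -/
def toTorus {d : ℕ} (x : EuclideanSpace ℝ (Fin d)) : UnitAddTorus (Fin d) :=
  fun i => (x i : UnitAddCircle)

theorem toTorus_add {d : ℕ} (x y : EuclideanSpace ℝ (Fin d)) :
    toTorus (x + y) = toTorus x + toTorus y := by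
  funext i; simp [toTorus]

theorem toTorus_sub {d : ℕ} (x y : EuclideanSpace ℝ (Fin d)) :
    toTorus (x - y) = toTorus x - toTorus y := by
  funext i; simp [toTorus]

theorem isOpenQuotientMap_toTorus (d : ℕ) :
    IsOpenQuotientMap (toTorus : EuclideanSpace ℝ (Fin d) → UnitAddTorus (Fin d)) := by
  have h1 : IsOpenQuotientMap
      (Pi.map (fun (_ : Fin d) (t : ℝ) => (t : UnitAddCircle))) :=
    IsOpenQuotientMap.piMap fun _ => QuotientAddGroup.isOpenQuotientMap_mk
  exact h1.comp (EuclideanSpace.equiv (Fin d) ℝ).toHomeomorph.isOpenQuotientMap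

theorem exists_compact_toTorus (d : ℕ) :
    ∃ K : Set (EuclideanSpace ℝ (Fin d)), IsCompact K ∧
      ∀ x, ∃ y ∈ K, ∃ m : EuclideanSpace ℝ (Fin d), toTorus m = 0 ∧ x = y + m := by
  refine ⟨WithLp.toLp 2 '' (Set.pi Set.univ fun _ : Fin d => Set.Icc (0 : ℝ) 1),
    (isCompact_univ_pi fun _ => isCompact_Icc).image (PiLp.continuous_toLp 2 _), fun x => ?_⟩
  refine ⟨WithLp.toLp 2 fun i => Int.fract (x i), ⟨_, ?_, rfl⟩,
    WithLp.toLp 2 fun i => (⌊x i⌋ : ℝ), ?_, ?_⟩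
  · intro i _
    exact ⟨Int.fract_nonneg _, (Int.fract_lt_one _).le⟩
  · funext i
    simp only [toTorus, Pi.zero_apply]
    rw [AddCircle.coe_eq_zero_iff]
    exact ⟨⌊x i⌋, by simp⟩
  · ext i
    simp

/-- The space `𝒮 = C^∞(𝕋^d, ℝ)`: a function on the torus is smooth if its periodic lift to `ℝ^d`
is smooth. -/
def TestFunction (d : ℕ) : Submodule ℝ C(UnitAddTorus (Fin d), ℝ) where
  carrier := {φ | ContDiff ℝ ∞ fun x : EuclideanSpace ℝ (Fin d) => φ (toTorus x)}
  add_mem' := by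
    intro φ ψ hφ hψ
    simp only [Set.mem_ofPred_eq] at hφ hψ ⊢
    exact hφ.add hψ
  zero_mem' := by
    simp only [Set.mem_ofPred_eq]
    exact contDiff_const
  smul_mem' := by
    intro c φ hφ
    simp only [Set.mem_ofPred_eq] at hφ ⊢
    exact contDiff_const.smul hφ

/-- The periodic lift of a test function to `ℝ^d`. -/
def lift {d : ℕ} (φ : TestFunction d) (x : EuclideanSpace ℝ (Fin d)) : ℝ :=
  φ.1 (toTorus x)

theorem contDiff_lift {d : ℕ} (φ : TestFunction d) : ContDiff ℝ ∞ (lift φ) := φ.2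

theorem lift_add {d : ℕ} (φ ψ : TestFunction d) :
    lift (φ + ψ) = lift φ + lift ψ := rfl

theorem lift_smul {d : ℕ} (c : ℝ) (φ : TestFunction d) :
    lift (c • φ) = c • lift φ := rfl

theorem exists_bound {d : ℕ} (φ : TestFunction d) (k : ℕ) :
    ∃ M : ℝ, ∀ x, ‖iteratedFDeriv ℝ k (lift φ) x‖ ≤ M := by
  obtain ⟨K, hK, hK'⟩ := exists_compact_toTorus d
  have hc : Continuous (iteratedFDeriv ℝ k (lift φ)) :=
    (contDiff_lift φ).continuous_iteratedFDeriv (mod_cast le_top)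
  obtain ⟨M, hM⟩ := hK.exists_bound_of_continuousOn hc.continuousOn
  refine ⟨M, fun x => ?_⟩
  obtain ⟨y, hy, m, hm, rfl⟩ := hK' x
  have h : (fun z => lift φ (z + m)) = lift φ := by
    funext z
    simp [lift, toTorus_add, hm]
  rw [← iteratedFDeriv_comp_add_right, h]
  exact hM y hy

/-- The space `𝒮'` of real distributions on the torus: the linear functionals `T` on `𝒮` for which
there are `c` and `n` with `|T φ| ≤ c * max_{k ≤ n} sup_x ‖D^k φ(x)‖`. -/
def TorusDistribution (d : ℕ) : Submodule ℝ (TestFunction d →ₗ[ℝ] ℝ) where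
  carrier := {T | ∃ (c : ℝ) (n : ℕ), ∀ (φ : TestFunction d) (M : ℝ),
    (∀ k ≤ n, ∀ x, ‖iteratedFDeriv ℝ k (lift φ) x‖ ≤ M) → |T φ| ≤ c * M}
  add_mem' := by
    rintro S T ⟨c, n, h⟩ ⟨c', n', h'⟩
    refine ⟨c + c', max n n', fun φ M hM => ?_⟩
    have h1 := h φ M fun k hk => hM k (hk.trans (le_max_left _ _))
    have h2 := h' φ M fun k hk => hM k (hk.trans (le_max_right _ _))
    rw [LinearMap.add_apply, add_mul]
    exact (abs_add_le _ _).trans (add_le_add h1 h2)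
  zero_mem' := ⟨0, 0, fun φ M _ => by simp⟩
  smul_mem' := by
    rintro a T ⟨c, n, h⟩
    refine ⟨|a| * c, n, fun φ M hM => ?_⟩
    rw [LinearMap.smul_apply, smul_eq_mul, abs_mul, mul_assoc]
    exact mul_le_mul_of_nonneg_left (h φ M hM) (abs_nonneg a)

theorem integrable_torus {d : ℕ} (u : C(UnitAddTorus (Fin d), ℝ)) : Integrable (fun x => u x) :=
  u.continuous.integrable_of_hasCompactSupport (HasCompactSupport.of_compactSpace _)

/-- The distribution `φ ↦ ∫_{𝕋^d} u(x) φ(x) dx` given by a continuous function `u`. -/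
noncomputable def ofFunction {d : ℕ} : C(UnitAddTorus (Fin d), ℝ) →ₗ[ℝ] TorusDistribution d where
  toFun u := ⟨{ toFun := fun φ => ∫ x, u x * φ.1 x
                map_add' := fun φ ψ => by
                  have h1 := integrable_torus (u * φ.1)
                  have h2 := integrable_torus (u * ψ.1)
                  simp only [ContinuousMap.mul_apply] at h1 h2
                  rw [← integral_add h1 h2]
                  simp [mul_add]
                map_smul' := fun c φ => by
                  rw [RingHom.id_apply, smul_eq_mul, ← integral_const_mul]
                  simp [mul_left_comm] }, by
    refine ⟨‖u‖, 0, fun φ M hM => ?_⟩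
    have hφ : ∀ x, ‖φ.1 x‖ ≤ M := fun x => by
      obtain ⟨z, rfl⟩ := (isOpenQuotientMap_toTorus d).surjective x
      simpa [lift] using hM 0 le_rfl z
    have := norm_integral_le_of_norm_le_const (μ := (volume : Measure (UnitAddTorus (Fin d))))
      (f := fun x => u x * φ.1 x) (C := ‖u‖ * M) (ae_of_all _ fun x => by
        rw [norm_mul]
        exact mul_le_mul (u.norm_coe_le_norm x) (hφ x) (norm_nonneg _) (norm_nonneg _))
    have hv : (volume : Measure (UnitAddTorus (Fin d))).real Set.univ = 1 := by
      simp [Measure.real, volume_pi, Measure.pi_univ]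
    rw [hv, mul_one] at this
    exact this⟩
  map_add' u v := by
    ext φ
    have h1 := integrable_torus (u * φ.1)
    have h2 := integrable_torus (v * φ.1)
    simp only [ContinuousMap.mul_apply] at h1 h2
    change ∫ x, (u + v) x * φ.1 x = (∫ x, u x * φ.1 x) + ∫ x, v x * φ.1 x
    rw [← integral_add h1 h2]
    simp [add_mul]
  map_smul' c u := by
    ext φ
    change ∫ x, (c • u) x * φ.1 x = c * ∫ x, u x * φ.1 x
    rw [← integral_const_mul]
    simp [mul_assoc]

open Classical in
/-- The cube of a distribution that is (integration against) a continuous function `u`, namely the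
distribution given by the pointwise cube `u^3`. The value `0` on other distributions is never used:
for `α > 0` every element of `𝒞^α` is a continuous function. -/
noncomputable def cube {d : ℕ} (T : TorusDistribution d) : TorusDistribution d :=
  if h : ∃ u : C(UnitAddTorus (Fin d), ℝ), ofFunction u = T then ofFunction (h.choose ^ 3) else 0

open Laplacian in
/-- The Laplacian on test functions. -/
noncomputable def laplacianFun {d : ℕ} (φ : TestFunction d) (x : UnitAddTorus (Fin d)) : ℝ :=
  (Δ fun y : EuclideanSpace ℝ (Fin d) => φ.1 (x + toTorus y)) 0

open Laplacian in
theorem laplacianFun_toTorus {d : ℕ} (φ : TestFunction d) (z : EuclideanSpace ℝ (Fin d)) :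
    laplacianFun φ (toTorus z) = (Δ (lift φ)) z := by
  have h : (fun y : EuclideanSpace ℝ (Fin d) => φ.1 (toTorus z + toTorus y)) =
      fun y => lift φ (z + y) := by
    funext y
    rw [lift, toTorus_add]
  rw [laplacianFun, h]
  simp only [InnerProductSpace.laplacian_eq_iteratedFDeriv_stdOrthonormalBasis,
    iteratedFDeriv_comp_add_left, add_zero]


open Laplacian in
theorem contDiff_laplacian_lift {d : ℕ} (φ : TestFunction d) : ContDiff ℝ ∞ (Δ (lift φ)) := by
  rw [InnerProductSpace.laplacian_eq_iteratedFDeriv_stdOrthonormalBasis]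
  simp only [iteratedFDeriv_two_apply]
  refine ContDiff.sum fun i _ => ?_
  have h1 : ContDiff ℝ ∞ (fderiv ℝ (lift φ)) :=
    (contDiff_lift φ).fderiv_right (by simp)
  have h2 : ContDiff ℝ ∞ (fderiv ℝ (fderiv ℝ (lift φ))) := h1.fderiv_right (by simp)
  exact (h2.clm_apply contDiff_const).clm_apply contDiff_const

open Laplacian in
theorem norm_iteratedFDeriv_laplacian_le {d : ℕ} (φ : TestFunction d) (k : ℕ) (M : ℝ)
    (hM : ∀ x, ‖iteratedFDeriv ℝ (k + 2) (lift φ) x‖ ≤ M) (x : EuclideanSpace ℝ (Fin d)) :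
    ‖iteratedFDeriv ℝ k (Δ (lift φ)) x‖ ≤ d * M := by
  have h1 : ContDiff ℝ ∞ (fderiv ℝ (lift φ)) :=
    (contDiff_lift φ).fderiv_right (by simp)
  have h2 : ContDiff ℝ ∞ (fderiv ℝ (fderiv ℝ (lift φ))) := h1.fderiv_right (by simp)
  have h3 : ∀ v : EuclideanSpace ℝ (Fin d),
      ContDiff ℝ ∞ fun x => fderiv ℝ (fderiv ℝ (lift φ)) x v :=
    fun v => h2.clm_apply contDiff_const
  rw [InnerProductSpace.laplacian_eq_iteratedFDeriv_stdOrthonormalBasis]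
  simp only [iteratedFDeriv_two_apply]
  rw [iteratedFDeriv_fun_sum_apply fun i _ =>
    (((h3 _).clm_apply contDiff_const).of_le (mod_cast le_top)).contDiffAt]
  refine (norm_sum_le _ _).trans ?_
  have hb : ∀ i ∈ (Finset.univ : Finset (Fin (Module.finrank ℝ (EuclideanSpace ℝ (Fin d))))),
      ‖iteratedFDeriv ℝ k (fun x => fderiv ℝ (fderiv ℝ (lift φ)) x
        (stdOrthonormalBasis ℝ (EuclideanSpace ℝ (Fin d)) i)
        (stdOrthonormalBasis ℝ (EuclideanSpace ℝ (Fin d)) i)) x‖ ≤ M := by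
    intro i _
    refine (norm_iteratedFDeriv_clm_apply_const (N := ∞) (h3 _).contDiffAt (mod_cast le_top)).trans ?_
    rw [OrthonormalBasis.norm_eq_one, one_mul]
    refine (norm_iteratedFDeriv_clm_apply_const (N := ∞) h2.contDiffAt (mod_cast le_top)).trans ?_
    rw [OrthonormalBasis.norm_eq_one, one_mul, norm_iteratedFDeriv_fderiv,
      norm_iteratedFDeriv_fderiv]
    exact hM x
  refine (Finset.sum_le_card_nsmul _ _ M hb).trans ?_
  simp

theorem two_le_infty : (2 : WithTop ℕ∞) ≤ ∞ :=
  WithTop.coe_le_coe.2 le_top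

/-- The Laplacian `Δ : 𝒮 → 𝒮` as a linear map. -/
noncomputable def testLaplacian {d : ℕ} : TestFunction d →ₗ[ℝ] TestFunction d where
  toFun φ := ⟨⟨laplacianFun φ, by
    rw [(isOpenQuotientMap_toTorus d).isQuotientMap.continuous_iff]
    exact (contDiff_laplacian_lift φ).continuous.congr fun z => (laplacianFun_toTorus φ z).symm⟩, by
    have h := contDiff_laplacian_lift φ
    rw [← funext (laplacianFun_toTorus φ)] at h
    exact h⟩
  map_add' φ ψ := by
    ext x
    obtain ⟨z, rfl⟩ := (isOpenQuotientMap_toTorus d).surjective x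
    change laplacianFun (φ + ψ) _ = laplacianFun φ _ + laplacianFun ψ _
    simp only [laplacianFun_toTorus, lift_add]
    exact ContDiffAt.laplacian_add ((contDiff_lift φ).of_le two_le_infty).contDiffAt
      ((contDiff_lift ψ).of_le two_le_infty).contDiffAt
  map_smul' c φ := by
    ext x
    obtain ⟨z, rfl⟩ := (isOpenQuotientMap_toTorus d).surjective x
    change laplacianFun (c • φ) _ = c • laplacianFun φ _
    simp only [laplacianFun_toTorus, lift_smul]
    exact InnerProductSpace.laplacian_smul c
      ((contDiff_lift φ).of_le two_le_infty).contDiffAt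

open Laplacian in
theorem lift_testLaplacian {d : ℕ} (φ : TestFunction d) : lift (testLaplacian φ) = Δ (lift φ) :=
  funext fun z => laplacianFun_toTorus φ z

/-- The distributional Laplacian, `(Δ T)(φ) = T(Δ φ)`. -/
noncomputable def distLaplacian {d : ℕ} (T : TorusDistribution d) : TorusDistribution d :=
  ⟨T.1 ∘ₗ testLaplacian, by
    obtain ⟨c, n, h⟩ := T.2
    refine ⟨c * d, n + 2, fun φ M hM => ?_⟩
    rw [mul_assoc]
    refine h (testLaplacian φ) (d * M) fun k hk x => ?_
    rw [lift_testLaplacian]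
    exact norm_iteratedFDeriv_laplacian_le φ k M (hM (k + 2) (by omega)) x⟩

/-- The test function `y ↦ k(x - y)`. -/
noncomputable def reflect {d : ℕ} (k : TestFunction d) (x : UnitAddTorus (Fin d)) :
    TestFunction d :=
  ⟨⟨fun y => k.1 (x - y), by fun_prop⟩, by
    obtain ⟨z, rfl⟩ := (isOpenQuotientMap_toTorus d).surjective x
    have h : ContDiff ℝ ∞ fun y : EuclideanSpace ℝ (Fin d) => lift k (z - y) :=
      (contDiff_lift k).comp (contDiff_const.sub contDiff_id)
    have e : (fun y => lift k (z - y)) = fun y => k.1 (toTorus z - toTorus y) := by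
      funext y
      rw [lift, toTorus_sub]
    rw [e] at h
    exact h⟩

theorem lift_reflect {d : ℕ} (k : TestFunction d) (z : EuclideanSpace ℝ (Fin d)) :
    lift (reflect k (toTorus z)) = fun y => lift k (z - y) := by
  funext y
  rw [lift, lift, toTorus_sub]
  rfl

theorem continuous_apply_reflect {d : ℕ} (k : TestFunction d) (T : TorusDistribution d) :
    Continuous fun x => T.1 (reflect k x) := by
  rw [(isOpenQuotientMap_toTorus d).isQuotientMap.continuous_iff]
  obtain ⟨c, n, h⟩ := T.2
  choose B hB using fun j => exists_bound k j
  have hB0 : ∀ j, 0 ≤ B j := fun j => (norm_nonneg _).trans (hB j 0)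
  set S := ∑ j ∈ Finset.range (n + 2), B j with hS
  have hBS : ∀ j ≤ n + 1, B j ≤ S := fun j hj =>
    Finset.single_le_sum (f := B) (fun i _ => hB0 i) (Finset.mem_range.2 (by omega))
  have key : ∀ z w, |T.1 (reflect k (toTorus z)) - T.1 (reflect k (toTorus w))| ≤
      c * (S * ‖z - w‖) := by
    intro z w
    rw [← map_sub]
    refine h _ _ fun j hj y => ?_
    set g := lift k with hg
    have hgc : ContDiff ℝ ∞ g := contDiff_lift k
    have e1 : lift (reflect k (toTorus z) - reflect k (toTorus w)) =
        fun y => ((fun u => g (z - w + u) - g u) ∘ LinearIsometryEquiv.neg ℝ) (y - w) := by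
      funext y
      have h1 := congrFun (lift_reflect k z) y
      have h2 := congrFun (lift_reflect k w) y
      change lift (reflect k (toTorus z)) y - lift (reflect k (toTorus w)) y = _
      rw [h1, h2]
      simp only [Function.comp_apply, LinearIsometryEquiv.coe_neg, neg_sub, hg]
      congr 2
      abel
    rw [e1, iteratedFDeriv_comp_sub, LinearIsometryEquiv.norm_iteratedFDeriv_comp_right]
    set u := (LinearIsometryEquiv.neg ℝ) (y - w)
    have hga : ContDiff ℝ ∞ fun u => g (z - w + u) := hgc.comp (contDiff_const.add contDiff_id)
    have e2 := iteratedFDeriv_sub_apply (i := j) (x := u) (hga.of_le (mod_cast le_top)).contDiffAt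
      (hgc.of_le (mod_cast le_top)).contDiffAt
    rw [iteratedFDeriv_comp_add_left] at e2
    change ‖iteratedFDeriv ℝ j ((fun u => g (z - w + u)) - g) u‖ ≤ _
    rw [e2]
    have hd : Differentiable ℝ (iteratedFDeriv ℝ j g) :=
      hgc.differentiable_iteratedFDeriv (mod_cast WithTop.coe_lt_top j)
    have := Convex.norm_image_sub_le_of_norm_fderiv_le (𝕜 := ℝ) (f := iteratedFDeriv ℝ j g)
      (s := Set.univ) (C := S) (x := u) (y := z - w + u) (fun x _ => hd x)
      (fun x _ => by
        rw [norm_fderiv_iteratedFDeriv]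
        exact (hB (j + 1) x).trans (hBS _ (by omega))) convex_univ trivial trivial
    simpa using this
  refine continuous_iff_continuousAt.2 fun w => ?_
  rw [ContinuousAt, tendsto_iff_norm_sub_tendsto_zero]
  refine squeeze_zero (fun _ => norm_nonneg _) (fun z => key z w) ?_
  have : Continuous fun z : EuclideanSpace ℝ (Fin d) => c * (S * ‖z - w‖) := by fun_prop
  simpa using this.tendsto w

/-- The convolution `(k * T)(x) = T(k(x - ·))` of a distribution with a smooth function, a
continuous function on the torus. -/
noncomputable def convolve {d : ℕ} (k : TestFunction d) (T : TorusDistribution d) :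
    C(UnitAddTorus (Fin d), ℝ) :=
  ⟨fun x => T.1 (reflect k x), continuous_apply_reflect k T⟩


/-- A lattice point of `ℤ^d` as a vector of `ℝ^d`. -/
def latticePoint {d : ℕ} (m : Fin d → ℤ) : EuclideanSpace ℝ (Fin d) :=
  WithLp.toLp 2 fun i => (m i : ℝ)

theorem mFourier_toTorus {d : ℕ} (m : Fin d → ℤ) (z : EuclideanSpace ℝ (Fin d)) :
    UnitAddTorus.mFourier m (toTorus z) =
      Complex.exp (((2 * Real.pi * inner ℝ z (latticePoint m) : ℝ) : ℂ) * Complex.I) := by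
  simp only [UnitAddTorus.mFourier, ContinuousMap.coe_mk, toTorus, fourier_coe_apply]
  rw [← Complex.exp_sum]
  congr 1
  simp only [PiLp.inner_apply, latticePoint, RCLike.inner_apply, conj_trivial]
  push_cast
  rw [Finset.mul_sum, Finset.sum_mul]
  refine Finset.sum_congr rfl fun i _ => ?_
  ring

/-- The function `x ↦ cos (2π⟨x, m⟩)` on the torus, the real part of `x ↦ exp (2πi⟨x, m⟩)`. -/
noncomputable def cosMode {d : ℕ} (m : Fin d → ℤ) (x : UnitAddTorus (Fin d)) : ℝ :=
  (UnitAddTorus.mFourier m x).re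

theorem cosMode_toTorus {d : ℕ} (m : Fin d → ℤ) (z : EuclideanSpace ℝ (Fin d)) :
    cosMode m (toTorus z) = Real.cos (2 * Real.pi * inner ℝ z (latticePoint m)) := by
  rw [cosMode, mFourier_toTorus, Complex.exp_ofReal_mul_I_re]

theorem norm_iteratedFDeriv_cos_le {d : ℕ} (m : Fin d → ℤ) (k : ℕ)
    (z : EuclideanSpace ℝ (Fin d)) :
    ‖iteratedFDeriv ℝ k (fun z => Real.cos (2 * Real.pi * inner ℝ z (latticePoint m))) z‖ ≤
      (2 * Real.pi * ‖latticePoint m‖) ^ k := by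
  set L : EuclideanSpace ℝ (Fin d) →L[ℝ] ℝ := (2 * Real.pi) • innerSL ℝ (latticePoint m) with hL
  have e : (fun z => Real.cos (2 * Real.pi * inner ℝ z (latticePoint m))) = Real.cos ∘ L := by
    funext z
    simp [hL, real_inner_comm]
  rw [e, L.iteratedFDeriv_comp_right (n := ∞) Real.contDiff_cos z (mod_cast le_top)]
  refine (ContinuousMultilinearMap.norm_compContinuousLinearMap_le _ _).trans ?_
  rw [norm_iteratedFDeriv_eq_norm_iteratedDeriv]
  have hLn : ‖L‖ = 2 * Real.pi * ‖latticePoint m‖ := by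
    rw [hL, norm_smul, innerSL_apply_norm, Real.norm_of_nonneg (by positivity)]
  rw [Finset.prod_const, Finset.card_univ, Fintype.card_fin, hLn]
  exact mul_le_of_le_one_left (by positivity) (Real.abs_iteratedDeriv_cos_le_one k _)

/-- The smooth function `x ↦ ∑_{m ∈ ℤ^d} a(m) cos (2π⟨x, m⟩)` on the torus, for rapidly decreasing
coefficients `a`. -/
noncomputable def cosSeries {d : ℕ} (a : (Fin d → ℤ) → ℝ)
    (ha : ∀ k : ℕ, Summable fun m => |a m| * ‖latticePoint m‖ ^ k) : TestFunction d :=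
  ⟨⟨fun x => ∑' m, a m * cosMode m x, by
    refine continuous_tsum (u := fun m => |a m|) (fun m => ?_) (by simpa using ha 0) fun m x => ?_
    · exact continuous_const.mul (Complex.continuous_re.comp (UnitAddTorus.mFourier m).continuous)
    · rw [norm_mul, Real.norm_eq_abs]
      refine mul_le_of_le_one_right (abs_nonneg _) ?_
      refine (Complex.abs_re_le_norm _).trans ?_
      exact ((UnitAddTorus.mFourier m).norm_coe_le_norm x).trans UnitAddTorus.mFourier_norm.le⟩, by
    change ContDiff ℝ ∞ fun z => ∑' m, a m * cosMode m (toTorus z)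
    simp only [cosMode_toTorus]
    have hc : ∀ m : Fin d → ℤ, ContDiff ℝ ∞ fun z : EuclideanSpace ℝ (Fin d) =>
        Real.cos (2 * Real.pi * inner ℝ z (latticePoint m)) := fun m =>
      Real.contDiff_cos.comp (contDiff_const.mul (contDiff_id.inner ℝ contDiff_const))
    refine contDiff_tsum (N := (⊤ : ℕ∞))
      (v := fun k m => (2 * Real.pi) ^ k * (|a m| * ‖latticePoint m‖ ^ k))
      (fun m => contDiff_const.mul (hc m)) (fun k _ => (ha k).mul_left _) fun k m z _ => ?_
    have h1 := iteratedFDeriv_const_smul_apply (𝕜 := ℝ) (a := a m)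
      (((hc m).of_le (m := (k : WithTop ℕ∞)) (mod_cast le_top)).contDiffAt (x := z))
    have h2 : (fun z => a m * Real.cos (2 * Real.pi * inner ℝ z (latticePoint m))) =
      a m • fun z => Real.cos (2 * Real.pi * inner ℝ z (latticePoint m)) := rfl
    rw [h2, h1, norm_smul, Real.norm_eq_abs]
    refine (mul_le_mul_of_nonneg_left (norm_iteratedFDeriv_cos_le m k z) (abs_nonneg _)).trans ?_
    rw [mul_pow]
    exact le_of_eq (by ring)⟩

theorem abs_le_norm_latticePoint {d : ℕ} (m : Fin d → ℤ) (i : Fin d) :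
    |(m i : ℝ)| ≤ ‖latticePoint m‖ := by
  simpa [latticePoint] using PiLp.norm_apply_le (latticePoint m) i

theorem finite_norm_latticePoint_le (d : ℕ) (R : ℝ) :
    {m : Fin d → ℤ | ‖latticePoint m‖ ≤ R}.Finite := by
  refine (Set.finite_Icc (fun _ : Fin d => -⌈R⌉) fun _ => ⌈R⌉).subset fun m hm => ?_
  have h : ∀ i, |m i| ≤ ⌈R⌉ := fun i => by
    have := ((abs_le_norm_latticePoint m i).trans hm).trans (Int.le_ceil R)
    exact_mod_cast this
  exact ⟨fun i => (abs_le.1 (h i)).1, fun i => (abs_le.1 (h i)).2⟩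

theorem summable_prod_pi (d : ℕ) (f : ℤ → ℝ) (hf0 : ∀ n, 0 ≤ f n) (hf : Summable f) :
    Summable fun m : Fin d → ℤ => ∏ i, f (m i) := by
  induction d with
  | zero => exact Summable.of_finite
  | succ d ih =>
    rw [← (Fin.consEquiv fun _ : Fin (d + 1) => ℤ).summable_iff]
    have := hf.mul_of_nonneg ih hf0 fun m => Finset.prod_nonneg fun i _ => hf0 _
    refine this.congr fun p => ?_
    simp [Fin.prod_univ_succ, Fin.consEquiv]

theorem summable_heat (d : ℕ) {r : ℝ} (hr : 0 < r) (k : ℕ) :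
    Summable fun m : Fin d → ℤ => |Real.exp (-r * (2 * Real.pi * ‖latticePoint m‖) ^ 4)| *
      ‖latticePoint m‖ ^ k := by
  have hf : Summable fun n : ℤ => (1 + (n : ℝ) ^ 2)⁻¹ := by
    refine Summable.of_norm_bounded_eventually (g := fun n : ℤ => 1 / (n : ℝ) ^ 2)
      (Real.summable_one_div_int_pow.2 (by norm_num)) ?_
    filter_upwards [(Set.finite_singleton (0 : ℤ)).compl_mem_cofinite] with n hn
    have hn' : (n : ℝ) ≠ 0 := by exact_mod_cast hn
    rw [Real.norm_of_nonneg (by positivity), ← one_div]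
    gcongr
    linarith
  have hs := summable_prod_pi d _ (fun n => by positivity) hf
  set n := k + 2 * d with hn
  set s := r * (2 * Real.pi) ^ 4 with hs'
  have hsp : 0 < s := by positivity
  set C : ℝ := 2 ^ d * (1 + n.factorial / s ^ n) with hC
  refine Summable.of_nonneg_of_le (fun m => by positivity) (fun m => ?_) (hs.mul_left C)
  set t := ‖latticePoint m‖ with ht
  have ht0 : 0 ≤ t := norm_nonneg _
  rw [abs_of_pos (Real.exp_pos _)]
  have hE : -r * (2 * Real.pi * t) ^ 4 = -(s * t ^ 4) := by rw [hs']; ring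
  rw [hE, Real.exp_neg]
  have hprod : ((1 + t ^ 2) ^ d)⁻¹ ≤ ∏ i, (1 + (m i : ℝ) ^ 2)⁻¹ := by
    rw [Finset.prod_inv_distrib]
    refine inv_anti₀ (Finset.prod_pos fun i _ => by positivity) ?_
    have := Finset.prod_le_prod (s := Finset.univ) (f := fun i => 1 + (m i : ℝ) ^ 2)
      (g := fun _ => 1 + t ^ 2) (fun i _ => by positivity) fun i _ => by
        have := pow_le_pow_left₀ (abs_nonneg _) (abs_le_norm_latticePoint m i) 2
        rw [sq_abs] at this
        linarith
    simpa using this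
  refine le_trans ?_ (mul_le_mul_of_nonneg_left hprod (by positivity))
  rw [← div_eq_mul_inv, le_div_iff₀ (by positivity), inv_mul_eq_div, div_mul_eq_mul_div,
    div_le_iff₀ (Real.exp_pos _)]
  have hexp : (s * t ^ 4) ^ n / n.factorial ≤ Real.exp (s * t ^ 4) :=
    Real.pow_div_factorial_le_exp _ (by positivity) n
  have hexp1 : 1 ≤ Real.exp (s * t ^ 4) := Real.one_le_exp (by positivity)
  rcases le_total t 1 with h1 | h1
  · have a1 : t ^ k ≤ 1 := pow_le_one₀ ht0 h1
    have a2 : (1 + t ^ 2) ^ d ≤ 2 ^ d := by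
      gcongr
      nlinarith
    have a3 : (2 : ℝ) ^ d ≤ C := by
      rw [hC]
      refine le_mul_of_one_le_right (by positivity) ?_
      have : 0 ≤ n.factorial / s ^ n := by positivity
      linarith
    calc t ^ k * (1 + t ^ 2) ^ d ≤ 1 * 2 ^ d := by gcongr
      _ ≤ C * 1 := by linarith
      _ ≤ C * Real.exp (s * t ^ 4) := by gcongr
  · have a1 : t ^ k * (1 + t ^ 2) ^ d ≤ 2 ^ d * t ^ (4 * n) := by
      calc t ^ k * (1 + t ^ 2) ^ d ≤ t ^ k * (2 * t ^ 2) ^ d := by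
            gcongr
            nlinarith
        _ = 2 ^ d * t ^ (k + 2 * d) := by ring
        _ ≤ 2 ^ d * t ^ (4 * n) := by
            gcongr 2 ^ d * ?_
            exact pow_le_pow_right₀ h1 (by omega)
    have a2 : t ^ (4 * n) ≤ n.factorial / s ^ n * Real.exp (s * t ^ 4) := by
      rw [div_mul_eq_mul_div, le_div_iff₀ (by positivity)]
      rw [div_le_iff₀ (by positivity)] at hexp
      calc t ^ (4 * n) * s ^ n = (s * t ^ 4) ^ n := by rw [mul_pow s, ← pow_mul, mul_comm]
        _ ≤ _ := hexp
        _ = _ := by ring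
    calc _ ≤ 2 ^ d * t ^ (4 * n) := a1
      _ ≤ 2 ^ d * (n.factorial / s ^ n * Real.exp (s * t ^ 4)) := by gcongr
      _ ≤ 2 ^ d * ((1 + n.factorial / s ^ n) * Real.exp (s * t ^ 4)) := by
          gcongr
          linarith
      _ = _ := by rw [hC]; ring


/-- The test function `x ↦ Re (c exp (2πi⟨x, m⟩))`. -/
noncomputable def trigMode {d : ℕ} (c : ℂ) (m : Fin d → ℤ) : TestFunction d :=
  ⟨⟨fun x => (c * UnitAddTorus.mFourier m x).re, by fun_prop⟩, by
    change ContDiff ℝ ∞ fun z => (c * UnitAddTorus.mFourier m (toTorus z)).re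
    simp only [mFourier_toTorus]
    have h : ContDiff ℝ ∞ fun z : EuclideanSpace ℝ (Fin d) =>
        2 * Real.pi * inner ℝ z (latticePoint m) :=
      contDiff_const.mul (contDiff_id.inner ℝ contDiff_const)
    exact Complex.reCLM.contDiff.comp (contDiff_const.mul
      ((Complex.ofRealCLM.contDiff.comp h).mul contDiff_const).cexp)⟩

theorem ofFunction_injective (d : ℕ) :
    Function.Injective (ofFunction : C(UnitAddTorus (Fin d), ℝ) →ₗ[ℝ] TorusDistribution d) := by
  rw [injective_iff_map_eq_zero]
  intro w hw
  have hφ : ∀ φ : TestFunction d, ∫ x, w x * φ.1 x = 0 := fun φ => by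
    have := congrArg (fun T : TorusDistribution d => T.1 φ) hw
    exact this
  set wc : C(UnitAddTorus (Fin d), ℂ) := ⟨fun x => (w x : ℂ), by fun_prop⟩ with hwc
  have hint : ∀ g : C(UnitAddTorus (Fin d), ℂ), Integrable fun x => wc x * g x := fun g =>
    (wc * g).continuous.integrable_of_hasCompactSupport (HasCompactSupport.of_compactSpace _)
  have hm : ∀ m, ∫ x, wc x * UnitAddTorus.mFourier m x = 0 := by
    intro m
    have hi := hint (UnitAddTorus.mFourier m)
    apply Complex.ext
    · have h1 := hφ (trigMode 1 m)
      have h2 := Complex.reCLM.integral_comp_comm hi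
      simp only [Complex.reCLM_apply] at h2
      rw [← h2, Complex.zero_re, ← h1]
      refine integral_congr_ae (ae_of_all _ fun x => ?_)
      simp [hwc, trigMode]
    · have h1 := hφ (trigMode (-Complex.I) m)
      have h2 := Complex.imCLM.integral_comp_comm hi
      simp only [Complex.imCLM_apply] at h2
      rw [← h2, Complex.zero_im, ← h1]
      refine integral_congr_ae (ae_of_all _ fun x => ?_)
      simp [hwc, trigMode]
  have hv : (volume : Measure (UnitAddTorus (Fin d))).real Set.univ = 1 := by
    simp [Measure.real, volume_pi, Measure.pi_univ]
  let Λ : C(UnitAddTorus (Fin d), ℂ) →L[ℂ] ℂ := LinearMap.mkContinuous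
    { toFun := fun g => ∫ x, wc x * g x
      map_add' := fun g g' => by
        rw [← integral_add (hint g) (hint g')]
        simp [mul_add]
      map_smul' := fun c g => by
        rw [RingHom.id_apply, smul_eq_mul, ← integral_const_mul]
        simp [mul_left_comm] } ‖wc‖ fun g => by
    have := norm_integral_le_of_norm_le_const (μ := (volume : Measure (UnitAddTorus (Fin d))))
      (f := fun x => wc x * g x) (C := ‖wc‖ * ‖g‖) (ae_of_all _ fun x => by
        rw [norm_mul]
        exact mul_le_mul (wc.norm_coe_le_norm x) (g.norm_coe_le_norm x) (norm_nonneg _)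
          (norm_nonneg _))
    rw [hv, mul_one] at this
    exact this
  have hΛ : ∀ g, Λ g = ∫ x, wc x * g x := fun _ => rfl
  have hker : (⊤ : Submodule ℂ C(UnitAddTorus (Fin d), ℂ)) ≤ LinearMap.ker Λ.toLinearMap := by
    rw [← UnitAddTorus.span_mFourier_closure_eq_top]
    refine Submodule.topologicalClosure_minimal _ (Submodule.span_le.2 ?_) Λ.isClosed_ker
    rintro _ ⟨m, rfl⟩
    exact hm m
  have h0 : ∫ x, w x * w x = 0 := by
    have h1 : ∫ x, wc x * wc x = 0 := hker (Submodule.mem_top (x := wc))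
    have h2 : ∀ x, wc x * wc x = ((w x * w x : ℝ) : ℂ) := fun x => by simp [hwc]
    simp only [h2] at h1
    rw [integral_complex_ofReal] at h1
    exact_mod_cast h1
  have h3 := (integral_eq_zero_iff_of_nonneg (fun x => mul_self_nonneg (w x))
    (integrable_torus (w * w))).1 h0
  have h4 := (Continuous.ae_eq_iff_eq volume (by fun_prop) continuous_zero).1 h3
  ext x
  simpa using congrFun h4 x

theorem cube_ofFunction {d : ℕ} (u : C(UnitAddTorus (Fin d), ℝ)) :
    cube (ofFunction u) = ofFunction (u ^ 3) := by
  have h : ∃ v : C(UnitAddTorus (Fin d), ℝ), ofFunction v = ofFunction u := ⟨u, rfl⟩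
  rw [cube, dif_pos h, ofFunction_injective d h.choose_spec]

/-- The kernel `η_r(x) = ∑_{m ∈ ℤ^d} exp (-r |2πm|^4) cos (2π⟨x, m⟩)` of `exp (-r Δ²)`, `r > 0`. -/
noncomputable def heatKernel (d : ℕ) {r : ℝ} (hr : 0 < r) : TestFunction d :=
  cosSeries (fun m => Real.exp (-r * (2 * Real.pi * ‖latticePoint m‖) ^ 4)) (summable_heat d hr)

open Classical in
/-- The semigroup `P_r T = η_r * T` for `r > 0` and `P_0 T = T`. -/
noncomputable def semigroup {d : ℕ} (r : ℝ) (T : TorusDistribution d) : TorusDistribution d :=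
  if hr : 0 < r then ofFunction (convolve (heatKernel d hr) T) else T

/-- A dyadic partition of unity `(ρ_{-1}, ρ_0)` on `ℝ^d`. -/
structure DyadicPartition (d : ℕ) where
  /-- The function `ρ_{-1}`. -/
  low : EuclideanSpace ℝ (Fin d) → ℝ
  /-- The function `ρ_0`. -/
  annulus : EuclideanSpace ℝ (Fin d) → ℝ
  low_smooth : ContDiff ℝ ∞ low
  annulus_smooth : ContDiff ℝ ∞ annulus
  low_nonneg : ∀ x, 0 ≤ low x
  annulus_nonneg : ∀ x, 0 ≤ annulus x
  low_radial : ∀ x y, ‖x‖ = ‖y‖ → low x = low y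
  annulus_radial : ∀ x y, ‖x‖ = ‖y‖ → annulus x = annulus y
  low_support : tsupport low ⊆ {x | ‖x‖ ≤ 4 / 3}
  annulus_support : tsupport annulus ⊆ {x | 3 / 4 ≤ ‖x‖ ∧ ‖x‖ ≤ 8 / 3}
  sum_eq_one : ∀ x, low x + ∑' q : ℕ, annulus (((2 : ℝ) ^ q)⁻¹ • x) = 1

/-- The function `ρ_{j-1}`: `ρ_{-1}` for `j = 0` and `x ↦ ρ_0(2^{-(j-1)} x)` for `j ≥ 1`. -/
noncomputable def DyadicPartition.cutoff {d : ℕ} (ρ : DyadicPartition d) :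
    ℕ → EuclideanSpace ℝ (Fin d) → ℝ
  | 0 => ρ.low
  | q + 1 => fun x => ρ.annulus (((2 : ℝ) ^ q)⁻¹ • x)

theorem DyadicPartition.summable_cutoff {d : ℕ} (ρ : DyadicPartition d) (j k : ℕ) :
    Summable fun m : Fin d → ℤ => |ρ.cutoff j (latticePoint m)| * ‖latticePoint m‖ ^ k := by
  refine summable_of_hasFiniteSupport
    ((finite_norm_latticePoint_le d (2 ^ j * (8 / 3))).subset fun m hm => ?_)
  have h0 : ρ.cutoff j (latticePoint m) ≠ 0 := fun h => hm (by simp [h])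
  cases j with
  | zero =>
    have := ρ.low_support (subset_tsupport _ h0)
    simp only [Set.mem_ofPred_eq] at this ⊢
    linarith
  | succ q =>
    have := (ρ.annulus_support (subset_tsupport _ h0)).2
    simp only [Set.mem_ofPred_eq] at this ⊢
    rw [norm_smul, norm_inv, norm_pow, Real.norm_ofNat, inv_mul_le_iff₀ (by positivity)] at this
    refine this.trans ?_
    gcongr
    · norm_num
    · omega

/-- The kernel `K_{j-1}(x) = ∑_{m ∈ ℤ^d} ρ_{j-1}(m) cos (2π⟨x, m⟩)`. -/
noncomputable def blockKernel {d : ℕ} (ρ : DyadicPartition d) (j : ℕ) : TestFunction d :=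
  cosSeries (fun m => ρ.cutoff j (latticePoint m)) (ρ.summable_cutoff j)

/-- The Littlewood-Paley block `Δ_{j-1} T = K_{j-1} * T`. -/
noncomputable def block {d : ℕ} (ρ : DyadicPartition d) (j : ℕ) (T : TorusDistribution d) :
    C(UnitAddTorus (Fin d), ℝ) :=
  convolve (blockKernel ρ j) T

/-- `2^{α(j-1)} ‖Δ_{j-1} T‖_{L^∞}`; the norm of `C(𝕋^d, ℝ)` is the supremum norm, which for
continuous functions is the `L^∞` norm. -/
noncomputable def weightedBlockNorm {d : ℕ} (ρ : DyadicPartition d) (α : ℝ) (T : TorusDistribution d)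
    (j : ℕ) : ℝ :=
  (2 : ℝ) ^ (α * ((j : ℝ) - 1)) * ‖block ρ j T‖

/-- The norm `‖T‖_α = sup_j 2^{α(j-1)} ‖Δ_{j-1} T‖_{L^∞}`, with values in `[0, ∞]`. -/
noncomputable def holderNorm {d : ℕ} (ρ : DyadicPartition d) (α : ℝ) (T : TorusDistribution d) :
    ENNReal :=
  ⨆ j : ℕ, ENNReal.ofReal (weightedBlockNorm ρ α T j)

/-- The space `𝒞^α` of the distributions `T` with `2^{αq} ‖Δ_q T‖_{L^∞} → 0` as `q → ∞`. -/
def HolderBesov {d : ℕ} (ρ : DyadicPartition d) (α : ℝ) : Set (TorusDistribution d) :=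
  {T | Tendsto (weightedBlockNorm ρ α T) atTop (𝓝 0)}

/-- `h ∈ C_U 𝒞^α`: on `[0, U]`, `h` takes values in `𝒞^α` and is continuous for `‖·‖_α`. -/
def ContinuousInHolder {d : ℕ} (ρ : DyadicPartition d) (α U : ℝ) (h : ℝ → TorusDistribution d) :
    Prop :=
  (∀ r ∈ Set.Icc 0 U, h r ∈ HolderBesov ρ α) ∧
    ∀ r ∈ Set.Icc 0 U, Tendsto (fun s => holderNorm ρ α (h s - h r)) (𝓝[Set.Icc 0 U] r) (𝓝 0)

/-- `I = ∫_a^b F(q) dq` for a function `F` with values in `𝒮'`: the integral is taken after pairing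
with each test function. -/
def HasDistIntegral {d : ℕ} (F : ℝ → TorusDistribution d) (a b : ℝ) (I : TorusDistribution d) : Prop :=
  ∀ φ : TestFunction d, IntervalIntegrable (fun q => (F q).1 φ) volume a b ∧
    I.1 φ = ∫ q in a..b, (F q).1 φ

/-- `f ∈ ⋂_{U ∈ [0, β)} C_U 𝒞^α` solves, for all `r ∈ [0, β)`,
`f(r) = P_r g₁ + g₂(r) + ∫_0^r P_{r-q}(Δ(f(q)^3 - f(q))) dq`. -/
structure IsMildSolution {d : ℕ} (ρ : DyadicPartition d) (α : ℝ) (g₁ : TorusDistribution d)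
    (g₂ : ℝ → TorusDistribution d) (β : EReal) (f : ℝ → TorusDistribution d) : Prop where
  continuousInHolder : ∀ U : ℝ, 0 ≤ U → (U : EReal) < β → ContinuousInHolder ρ α U f
  equation : ∀ r : ℝ, 0 ≤ r → (r : EReal) < β → ∃ I : TorusDistribution d,
    HasDistIntegral (fun q => semigroup (r - q) (distLaplacian (cube (f q) - f q))) 0 r I ∧
      f r = semigroup r g₁ + g₂ r + I

end CahnHilliard

open CahnHilliard

/-!
Mild solutions are constructed in the Banach space `C(𝕋^d)` with the supremum norm, and their
regularity in `𝒞^α` is recovered afterwards.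

Since `α > 0`, a distribution in `𝒞^α` is the absolutely convergent sum of its Littlewood-Paley
blocks, so it is a continuous function whose supremum norm is at most a constant times `‖·‖_α`
(`exists_ofFunction`, `norm_le_of_holderNorm_le`). This uses that a distribution is determined by
its Fourier coefficients (`ext_distCoeff`), because the Fourier series of a smooth function converges
with all derivatives.

On continuous functions `P_tΔ` and `Δ_j P_t Δ` are convolutions whose operator norm is at most
the `L²` norm of the kernel, which Parseval's identity turns into a lattice sum. For `α < a < 2 - d/2`
this gives norms of order `t^{-γ}` and `2^{-aj} t^{-γ}` with `γ = (1 + a/2 + d/4)/2 < 1`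
(`exists_norm_lapHeatOp_le`). Hence no product estimate in Besov spaces is needed: `u ↦ u³ - u` is
locally Lipschitz on `C(𝕋^d)`, the singularity is integrable, and the Duhamel term is continuous in
`𝒞^α` because its blocks decay like `2^{-aj}` with `a > α` (`continuousInHolder_volterra`).

The uniform bound for `P_t` on `C(𝕋^d)` (`exists_norm_heatOp_le`) requires the `L¹` norm of `η_t`. The
kernel is not positive; its `L¹` norm is bounded by the Cauchy-Schwarz inequality with the weight
`1 + t^{-1/2} ∑_i (2 - 2 cos (2πx_i))`, whose inverse is square integrable of the right order for
`d ≤ 3`, and which acts on the symbol `exp (-t|2πm|⁴)` as a second difference operator.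

The equation thus becomes a Volterra equation with singular kernel in a Banach space. With a globally
Lipschitz truncation of the nonlinearity it is solved on every interval `[0, T]` by the contraction
principle for an exponentially weighted norm (`IsSingularKernel.existsUnique_of_lipschitz`).
Solutions of the original equation are unique, so they glue to a maximal one, and a bounded solution
on a bounded interval can be extended. Finally the norm tends to infinity, and is not merely
unbounded: restarting the equation from a time `s` with `‖f(s)‖ ≤ M`, the solution needs a time
depending only on `M` to leave a larger ball, so returning to a fixed ball arbitrarily close to the
end of the interval of existence would keep the solution bounded
(`IsVolterraSolution.exists_bound_of_frequently`).
-/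


namespace CahnHilliard

/-! ### Fourier coefficients and convolution on the torus -/

/-- The torus `𝕋^d`. -/
abbrev Torus (d : ℕ) : Type := UnitAddTorus (Fin d)

/-- The Lebesgue measure of the torus is the product of the Haar probability measures, the measure
in terms of which Mathlib states Parseval's identity. -/
theorem volume_torus_eq (d : ℕ) :
    (volume : Measure (Torus d)) = Measure.pi fun _ => AddCircle.haarAddCircle := by
  rw [volume_pi]
  congr 1
  funext i
  rw [AddCircle.volume_eq_smul_haarAddCircle]
  simp

instance isProbabilityMeasure_torus (d : ℕ) : IsProbabilityMeasure (volume : Measure (Torus d)) :=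
  ⟨by simp [volume_pi, Measure.pi_univ]⟩

instance isAddLeftInvariant_torus (d : ℕ) :
    (volume : Measure (Torus d)).IsAddLeftInvariant := by
  rw [volume_torus_eq]; infer_instance

instance isNegInvariant_torus (d : ℕ) : (volume : Measure (Torus d)).IsNegInvariant := by
  have : (AddCircle.haarAddCircle : Measure UnitAddCircle).IsNegInvariant :=
    Measure.IsAddHaarMeasure.isNegInvariant_of_regular _
  rw [volume_torus_eq]; infer_instance

theorem integrable_of_continuous {d : ℕ} {F : Type*} [NormedAddCommGroup F] {f : Torus d → F}
    (hf : Continuous f) : Integrable f :=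
  hf.integrable_of_hasCompactSupport (HasCompactSupport.of_compactSpace _)

theorem norm_mFourier_apply {d : ℕ} (m : Fin d → ℤ) (x : Torus d) :
    ‖UnitAddTorus.mFourier m x‖ = 1 := by
  simp only [UnitAddTorus.mFourier, ContinuousMap.coe_mk, norm_prod, fourier_apply,
    Circle.norm_coe, Finset.prod_const_one]

theorem mFourier_sub_apply {d : ℕ} (m : Fin d → ℤ) (x y : Torus d) :
    UnitAddTorus.mFourier m (x - y) =
      UnitAddTorus.mFourier m x * UnitAddTorus.mFourier (-m) y := by
  rw [UnitAddTorus.mFourier_neg]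
  simp only [UnitAddTorus.mFourier, ContinuousMap.coe_mk, Pi.sub_apply, map_prod,
    ← Finset.prod_mul_distrib]
  refine Finset.prod_congr rfl fun i _ => ?_
  rw [fourier_apply, fourier_apply, fourier_apply, smul_sub, sub_eq_add_neg,
    AddCircle.toCircle_add, AddCircle.toCircle_neg, Circle.coe_mul, Circle.coe_inv_eq_conj]

/-- The Fourier coefficient `∫ e^{-2πi⟨x, m⟩} u(x) dx` of a real continuous function, as a
continuous linear map of `u`. -/
noncomputable def coeff {d : ℕ} (m : Fin d → ℤ) : C(Torus d, ℝ) →L[ℝ] ℂ :=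
  LinearMap.mkContinuous
    { toFun := fun u => ∫ x, UnitAddTorus.mFourier (-m) x * (u x : ℂ)
      map_add' := fun u v => by
        rw [← integral_add (integrable_of_continuous (by fun_prop))
          (integrable_of_continuous (by fun_prop))]
        simp [mul_add]
      map_smul' := fun c u => by
        rw [RingHom.id_apply, Complex.real_smul, ← integral_const_mul]
        simp [mul_left_comm] } 1 fun u => by
    have := norm_integral_le_of_norm_le_const (μ := (volume : Measure (Torus d)))
      (f := fun x => UnitAddTorus.mFourier (-m) x * (u x : ℂ)) (C := ‖u‖) (ae_of_all _ fun x => by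
        rw [norm_mul, norm_mFourier_apply, one_mul, Complex.norm_real]
        exact u.norm_coe_le_norm x)
    simpa using this

theorem coeff_apply {d : ℕ} (m : Fin d → ℤ) (u : C(Torus d, ℝ)) :
    coeff m u = ∫ x, UnitAddTorus.mFourier (-m) x * (u x : ℂ) := rfl

/-- Parseval's identity. -/
theorem hasSum_sq_coeff {d : ℕ} (u : C(Torus d, ℝ)) :
    HasSum (fun m => ‖coeff m u‖ ^ 2) (∫ x, u x ^ 2) := by
  set f : C(Torus d, ℂ) := ⟨fun x => (u x : ℂ), by fun_prop⟩
  have h := UnitAddTorus.hasSum_sq_mFourierCoeff (ContinuousMap.toLp 2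
    (Measure.pi fun _ => AddCircle.haarAddCircle) ℂ f)
  have h1 : ∀ m, UnitAddTorus.mFourierCoeff (ContinuousMap.toLp 2
      (Measure.pi fun _ => AddCircle.haarAddCircle) ℂ f) m = coeff m u := fun m => by
    rw [coeff_apply, volume_torus_eq]
    exact UnitAddTorus.mFourierCoeff_toLp f m
  have h2 : ∫ x, u x ^ 2 = ∫ t, ‖ContinuousMap.toLp (E := ℂ) 2
      (Measure.pi fun _ => AddCircle.haarAddCircle) ℂ f t‖ ^ 2
      ∂(Measure.pi fun _ : Fin d => AddCircle.haarAddCircle) := by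
    rw [volume_torus_eq]
    refine integral_congr_ae ?_
    filter_upwards [ContinuousMap.coeFn_toLp (p := 2) (𝕜 := ℂ)
      (Measure.pi fun _ : Fin d => AddCircle.haarAddCircle) f] with x hx
    rw [hx]
    simp [f]
  rw [h2]
  simp only [h1] at h
  exact h

theorem eq_zero_of_coeff_eq_zero {d : ℕ} {u : C(Torus d, ℝ)} (h : ∀ m, coeff m u = 0) : u = 0 := by
  have h0 : ∫ x, u x ^ 2 = 0 := by
    have := hasSum_sq_coeff u
    simp only [h, norm_zero, ne_eq, OfNat.ofNat_ne_zero, not_false_eq_true, zero_pow] at this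
    exact this.unique hasSum_zero
  have h3 := (integral_eq_zero_iff_of_nonneg (fun x => sq_nonneg (u x))
    (integrable_of_continuous (by fun_prop))).1 h0
  have h4 := (Continuous.ae_eq_iff_eq (volume : Measure (Torus d)) (by fun_prop)
    continuous_zero).1 h3
  ext x
  simpa using congrFun h4 x

/-- A continuous function is determined by its Fourier coefficients. -/
theorem ext_coeff {d : ℕ} {u v : C(Torus d, ℝ)} (h : ∀ m, coeff m u = coeff m v) : u = v :=
  sub_eq_zero.1 (eq_zero_of_coeff_eq_zero fun m => by rw [map_sub, h, sub_self])

/-- The convolution `(k * u)(x) = ∫ u(y) k(x - y) dy` of continuous functions. -/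
noncomputable def convFun {d : ℕ} (k u : C(Torus d, ℝ)) : C(Torus d, ℝ) :=
  ⟨fun x => ∫ y, u y * k (x - y), by
    refine continuous_of_dominated (bound := fun _ => ‖u‖ * ‖k‖)
      (fun x => (Continuous.aestronglyMeasurable (by fun_prop)))
      (fun x => ae_of_all _ fun y => ?_) (integrable_const _)
      (ae_of_all _ fun y => by fun_prop)
    rw [norm_mul]
    exact mul_le_mul (u.norm_coe_le_norm y) (k.norm_coe_le_norm _) (norm_nonneg _) (norm_nonneg _)⟩

theorem convFun_apply {d : ℕ} (k u : C(Torus d, ℝ)) (x : Torus d) :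
    convFun k u x = ∫ y, u y * k (x - y) := rfl

theorem norm_convFun_le {d : ℕ} (k u : C(Torus d, ℝ)) :
    ‖convFun k u‖ ≤ (∫ x, |k x|) * ‖u‖ := by
  rw [ContinuousMap.norm_le _ (mul_nonneg (integral_nonneg fun _ => abs_nonneg _) (norm_nonneg _))]
  intro x
  rw [convFun_apply, ← integral_sub_left_eq_self (fun y => |k y|) volume x, mul_comm,
    ← integral_const_mul]
  refine norm_integral_le_of_norm_le (integrable_of_continuous (by fun_prop))
    (ae_of_all _ fun y => ?_)
  rw [norm_mul]
  exact mul_le_mul_of_nonneg_right (u.norm_coe_le_norm y) (norm_nonneg _)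

/-- Convolution with a continuous kernel as a bounded operator on `C(𝕋^d)`. -/
noncomputable def conv {d : ℕ} (k : C(Torus d, ℝ)) : C(Torus d, ℝ) →L[ℝ] C(Torus d, ℝ) :=
  LinearMap.mkContinuous
    { toFun := convFun k
      map_add' := fun u v => by
        ext x
        simp only [ContinuousMap.add_apply, convFun_apply, add_mul]
        exact integral_add (integrable_of_continuous (by fun_prop))
          (integrable_of_continuous (by fun_prop))
      map_smul' := fun c u => by
        ext x
        simp only [ContinuousMap.smul_apply, convFun_apply, smul_eq_mul, mul_assoc,
          integral_const_mul, RingHom.id_apply] } (∫ x, |k x|) (norm_convFun_le k)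

theorem conv_apply {d : ℕ} (k u : C(Torus d, ℝ)) (x : Torus d) :
    conv k u x = ∫ y, u y * k (x - y) := rfl

theorem norm_conv_le_integral {d : ℕ} (k : C(Torus d, ℝ)) : ‖conv k‖ ≤ ∫ x, |k x| :=
  LinearMap.mkContinuous_norm_le _ (integral_nonneg fun _ => abs_nonneg _) _

theorem integral_abs_mul_le {d : ℕ} (u v : C(Torus d, ℝ)) :
    (∫ x, |u x * v x|) ^ 2 ≤ (∫ x, u x ^ 2) * ∫ x, v x ^ 2 := by
  have h := integral_mul_le_Lp_mul_Lq_of_nonneg (μ := (volume : Measure (Torus d)))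
    (f := fun x => |u x|) (g := fun x => |v x|) (p := 2) (q := 2)
    (Real.holderConjugate_iff.2 ⟨by norm_num, by norm_num⟩)
    (ae_of_all _ fun x => abs_nonneg _) (ae_of_all _ fun x => abs_nonneg _)
    ((Continuous.memLp_of_hasCompactSupport (by fun_prop) (HasCompactSupport.of_compactSpace _)))
    ((Continuous.memLp_of_hasCompactSupport (by fun_prop) (HasCompactSupport.of_compactSpace _)))
  have hp : ∀ w : C(Torus d, ℝ), (∫ x, |w x| ^ (2 : ℝ)) = ∫ x, w x ^ 2 := fun w => by
    refine integral_congr_ae (ae_of_all _ fun x => ?_)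
    simp
  rw [hp, hp, ← Real.sqrt_eq_rpow, ← Real.sqrt_eq_rpow] at h
  have hu : 0 ≤ ∫ x, u x ^ 2 := integral_nonneg fun _ => sq_nonneg _
  have hv : 0 ≤ ∫ x, v x ^ 2 := integral_nonneg fun _ => sq_nonneg _
  have h0 : 0 ≤ ∫ x, |u x * v x| := integral_nonneg fun _ => abs_nonneg _
  simp only [← abs_mul] at h
  refine (pow_le_pow_left₀ h0 h 2).trans ?_
  rw [mul_pow, Real.sq_sqrt hu, Real.sq_sqrt hv]

/-- The operator norm of a convolution is at most the `L²` norm of the kernel, hence at most the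
`ℓ²` norm of its Fourier coefficients. -/
theorem norm_conv_le {d : ℕ} (k : C(Torus d, ℝ)) {A : ℝ} (hA : 0 ≤ A) (b : (Fin d → ℤ) → ℝ)
    (hb : Summable b) (hkb : ∀ m, ‖coeff m k‖ ^ 2 ≤ b m) (hbA : ∑' m, b m ≤ A ^ 2) :
    ‖conv k‖ ≤ A := by
  refine (norm_conv_le_integral k).trans ?_
  have h := integral_abs_mul_le k 1
  simp only [ContinuousMap.one_apply, mul_one, one_pow, integral_const, probReal_univ,
    smul_eq_mul] at h
  refine abs_le_of_sq_le_sq' ?_ hA |>.2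
  refine h.trans (le_trans ?_ hbA)
  rw [← (hasSum_sq_coeff k).tsum_eq]
  exact (hasSum_sq_coeff k).summable.tsum_le_tsum hkb hb

theorem coeff_conv {d : ℕ} (k u : C(Torus d, ℝ)) (m : Fin d → ℤ) :
    coeff m (conv k u) = coeff m k * coeff m u := by
  have hi : Integrable (Function.uncurry fun x y : Torus d =>
      UnitAddTorus.mFourier (-m) x * ((u y : ℂ) * (k (x - y) : ℂ))) (volume.prod volume) :=
    Continuous.integrable_of_hasCompactSupport (by
      unfold Function.uncurry
      fun_prop) (HasCompactSupport.of_compactSpace _)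
  calc coeff m (conv k u)
      = ∫ x, ∫ y, UnitAddTorus.mFourier (-m) x * ((u y : ℂ) * (k (x - y) : ℂ)) := by
        rw [coeff_apply]
        refine integral_congr_ae (ae_of_all _ fun x => ?_)
        simp only [conv_apply]
        rw [integral_const_mul, ← integral_complex_ofReal]
        simp
    _ = ∫ y, ∫ x, UnitAddTorus.mFourier (-m) x * ((u y : ℂ) * (k (x - y) : ℂ)) :=
        integral_integral_swap hi
    _ = ∫ y, UnitAddTorus.mFourier (-m) y * (u y : ℂ) * coeff m k := by
        refine integral_congr_ae (ae_of_all _ fun y => ?_)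
        simp only
        rw [coeff_apply, ← integral_sub_right_eq_self
          (fun x => UnitAddTorus.mFourier (-m) x * (k x : ℂ)) y, ← integral_const_mul]
        refine integral_congr_ae (ae_of_all _ fun x => ?_)
        simp only [mFourier_sub_apply, neg_neg]
        have : UnitAddTorus.mFourier (-m) y * UnitAddTorus.mFourier m y = 1 := by
          rw [← UnitAddTorus.mFourier_add, neg_add_cancel, UnitAddTorus.mFourier_zero]
          rfl
        linear_combination (-(u y : ℂ) * UnitAddTorus.mFourier (-m) x * (k (x - y) : ℂ)) * this
    _ = coeff m k * coeff m u := by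
        rw [integral_mul_const, mul_comm, coeff_apply m u]

theorem integral_mFourier {d : ℕ} (n : Fin d → ℤ) :
    ∫ x : Torus d, UnitAddTorus.mFourier n x = if n = 0 then 1 else 0 := by
  have h := orthonormal_iff_ite.1 (UnitAddTorus.orthonormal_mFourier (d := Fin d)) 0 n
  rw [ContinuousMap.inner_toLp] at h
  simp only [UnitAddTorus.mFourier_zero, ContinuousMap.one_apply, map_one, mul_one, eq_comm (a := (0 : Fin d → ℤ))] at h
  rw [volume_torus_eq]
  exact h

theorem integral_mFourier_mul {d : ℕ} (m n : Fin d → ℤ) :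
    ∫ x : Torus d, UnitAddTorus.mFourier m x * UnitAddTorus.mFourier n x =
      if n = -m then 1 else 0 := by
  simp only [← UnitAddTorus.mFourier_add, integral_mFourier]
  congr 1
  rw [add_comm, eq_neg_iff_add_eq_zero]

/-- The Fourier coefficients of `∑ a(m) cos (2π⟨x, m⟩)` for an even sequence `a`. -/
theorem coeff_cosSeries {d : ℕ} (a : (Fin d → ℤ) → ℝ)
    (ha : ∀ k : ℕ, Summable fun m => |a m| * ‖latticePoint m‖ ^ k) (he : ∀ m, a (-m) = a m)
    (n : Fin d → ℤ) : coeff n (cosSeries a ha).1 = a n := by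
  have hs : Summable fun m => |a m| := by simpa using ha 0
  set c : (Fin d → ℤ) → C(Torus d, ℝ) := fun m =>
    a m • ⟨fun x => cosMode m x,
      Complex.continuous_re.comp (UnitAddTorus.mFourier m).continuous⟩ with hc
  have hcs : Summable c := by
    refine Summable.of_norm_bounded hs fun m => ?_
    rw [hc, norm_smul, Real.norm_eq_abs]
    refine mul_le_of_le_one_right (abs_nonneg _) ((ContinuousMap.norm_le _ zero_le_one).2 fun x => ?_)
    exact (Complex.abs_re_le_norm _).trans (norm_mFourier_apply m x).le
  have h1 : (cosSeries a ha).1 = ∑' m, c m := by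
    ext x
    rw [← ContinuousMap.tsum_apply hcs]
    rfl
  have h2 : ∀ m, coeff n (c m) = (a m / 2 : ℂ) * (if m = n then 1 else 0) +
      (a m / 2 : ℂ) * (if m = -n then 1 else 0) := by
    intro m
    have e1 := integral_mFourier_mul (-n) m
    have e2 := integral_mFourier_mul (-n) (-m)
    rw [neg_neg] at e1 e2
    simp only [neg_eq_iff_eq_neg (a := m)] at e2
    rw [hc, map_smul, ← e1, ← e2, coeff_apply, Complex.real_smul, ← integral_const_mul,
      ← integral_const_mul, ← integral_const_mul, ← integral_add
        (integrable_of_continuous (by fun_prop)) (integrable_of_continuous (by fun_prop))]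
    refine integral_congr_ae (ae_of_all _ fun x => ?_)
    simp only [ContinuousMap.coe_mk, cosMode]
    rw [Complex.re_eq_add_conj, ← UnitAddTorus.mFourier_neg]
    ring
  rw [h1, ContinuousLinearMap.map_tsum _ hcs]
  have h3 : HasSum (fun m => (a m / 2 : ℂ) * (if m = n then 1 else 0)) (a n / 2 : ℂ) := by
    convert hasSum_ite_eq n (a n / 2 : ℂ) using 2 with m
    split_ifs with h <;> simp [h]
  have h4 : HasSum (fun m => (a m / 2 : ℂ) * (if m = -n then 1 else 0)) (a n / 2 : ℂ) := by
    convert hasSum_ite_eq (-n) (a n / 2 : ℂ) using 2 with m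
    split_ifs with h <;> simp [h, he]
  simp only [h2]
  rw [(h3.add h4).tsum_eq]
  ring

/-! ### Derivatives and decay of Fourier coefficients -/

theorem one_le_norm_latticePoint {d : ℕ} {m : Fin d → ℤ} (hm : m ≠ 0) : 1 ≤ ‖latticePoint m‖ := by
  obtain ⟨i, hi⟩ := Function.ne_iff.1 hm
  refine le_trans ?_ (abs_le_norm_latticePoint m i)
  exact_mod_cast Int.one_le_abs hi

theorem norm_latticePoint_sq {d : ℕ} (m : Fin d → ℤ) :
    ‖latticePoint m‖ ^ 2 = ∑ i, (m i : ℝ) ^ 2 := by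
  simp [EuclideanSpace.norm_sq_eq, latticePoint]

@[simp]
theorem latticePoint_zero {d : ℕ} : latticePoint (0 : Fin d → ℤ) = 0 := by
  ext i; simp [latticePoint]

theorem norm_latticePoint_neg {d : ℕ} (m : Fin d → ℤ) : ‖latticePoint (-m)‖ = ‖latticePoint m‖ := by
  have : latticePoint (-m) = -latticePoint m := by
    ext i; simp [latticePoint]
  rw [this, norm_neg]

theorem toTorus_zero {d : ℕ} : toTorus (0 : EuclideanSpace ℝ (Fin d)) = 0 := by
  funext i; simp [toTorus]

/-- The derivative of a test function in the direction `v`. -/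
noncomputable def dirDeriv {d : ℕ} (v : EuclideanSpace ℝ (Fin d)) (φ : TestFunction d) :
    TestFunction d :=
  have h : ∀ z, fderiv ℝ (fun y => φ.1 (toTorus z + toTorus y)) 0 v = fderiv ℝ (lift φ) z v := by
    intro z
    have : (fun y => φ.1 (toTorus z + toTorus y)) = fun y => lift φ (z + y) := by
      funext y
      rw [lift, toTorus_add]
    rw [this, fderiv_comp_add_left, add_zero]
  have hc : ContDiff ℝ ∞ fun z => fderiv ℝ (lift φ) z v :=
    ((contDiff_lift φ).fderiv_right (by simp)).clm_apply contDiff_const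
  ⟨⟨fun x => fderiv ℝ (fun y => φ.1 (x + toTorus y)) 0 v, by
    rw [(isOpenQuotientMap_toTorus d).isQuotientMap.continuous_iff]
    exact hc.continuous.congr fun z => (h z).symm⟩, by
    rw [← funext h] at hc
    exact hc⟩

theorem lift_dirDeriv {d : ℕ} (v : EuclideanSpace ℝ (Fin d)) (φ : TestFunction d) :
    lift (dirDeriv v φ) = fun z => fderiv ℝ (lift φ) z v := by
  funext z
  have : (fun y => φ.1 (toTorus z + toTorus y)) = fun y => lift φ (z + y) := by
    funext y
    rw [lift, toTorus_add]
  change fderiv ℝ (fun y => φ.1 (toTorus z + toTorus y)) 0 v = _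
  rw [this, fderiv_comp_add_left, add_zero]

theorem hasDerivAt_translate {d : ℕ} (v : EuclideanSpace ℝ (Fin d)) (φ : TestFunction d)
    (x : Torus d) (s : ℝ) :
    HasDerivAt (fun s : ℝ => φ.1 (x + toTorus (s • v))) ((dirDeriv v φ).1 (x + toTorus (s • v)))
      s := by
  obtain ⟨z, rfl⟩ := (isOpenQuotientMap_toTorus d).surjective x
  simp only [← toTorus_add]
  have h1 : HasFDerivAt (lift φ) (fderiv ℝ (lift φ) (z + s • v)) (z + s • v) :=
    ((contDiff_lift φ).differentiable (by simp)).differentiableAt.hasFDerivAt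
  have h2 : HasDerivAt (fun s : ℝ => z + s • v) v s := by
    simpa using ((hasDerivAt_id s).smul_const v).const_add z
  have h3 := h1.comp_hasDerivAt s h2
  have h4 := congrFun (lift_dirDeriv v φ) (z + s • v)
  change HasDerivAt _ (lift (dirDeriv v φ) (z + s • v)) s
  rw [h4]
  exact h3

/-- Differentiation in the direction `v` multiplies the Fourier coefficients by `2πi⟨v, m⟩`:
differentiate the coefficients of the translates `φ(· + sv)` at `s = 0`. -/
theorem coeff_dirDeriv {d : ℕ} (v : EuclideanSpace ℝ (Fin d)) (φ : TestFunction d)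
    (m : Fin d → ℤ) :
    coeff m (dirDeriv v φ).1 =
      ((2 * Real.pi * inner ℝ v (latticePoint m) : ℝ) : ℂ) * Complex.I * coeff m φ.1 := by
  have h1 : HasDerivAt (fun s : ℝ => ∫ x : Torus d,
      UnitAddTorus.mFourier (-m) x * (φ.1 (x + toTorus (s • v)) : ℂ))
      (∫ x : Torus d, UnitAddTorus.mFourier (-m) x *
        ((dirDeriv v φ).1 (x + toTorus ((0 : ℝ) • v)) : ℂ)) 0 := by
    refine (hasDerivAt_integral_of_dominated_loc_of_deriv_le (s := Set.univ)
      (F := fun (s : ℝ) (x : Torus d) =>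
        UnitAddTorus.mFourier (-m) x * (φ.1 (x + toTorus (s • v)) : ℂ))
      (F' := fun (s : ℝ) (x : Torus d) =>
        UnitAddTorus.mFourier (-m) x * ((dirDeriv v φ).1 (x + toTorus (s • v)) : ℂ))
      (bound := fun _ => ‖(dirDeriv v φ).1‖) Filter.univ_mem
      (Eventually.of_forall fun s => Continuous.aestronglyMeasurable (by fun_prop))
      (integrable_of_continuous (by fun_prop)) (Continuous.aestronglyMeasurable (by fun_prop))
      (ae_of_all _ fun x s _ => ?_) (integrable_const _) (ae_of_all _ fun x s _ => ?_)).2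
    · rw [norm_mul, norm_mFourier_apply, one_mul, Complex.norm_real]
      exact (dirDeriv v φ).1.norm_coe_le_norm _
    · exact (hasDerivAt_translate v φ x s).ofReal_comp.const_mul _
  have h2 : (fun s : ℝ => ∫ x : Torus d,
      UnitAddTorus.mFourier (-m) x * (φ.1 (x + toTorus (s • v)) : ℂ)) = fun s : ℝ =>
      Complex.exp (((s * (2 * Real.pi * inner ℝ v (latticePoint m)) : ℝ) : ℂ) * Complex.I) *
        coeff m φ.1 := by
    funext s
    rw [coeff_apply, ← integral_sub_right_eq_self _ (toTorus (s • v)), ← integral_const_mul]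
    refine integral_congr_ae (ae_of_all _ fun x => ?_)
    simp only [sub_add_cancel, mFourier_sub_apply, neg_neg]
    rw [mFourier_toTorus, inner_smul_left]
    simp only [conj_trivial]
    ring_nf
  rw [h2] at h1
  have h3 : HasDerivAt (fun s : ℝ =>
      Complex.exp (((s * (2 * Real.pi * inner ℝ v (latticePoint m)) : ℝ) : ℂ) * Complex.I) *
        coeff m φ.1) (((2 * Real.pi * inner ℝ v (latticePoint m) : ℝ) : ℂ) * Complex.I *
          coeff m φ.1) 0 := by
    have := (((hasDerivAt_id (0 : ℝ)).mul_const
      (2 * Real.pi * inner ℝ v (latticePoint m))).ofReal_comp.mul_const Complex.I).cexp.mul_const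
        (coeff m φ.1)
    simpa using this
  have h4 := h1.unique h3
  rw [← h4, coeff_apply]
  simp [toTorus_zero]

open Laplacian in
/-- The Laplacian multiplies the Fourier coefficients by `-|2πm|²`. -/
theorem coeff_testLaplacian {d : ℕ} (φ : TestFunction d) (m : Fin d → ℤ) :
    coeff m (testLaplacian φ).1 = -((2 * Real.pi * ‖latticePoint m‖ : ℝ) : ℂ) ^ 2 *
      coeff m φ.1 := by
  set b := stdOrthonormalBasis ℝ (EuclideanSpace ℝ (Fin d))
  have h1 : (testLaplacian φ).1 = ∑ i, (dirDeriv (b i) (dirDeriv (b i) φ)).1 := by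
    ext x
    obtain ⟨z, rfl⟩ := (isOpenQuotientMap_toTorus d).surjective x
    have h := congrFun (lift_testLaplacian φ) z
    rw [InnerProductSpace.laplacian_eq_iteratedFDeriv_stdOrthonormalBasis] at h
    rw [ContinuousMap.sum_apply]
    change lift (testLaplacian φ) z = ∑ i, lift (dirDeriv (b i) (dirDeriv (b i) φ)) z
    rw [h]
    refine Finset.sum_congr rfl fun i _ => ?_
    rw [iteratedFDeriv_two_apply, lift_dirDeriv, lift_dirDeriv]
    have hd : DifferentiableAt ℝ (fderiv ℝ (lift φ)) z :=
      (((contDiff_lift φ).fderiv_right (m := ∞) (by simp)).differentiable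
        (by simp)).differentiableAt
    have h2 := fderiv_clm_apply hd (differentiableAt_const (b i))
    change _ = fderiv ℝ (fun z => fderiv ℝ (lift φ) z (b i)) z (b i)
    rw [h2]
    simp [b]
  rw [h1, map_sum]
  simp only [coeff_dirDeriv]
  have h2 : ∑ i, (inner ℝ (b i) (latticePoint m)) ^ 2 = ‖latticePoint m‖ ^ 2 := by
    simpa using b.sum_sq_norm_inner_right (latticePoint m)
  have h3 : (-((2 * Real.pi * ‖latticePoint m‖ : ℝ) : ℂ) ^ 2) =
      ∑ i, (((2 * Real.pi * inner ℝ (b i) (latticePoint m) : ℝ) : ℂ) * Complex.I) ^ 2 := by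
    simp only [mul_pow, Complex.I_sq]
    rw [← Finset.sum_mul, mul_neg_one]
    norm_cast
    simp only [mul_pow]
    rw [← Finset.mul_sum, h2]
  rw [h3, Finset.sum_mul]
  exact Finset.sum_congr rfl fun i _ => by ring

theorem summable_prod_inv_one_add_sq (d : ℕ) :
    Summable fun m : Fin d → ℤ => ∏ i, (1 + (m i : ℝ) ^ 2)⁻¹ := by
  refine summable_prod_pi d (fun n : ℤ => (1 + (n : ℝ) ^ 2)⁻¹) (fun n => by positivity) ?_
  refine Summable.of_norm_bounded_eventually (g := fun n : ℤ => 1 / (n : ℝ) ^ 2)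
    (Real.summable_one_div_int_pow.2 (by norm_num)) ?_
  filter_upwards [(Set.finite_singleton (0 : ℤ)).compl_mem_cofinite] with n hn
  have hn' : (n : ℝ) ≠ 0 := by exact_mod_cast hn
  rw [Real.norm_of_nonneg (by positivity), ← one_div]
  gcongr
  linarith

/-- The Fourier coefficients of a smooth function are rapidly decreasing. -/
theorem summable_norm_coeff {d : ℕ} (φ : TestFunction d) (k : ℕ) :
    Summable fun m => ‖coeff m φ.1‖ * ‖latticePoint m‖ ^ k := by
  have hpow : ∀ (n : ℕ) (m : Fin d → ℤ), coeff m ((testLaplacian ^ n) φ).1 =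
      (-((2 * Real.pi * ‖latticePoint m‖ : ℝ) : ℂ) ^ 2) ^ n * coeff m φ.1 := by
    intro n m
    induction n with
    | zero => simp
    | succ n ih =>
      rw [pow_succ', Module.End.mul_apply, coeff_testLaplacian, ih]
      ring
  set n := k + d
  obtain ⟨B, hB⟩ : ∃ B : ℝ, ∀ m, ‖coeff m ((testLaplacian ^ n) φ).1‖ ≤ B :=
    ⟨_, fun m => (coeff m).le_of_opNorm_le (LinearMap.mkContinuous_norm_le _ zero_le_one _) _⟩
  refine Summable.of_norm_bounded_eventually (g := fun m => 2 ^ d * B * ∏ i, (1 + (m i : ℝ) ^ 2)⁻¹)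
    ((summable_prod_inv_one_add_sq d).mul_left _) ?_
  filter_upwards [(Set.finite_singleton (0 : Fin d → ℤ)).compl_mem_cofinite] with m hm
  have ht := one_le_norm_latticePoint (m := m) hm
  set t := ‖latticePoint m‖
  have h1 := hB m
  rw [hpow, norm_mul, norm_pow, norm_neg, norm_pow, Complex.norm_real, Real.norm_eq_abs, sq_abs] at h1
  rw [Real.norm_of_nonneg (by positivity), Finset.prod_inv_distrib, ← div_eq_mul_inv,
    le_div_iff₀ (Finset.prod_pos fun i _ => by positivity)]
  have h2 : ∏ i, (1 + (m i : ℝ) ^ 2) ≤ (2 * t ^ 2) ^ d := by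
    have := Finset.prod_le_prod (s := Finset.univ) (f := fun i => 1 + (m i : ℝ) ^ 2)
      (g := fun _ => 2 * t ^ 2) (fun i _ => by positivity) fun i _ => by
        have := pow_le_pow_left₀ (abs_nonneg _) (abs_le_norm_latticePoint m i) 2
        rw [sq_abs] at this
        nlinarith
    simpa using this
  have h3 : t ^ (2 * n) ≤ ((2 * Real.pi * t) ^ 2) ^ n := by
    rw [← pow_mul]
    gcongr
    nlinarith [Real.pi_gt_three]
  calc ‖coeff m φ.1‖ * t ^ k * ∏ i, (1 + (m i : ℝ) ^ 2)
      ≤ ‖coeff m φ.1‖ * t ^ k * (2 * t ^ 2) ^ d := by gcongr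
    _ = 2 ^ d * (t ^ (k + 2 * d) * ‖coeff m φ.1‖) := by ring
    _ ≤ 2 ^ d * (t ^ (2 * n) * ‖coeff m φ.1‖) := by
        gcongr 2 ^ d * (?_ * _)
        exact pow_le_pow_right₀ ht (by omega)
    _ ≤ 2 ^ d * (((2 * Real.pi * t) ^ 2) ^ n * ‖coeff m φ.1‖) := by gcongr
    _ ≤ 2 ^ d * B := by gcongr

/-! ### Distributions are determined by their Fourier coefficients -/

theorem lift_trigMode {d : ℕ} (c : ℂ) (m : Fin d → ℤ) (z : EuclideanSpace ℝ (Fin d)) :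
    lift (trigMode c m) z =
      ‖c‖ * Real.cos (2 * Real.pi * inner ℝ z (latticePoint m) + c.arg) := by
  change (c * UnitAddTorus.mFourier m (toTorus z)).re = _
  rw [mFourier_toTorus]
  nth_rw 1 [← Complex.norm_mul_exp_arg_mul_I c]
  rw [mul_assoc, ← Complex.exp_add, ← add_mul, ← Complex.ofReal_add, Complex.re_ofReal_mul,
    Complex.exp_ofReal_mul_I_re, add_comm]

theorem norm_iteratedFDeriv_trigMode_le {d : ℕ} (c : ℂ) (m : Fin d → ℤ) (k : ℕ)
    (z : EuclideanSpace ℝ (Fin d)) :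
    ‖iteratedFDeriv ℝ k (lift (trigMode c m)) z‖ ≤
      ‖c‖ * (2 * Real.pi * ‖latticePoint m‖) ^ k := by
  set L : EuclideanSpace ℝ (Fin d) →L[ℝ] ℝ := (2 * Real.pi) • innerSL ℝ (latticePoint m) with hL
  have hcos : ContDiff ℝ ∞ fun t : ℝ => Real.cos (t + c.arg) := by fun_prop
  have e : lift (trigMode c m) = ‖c‖ • ((fun t : ℝ => Real.cos (t + c.arg)) ∘ L) := by
    funext z
    rw [lift_trigMode]
    simp [hL, real_inner_comm]
  have h1 := iteratedFDeriv_const_smul_apply (𝕜 := ℝ) (a := ‖c‖)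
      (((hcos.comp L.contDiff).of_le (m := (k : WithTop ℕ∞)) (mod_cast le_top)).contDiffAt (x := z))
  rw [e, h1, norm_smul, norm_norm]
  refine mul_le_mul_of_nonneg_left ?_ (norm_nonneg _)
  rw [L.iteratedFDeriv_comp_right (n := ∞) hcos z (mod_cast le_top)]
  refine (ContinuousMultilinearMap.norm_compContinuousLinearMap_le _ _).trans ?_
  rw [norm_iteratedFDeriv_eq_norm_iteratedDeriv, iteratedDeriv_comp_add_const]
  have hLn : ‖L‖ = 2 * Real.pi * ‖latticePoint m‖ := by
    rw [hL, norm_smul, innerSL_apply_norm, Real.norm_of_nonneg (by positivity)]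
  rw [Finset.prod_const, Finset.card_univ, Fintype.card_fin, hLn]
  exact mul_le_of_le_one_left (by positivity) (Real.abs_iteratedDeriv_cos_le_one k _)

/-- The Fourier series of a test function converges uniformly. -/
theorem hasSum_trigMode {d : ℕ} (φ : TestFunction d) (x : Torus d) :
    HasSum (fun m => (trigMode (coeff m φ.1) m).1 x) (φ.1 x) := by
  set f : C(Torus d, ℂ) := ⟨fun x => (φ.1 x : ℂ), by fun_prop⟩
  have h1 : UnitAddTorus.mFourierCoeff f = fun m => coeff m φ.1 := by
    funext m
    rw [coeff_apply, volume_torus_eq]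
    rfl
  have h2 : Summable (UnitAddTorus.mFourierCoeff f) := by
    rw [h1]
    exact Summable.of_norm (by simpa using summable_norm_coeff φ 0)
  have h3 := UnitAddTorus.hasSum_mFourier_series_apply_of_summable h2 x
  rw [h1] at h3
  exact Complex.reCLM.hasSum h3

/-- A distribution can be applied to the Fourier series of a test function term by term, since the
series converges together with all its derivatives. -/
theorem hasSum_apply_trigMode {d : ℕ} (T : TorusDistribution d) (φ : TestFunction d) :
    HasSum (fun m => T.1 (trigMode (coeff m φ.1) m)) (T.1 φ) := by
  obtain ⟨c, n, h⟩ := T.2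
  set v : ℕ → (Fin d → ℤ) → ℝ := fun k m => ‖coeff m φ.1‖ * (2 * Real.pi * ‖latticePoint m‖) ^ k
    with hv
  have hvs : ∀ k, Summable (v k) := fun k => by
    refine ((summable_norm_coeff φ k).mul_left ((2 * Real.pi) ^ k)).congr fun m => ?_
    rw [hv]
    ring
  have hv0 : ∀ k m, 0 ≤ v k m := fun k m => by positivity
  set M : Finset (Fin d → ℤ) → ℝ := fun F => ∑ k ∈ Finset.range (n + 1),
    ∑' m : {m // m ∉ F}, v k m with hM
  have hlift : lift φ = fun z => ∑' m, lift (trigMode (coeff m φ.1) m) z :=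
    funext fun z => (hasSum_trigMode φ (toTorus z)).tsum_eq.symm
  have hder : ∀ k (z : EuclideanSpace ℝ (Fin d)),
      HasSum (fun m => iteratedFDeriv ℝ k (lift (trigMode (coeff m φ.1) m)) z)
        (iteratedFDeriv ℝ k (lift φ) z) := by
    intro k z
    have := iteratedFDeriv_tsum (𝕜 := ℝ) (N := (⊤ : ℕ∞)) (v := v)
      (fun m => contDiff_lift (trigMode (coeff m φ.1) m)) (fun k _ => hvs k)
      (fun k m z _ => norm_iteratedFDeriv_trigMode_le _ _ _ _) (k := k) le_top
    rw [← hlift] at this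
    rw [congrFun this z]
    exact (Summable.of_norm_bounded (hvs k)
      fun m => norm_iteratedFDeriv_trigMode_le _ _ _ _).hasSum
  have hbound : ∀ F : Finset (Fin d → ℤ),
      |T.1 φ - ∑ m ∈ F, T.1 (trigMode (coeff m φ.1) m)| ≤ c * M F := by
    intro F
    rw [← map_sum, ← map_sub]
    refine h _ _ fun k hk z => ?_
    have e : lift (φ - ∑ m ∈ F, trigMode (coeff m φ.1) m) =
        fun z => lift φ z - ∑ m ∈ F, lift (trigMode (coeff m φ.1) m) z := by
      funext z
      simp [lift]
    have hsub : iteratedFDeriv ℝ k (lift (φ - ∑ m ∈ F, trigMode (coeff m φ.1) m)) z =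
        iteratedFDeriv ℝ k (lift φ) z -
          ∑ m ∈ F, iteratedFDeriv ℝ k (lift (trigMode (coeff m φ.1) m)) z := by
      have hk' : ∀ ψ : TestFunction d, ContDiffAt ℝ k (lift ψ) z := fun ψ =>
        ((contDiff_lift ψ).of_le (mod_cast le_top)).contDiffAt
      rw [← iteratedFDeriv_fun_sum_apply fun m _ => hk' _, e]
      exact iteratedFDeriv_sub_apply (hk' φ) (ContDiffAt.sum fun m _ => hk' _)
    have hs := (hder k z).summable
    rw [hsub, ← (hder k z).tsum_eq, ← hs.sum_add_tsum_compl (s := F), add_sub_cancel_left]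
    refine (tsum_of_norm_bounded (g := fun m : {m // m ∉ F} => v k m)
      ((hvs k).subtype _).hasSum fun m => norm_iteratedFDeriv_trigMode_le _ _ _ _).trans ?_
    exact Finset.single_le_sum (f := fun k => ∑' m : {m // m ∉ F}, v k m)
      (fun k _ => tsum_nonneg fun m => hv0 k m) (Finset.mem_range.2 (by omega))
  have hM0 : Tendsto (fun F => c * M F) atTop (𝓝 0) := by
    have : Tendsto M atTop (𝓝 (∑ k ∈ Finset.range (n + 1), 0)) :=
      tendsto_finsetSum _ fun k _ => tendsto_tsum_compl_atTop_zero (v k)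
    simpa using this.const_mul c
  rw [HasSum, SummationFilter.unconditional_filter, tendsto_iff_norm_sub_tendsto_zero]
  refine squeeze_zero (fun _ => norm_nonneg _) (fun F => ?_) hM0
  rw [norm_sub_rev]
  exact hbound F

/-- The Fourier coefficient of a distribution at the frequency `m`. -/
noncomputable def distCoeff {d : ℕ} (m : Fin d → ℤ) (T : TorusDistribution d) : ℂ :=
  ⟨T.1 (trigMode 1 m), T.1 (trigMode Complex.I m)⟩

theorem apply_trigMode {d : ℕ} (T : TorusDistribution d) (c : ℂ) (m : Fin d → ℤ) :
    T.1 (trigMode c m) = (c * starRingEnd ℂ (distCoeff m T)).re := by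
  have h : trigMode c m = c.re • trigMode 1 m + c.im • trigMode Complex.I m := by
    ext x
    change (c * UnitAddTorus.mFourier m x).re = c.re * (1 * UnitAddTorus.mFourier m x).re +
      c.im * (Complex.I * UnitAddTorus.mFourier m x).re
    simp
    ring
  rw [h, map_add, map_smul, map_smul]
  simp [distCoeff]

theorem distCoeff_neg {d : ℕ} (m : Fin d → ℤ) (T : TorusDistribution d) :
    distCoeff (-m) T = starRingEnd ℂ (distCoeff m T) := by
  have h1 : trigMode 1 (-m) = trigMode 1 m := by
    ext x
    change (1 * UnitAddTorus.mFourier (-m) x).re = (1 * UnitAddTorus.mFourier m x).re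
    simp [UnitAddTorus.mFourier_neg]
  have h2 : trigMode Complex.I (-m) = (-1 : ℝ) • trigMode Complex.I m := by
    ext x
    change (Complex.I * UnitAddTorus.mFourier (-m) x).re =
      -1 * (Complex.I * UnitAddTorus.mFourier m x).re
    simp [UnitAddTorus.mFourier_neg]
  apply Complex.ext
  · simp [distCoeff, h1]
  · simp [distCoeff, h2]

theorem distCoeff_ofFunction {d : ℕ} (m : Fin d → ℤ) (u : C(Torus d, ℝ)) :
    distCoeff m (ofFunction u) = coeff m u := by
  have hi : Integrable fun x => UnitAddTorus.mFourier (-m) x * (u x : ℂ) :=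
    integrable_of_continuous (by fun_prop)
  have h1 := Complex.reCLM.integral_comp_comm hi
  have h2 := Complex.imCLM.integral_comp_comm hi
  apply Complex.ext
  · rw [coeff_apply]
    refine Eq.trans ?_ h1
    change ∫ x, u x * (1 * UnitAddTorus.mFourier m x).re = _
    refine integral_congr_ae (ae_of_all _ fun x => ?_)
    simp [UnitAddTorus.mFourier_neg, mul_comm]
  · rw [coeff_apply]
    refine Eq.trans ?_ h2
    change ∫ x, u x * (Complex.I * UnitAddTorus.mFourier m x).re = _
    refine integral_congr_ae (ae_of_all _ fun x => ?_)
    simp [UnitAddTorus.mFourier_neg, mul_comm]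

theorem ext_distCoeff {d : ℕ} {T T' : TorusDistribution d}
    (h : ∀ m, distCoeff m T = distCoeff m T') : T = T' := by
  ext φ
  refine (hasSum_apply_trigMode T φ).unique ?_
  convert hasSum_apply_trigMode T' φ using 2 with m
  rw [apply_trigMode, apply_trigMode, h]

/-! ### Littlewood-Paley blocks and the embedding of `𝒞^α` into `C(𝕋^d)` -/

theorem convolve_ofFunction {d : ℕ} (k : TestFunction d) (u : C(Torus d, ℝ)) :
    convolve k (ofFunction u) = conv k.1 u := rfl

theorem block_ofFunction {d : ℕ} (ρ : DyadicPartition d) (j : ℕ) (u : C(Torus d, ℝ)) :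
    block ρ j (ofFunction u) = conv (blockKernel ρ j).1 u := rfl

theorem block_sub {d : ℕ} (ρ : DyadicPartition d) (j : ℕ) (S T : TorusDistribution d) :
    block ρ j (S - T) = block ρ j S - block ρ j T := rfl

theorem DyadicPartition.cutoff_nonneg {d : ℕ} (ρ : DyadicPartition d) (j : ℕ)
    (x : EuclideanSpace ℝ (Fin d)) : 0 ≤ ρ.cutoff j x := by
  cases j with
  | zero => exact ρ.low_nonneg x
  | succ q => exact ρ.annulus_nonneg _

theorem DyadicPartition.cutoff_neg {d : ℕ} (ρ : DyadicPartition d) (j : ℕ) (m : Fin d → ℤ) :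
    ρ.cutoff j (latticePoint (-m)) = ρ.cutoff j (latticePoint m) := by
  cases j with
  | zero => exact ρ.low_radial _ _ (norm_latticePoint_neg m)
  | succ q =>
    refine ρ.annulus_radial _ _ ?_
    rw [norm_smul, norm_smul, norm_latticePoint_neg]

theorem DyadicPartition.cutoff_hasSum {d : ℕ} (ρ : DyadicPartition d)
    (x : EuclideanSpace ℝ (Fin d)) : HasSum (fun j => ρ.cutoff j x) 1 := by
  have hs : Summable fun q : ℕ => ρ.annulus (((2 : ℝ) ^ q)⁻¹ • x) := by
    obtain ⟨n, hn⟩ := pow_unbounded_of_one_lt (2 * ‖x‖) (one_lt_two (α := ℝ))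
    refine summable_of_ne_finset_zero (s := Finset.range n) fun q hq => ?_
    by_contra hne
    have h := (ρ.annulus_support (subset_tsupport _ (Function.mem_support.2 hne))).1
    rw [norm_smul, norm_inv, norm_pow, Real.norm_ofNat, inv_mul_eq_div,
      le_div_iff₀ (by positivity)] at h
    have hle : n ≤ q := by simpa using hq
    have := pow_le_pow_right₀ (one_le_two (α := ℝ)) hle
    have h2 : (0 : ℝ) < 2 ^ q := by positivity
    linarith
  have h := (hasSum_nat_add_iff (f := fun j => ρ.cutoff j x) 1).1 (a := _) hs.hasSum
  rw [Finset.sum_range_one, add_comm] at h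
  rwa [← ρ.sum_eq_one x]

theorem DyadicPartition.cutoff_le_one {d : ℕ} (ρ : DyadicPartition d) (j : ℕ)
    (x : EuclideanSpace ℝ (Fin d)) : ρ.cutoff j x ≤ 1 :=
  le_hasSum (ρ.cutoff_hasSum x) j fun i _ => ρ.cutoff_nonneg i x

/-- On the frequencies `m ≠ 0` in the support of the `j`-th cutoff, `2^j ≤ 2π|m|`. -/
theorem DyadicPartition.two_pow_le_of_cutoff_ne_zero {d : ℕ} (ρ : DyadicPartition d) {j : ℕ}
    {m : Fin d → ℤ} (hm : m ≠ 0) (h : ρ.cutoff j (latticePoint m) ≠ 0) :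
    (2 : ℝ) ^ j ≤ 2 * Real.pi * ‖latticePoint m‖ := by
  have h1 := one_le_norm_latticePoint hm
  have hpi := Real.pi_gt_three
  cases j with
  | zero => nlinarith
  | succ q =>
    have h := (ρ.annulus_support (subset_tsupport _ h)).1
    rw [norm_smul, norm_inv, norm_pow, Real.norm_ofNat, inv_mul_eq_div,
      le_div_iff₀ (by positivity)] at h
    rw [pow_succ]
    nlinarith

theorem coeff_blockKernel {d : ℕ} (ρ : DyadicPartition d) (j : ℕ) (n : Fin d → ℤ) :
    coeff n (blockKernel ρ j).1 = ρ.cutoff j (latticePoint n) :=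
  coeff_cosSeries _ _ (ρ.cutoff_neg j) n

theorem coeff_reflect {d : ℕ} (k : TestFunction d) (x : Torus d) (m : Fin d → ℤ) :
    coeff m (reflect k x).1 = UnitAddTorus.mFourier (-m) x * coeff (-m) k.1 := by
  rw [coeff_apply, coeff_apply, ← integral_sub_left_eq_self _ volume x, ← integral_const_mul]
  refine integral_congr_ae (ae_of_all _ fun y => ?_)
  change UnitAddTorus.mFourier (-m) (x - y) * (k.1 (x - (x - y)) : ℂ) = _
  rw [mFourier_sub_apply, sub_sub_cancel, mul_assoc]

/-- The Fourier coefficients of a Littlewood-Paley block of a distribution. -/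
theorem coeff_block {d : ℕ} (ρ : DyadicPartition d) (j : ℕ) (T : TorusDistribution d)
    (n : Fin d → ℤ) :
    coeff n (block ρ j T) = ρ.cutoff j (latticePoint n) * distCoeff n T := by
  obtain ⟨F, hF⟩ : ∃ F : Finset (Fin d → ℤ), ∀ m ∉ F, ρ.cutoff j (latticePoint m) = 0 := by
    have hfin : {m : Fin d → ℤ | ρ.cutoff j (latticePoint m) ≠ 0}.Finite := by
      refine (finite_norm_latticePoint_le d (2 ^ j * (8 / 3))).subset fun m hm => ?_
      cases j with
      | zero =>
        have := ρ.low_support (subset_tsupport _ hm)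
        simp only [Set.mem_ofPred_eq] at this ⊢
        linarith
      | succ q =>
        have := (ρ.annulus_support (subset_tsupport _ hm)).2
        simp only [Set.mem_ofPred_eq] at this ⊢
        rw [norm_smul, norm_inv, norm_pow, Real.norm_ofNat, inv_mul_le_iff₀ (by positivity)] at this
        refine this.trans ?_
        gcongr
        · norm_num
        · omega
    exact ⟨hfin.toFinset, fun m hm => by simpa using hm⟩
  set r : (Fin d → ℤ) → ℝ := fun m => ρ.cutoff j (latticePoint m) with hr
  set τ : (Fin d → ℤ) → ℂ := fun m => distCoeff m T with hτ
  have h1 : ∀ x, ((block ρ j T x : ℝ) : ℂ) = ∑ m ∈ F, (r m / 2 : ℂ) *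
      (UnitAddTorus.mFourier (-m) x * starRingEnd ℂ (τ m) + UnitAddTorus.mFourier m x * τ m) := by
    intro x
    have e1 : ∀ m, T.1 (trigMode (coeff m (reflect (blockKernel ρ j) x).1) m) =
        (UnitAddTorus.mFourier (-m) x * r m * starRingEnd ℂ (τ m)).re := fun m => by
      rw [apply_trigMode, coeff_reflect, coeff_blockKernel, ρ.cutoff_neg]
    have e2 := hasSum_apply_trigMode T (reflect (blockKernel ρ j) x)
    simp only [e1] at e2
    have e3 := e2.unique (hasSum_sum_of_ne_finset_zero (s := F) fun m hm => by simp [hr, hF m hm])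
    change ((T.1 (reflect (blockKernel ρ j) x) : ℝ) : ℂ) = _
    rw [e3, Complex.ofReal_sum]
    refine Finset.sum_congr rfl fun m _ => ?_
    rw [Complex.re_eq_add_conj, map_mul, map_mul, ← UnitAddTorus.mFourier_neg, neg_neg,
      Complex.conj_conj, Complex.conj_ofReal]
    ring
  have h2 : coeff n (block ρ j T) = ∑ m ∈ F, (r m / 2 : ℂ) *
      ((if m = -n then 1 else 0) * starRingEnd ℂ (τ m) + (if m = n then 1 else 0) * τ m) := by
    rw [coeff_apply]
    simp only [h1, Finset.mul_sum]
    rw [integral_finsetSum _ fun m _ => integrable_of_continuous (by fun_prop)]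
    refine Finset.sum_congr rfl fun m _ => ?_
    have i1 := integral_mFourier_mul (-n) (-m)
    have i2 := integral_mFourier_mul (-n) m
    rw [neg_neg] at i1 i2
    simp only [neg_eq_iff_eq_neg (a := m)] at i1
    rw [← i1, ← i2, ← integral_mul_const, ← integral_mul_const, ← integral_add
      (integrable_of_continuous (by fun_prop)) (integrable_of_continuous (by fun_prop)),
      ← integral_const_mul]
    refine integral_congr_ae (ae_of_all _ fun x => ?_)
    ring
  have h3 : ∀ (w : Fin d → ℤ) (a : (Fin d → ℤ) → ℂ),
      ∑ m ∈ F, (r m / 2 : ℂ) * ((if m = w then 1 else 0) * a m) = r w / 2 * a w := by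
    intro w a
    rw [Finset.sum_eq_single w (fun m _ hm => by simp [hm]) fun hw => by simp [hr, hF w hw]]
    simp
  rw [h2]
  simp only [mul_add, Finset.sum_add_distrib]
  rw [h3 (-n), h3 n]
  simp only [hr, hτ, ρ.cutoff_neg, distCoeff_neg, Complex.conj_conj]
  ring

/-- A distribution whose blocks are absolutely summable in `C(𝕋^d)` is the continuous function
`∑_j Δ_j T`. -/
theorem ofFunction_tsum_block {d : ℕ} (ρ : DyadicPartition d) (T : TorusDistribution d)
    (hs : Summable fun j => ‖block ρ j T‖) : ofFunction (∑' j, block ρ j T) = T := by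
  refine ext_distCoeff fun m => ?_
  rw [distCoeff_ofFunction, ContinuousLinearMap.map_tsum _ hs.of_norm]
  simp only [coeff_block]
  have := (ρ.cutoff_hasSum (latticePoint m)).mapL Complex.ofRealCLM |>.mul_right (distCoeff m T)
  simpa using this.tsum_eq

theorem weightedBlockNorm_nonneg {d : ℕ} (ρ : DyadicPartition d) (α : ℝ) (T : TorusDistribution d)
    (j : ℕ) : 0 ≤ weightedBlockNorm ρ α T j := by
  unfold weightedBlockNorm
  positivity

theorem norm_block_le {d : ℕ} (ρ : DyadicPartition d) {α : ℝ} {T : TorusDistribution d} {j : ℕ}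
    {H : ℝ} (h : weightedBlockNorm ρ α T j ≤ H) :
    ‖block ρ j T‖ ≤ (2 : ℝ) ^ (-(α * ((j : ℝ) - 1))) * H := by
  unfold weightedBlockNorm at h
  rw [Real.rpow_neg zero_le_two, inv_mul_eq_div, le_div_iff₀ (by positivity), mul_comm]
  exact h

theorem summable_rpow_weight {α : ℝ} (hα : 0 < α) :
    Summable fun j : ℕ => (2 : ℝ) ^ (-(α * ((j : ℝ) - 1))) := by
  have h : (2 : ℝ) ^ (-α) < 1 := Real.rpow_lt_one_of_one_lt_of_neg one_lt_two (by linarith)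
  refine ((summable_geometric_of_lt_one (by positivity) h).mul_left ((2 : ℝ) ^ α)).congr fun j => ?_
  rw [← Real.rpow_natCast, ← Real.rpow_mul zero_le_two, ← Real.rpow_add two_pos]
  ring_nf

/-- The constant `∑_j 2^{-α(j-1)}` of the embedding `𝒞^α ⊆ C(𝕋^d)`. -/
noncomputable def embeddingConst (α : ℝ) : ℝ := ∑' j : ℕ, (2 : ℝ) ^ (-(α * ((j : ℝ) - 1)))

theorem exists_ofFunction_of_weightedBlockNorm_le {d : ℕ} (ρ : DyadicPartition d) {α : ℝ}
    (hα : 0 < α) {T : TorusDistribution d} {H : ℝ} (h : ∀ j, weightedBlockNorm ρ α T j ≤ H) :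
    ∃ u, ofFunction u = T ∧ ‖u‖ ≤ embeddingConst α * H := by
  have hs := (summable_rpow_weight hα).mul_right H
  have hb := Summable.of_nonneg_of_le (fun _ => norm_nonneg _) (fun j => norm_block_le ρ (h j)) hs
  refine ⟨_, ofFunction_tsum_block ρ T hb, ?_⟩
  rw [embeddingConst, ← tsum_mul_right]
  exact tsum_of_norm_bounded hs.hasSum fun j => norm_block_le ρ (h j)

/-- For `α > 0` the elements of `𝒞^α` are continuous functions. -/
theorem exists_ofFunction {d : ℕ} (ρ : DyadicPartition d) {α : ℝ} (hα : 0 < α)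
    {T : TorusDistribution d} (hT : T ∈ HolderBesov ρ α) : ∃ u, ofFunction u = T := by
  obtain ⟨H, hH⟩ := (show Tendsto (weightedBlockNorm ρ α T) atTop (𝓝 0) from hT).bddAbove_range
  obtain ⟨u, hu, -⟩ := exists_ofFunction_of_weightedBlockNorm_le ρ hα (H := H)
    fun j => hH ⟨j, rfl⟩
  exact ⟨u, hu⟩

/-- The supremum norm is controlled by the norm of `𝒞^α`. -/
theorem norm_le_of_holderNorm_le {d : ℕ} (ρ : DyadicPartition d) {α : ℝ} (hα : 0 < α)
    {u : C(Torus d, ℝ)} {H : ℝ} (hH : 0 ≤ H)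
    (h : holderNorm ρ α (ofFunction u) ≤ ENNReal.ofReal H) : ‖u‖ ≤ embeddingConst α * H := by
  obtain ⟨v, hv, hn⟩ := exists_ofFunction_of_weightedBlockNorm_le ρ hα (T := ofFunction u) (H := H)
    fun j => (ENNReal.ofReal_le_ofReal_iff hH).1 ((le_iSup (fun j => ENNReal.ofReal
      (weightedBlockNorm ρ α (ofFunction u) j)) j).trans h)
  rwa [ofFunction_injective d hv] at hn

/-- A function which is continuous in `𝒞^α` is continuous in `C(𝕋^d)`. -/
theorem ContinuousInHolder.continuousOn {d : ℕ} {ρ : DyadicPartition d} {α U : ℝ} (hα : 0 < α)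
    {u : ℝ → C(Torus d, ℝ)} (h : ContinuousInHolder ρ α U fun r => ofFunction (u r)) :
    ContinuousOn u (Set.Icc 0 U) := by
  intro r hr
  rw [ContinuousWithinAt, tendsto_iff_norm_sub_tendsto_zero]
  have h1 := h.2 r hr
  have h2 : Tendsto (fun s => embeddingConst α *
      (holderNorm ρ α (ofFunction (u s) - ofFunction (u r))).toReal) (𝓝[Set.Icc 0 U] r) (𝓝 0) := by
    simpa using ((ENNReal.tendsto_toReal ENNReal.zero_ne_top).comp h1).const_mul (embeddingConst α)
  refine squeeze_zero' (Eventually.of_forall fun _ => norm_nonneg _) ?_ h2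
  filter_upwards [h1.eventually (gt_mem_nhds ENNReal.zero_lt_top)] with s hs
  refine norm_le_of_holderNorm_le ρ hα ENNReal.toReal_nonneg ?_
  rw [map_sub, ENNReal.ofReal_toReal hs.ne]

/-- A criterion for continuity in `𝒞^α`: every block is continuous, and the weighted block norms
tend to zero uniformly in time. -/
theorem continuousInHolder_of_block {d : ℕ} (ρ : DyadicPartition d) {α U : ℝ}
    {u : ℝ → C(Torus d, ℝ)} {τ : ℕ → ℝ} (hτ : Tendsto τ atTop (𝓝 0))
    (hc : ∀ j, ContinuousOn (fun r => conv (blockKernel ρ j).1 (u r)) (Set.Icc 0 U))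
    (hb : ∀ j, ∀ r ∈ Set.Icc 0 U, weightedBlockNorm ρ α (ofFunction (u r)) j ≤ τ j) :
    ContinuousInHolder ρ α U fun r => ofFunction (u r) := by
  refine ⟨fun r hr => squeeze_zero (fun j => weightedBlockNorm_nonneg ρ α _ j)
    (fun j => hb j r hr) hτ, fun r hr => ?_⟩
  rw [ENNReal.tendsto_nhds_zero]
  intro ε hε
  obtain ⟨δ, hδ0, hδ⟩ : ∃ δ : ℝ, 0 < δ ∧ ENNReal.ofReal δ ≤ ε := by
    rcases eq_or_ne ε ⊤ with rfl | h
    · exact ⟨1, one_pos, le_top⟩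
    · exact ⟨ε.toReal, ENNReal.toReal_pos hε.ne' h, ENNReal.ofReal_toReal_le⟩
  obtain ⟨J, hJ⟩ := eventually_atTop.1 (hτ.eventually (gt_mem_nhds (half_pos hδ0)))
  have hfin : ∀ j ∈ Finset.range J, ∀ᶠ s in 𝓝[Set.Icc 0 U] r,
      weightedBlockNorm ρ α (ofFunction (u s) - ofFunction (u r)) j < δ := by
    intro j _
    have h1 : Tendsto (fun s => weightedBlockNorm ρ α (ofFunction (u s) - ofFunction (u r)) j)
        (𝓝[Set.Icc 0 U] r) (𝓝 0) := by
      have := (tendsto_iff_norm_sub_tendsto_zero.1 (hc j r hr)).const_mul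
        ((2 : ℝ) ^ (α * ((j : ℝ) - 1)))
      rw [mul_zero] at this
      exact this
    exact h1.eventually (gt_mem_nhds hδ0)
  filter_upwards [(Filter.eventually_all_finset _).2 hfin, self_mem_nhdsWithin] with s hs hsU
  refine (iSup_le fun j => ENNReal.ofReal_le_ofReal ?_).trans hδ
  rcases lt_or_ge j J with hj | hj
  · exact (hs j (Finset.mem_range.2 hj)).le
  · have h1 := hb j s hsU
    have h2 := hb j r hr
    have h3 := hJ j hj
    unfold weightedBlockNorm at h1 h2 ⊢
    rw [block_sub]
    have := mul_le_mul_of_nonneg_left (norm_sub_le (block ρ j (ofFunction (u s)))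
      (block ρ j (ofFunction (u r)))) (by positivity : (0 : ℝ) ≤ 2 ^ (α * ((j : ℝ) - 1)))
    linarith

/-! ### Lattice sums -/

/-- The length `2π|m|` of a frequency. -/
noncomputable def freq {d : ℕ} (m : Fin d → ℤ) : ℝ := 2 * Real.pi * ‖latticePoint m‖

theorem freq_nonneg {d : ℕ} (m : Fin d → ℤ) : 0 ≤ freq m := by
  unfold freq; positivity

theorem one_le_freq {d : ℕ} {m : Fin d → ℤ} (hm : m ≠ 0) : 1 ≤ freq m := by
  have h1 := one_le_norm_latticePoint hm
  have hpi := Real.pi_gt_three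
  unfold freq
  nlinarith

theorem freq_pow_four {d : ℕ} (m : Fin d → ℤ) :
    freq m ^ 4 = (2 * Real.pi) ^ 4 * (∑ i, (m i : ℝ) ^ 2) ^ 2 := by
  rw [freq, ← norm_latticePoint_sq]
  ring

theorem summable_freq_pow_mul_exp (d : ℕ) {t : ℝ} (ht : 0 < t) (k : ℕ) :
    Summable fun m : Fin d → ℤ => freq m ^ k * Real.exp (-t * freq m ^ 4) := by
  refine ((summable_heat d ht k).mul_left ((2 * Real.pi) ^ k)).congr fun m => ?_
  rw [abs_of_pos (Real.exp_pos _), freq]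
  ring

theorem summable_exp_freq (d : ℕ) {t : ℝ} (ht : 0 < t) :
    Summable fun m : Fin d → ℤ => Real.exp (-t * freq m ^ 4) := by
  simpa using summable_freq_pow_mul_exp d ht 0

theorem hasSum_prod_pi (d : ℕ) {f : ℤ → ℝ} (hf0 : ∀ n, 0 ≤ f n) {S : ℝ} (hf : HasSum f S) :
    HasSum (fun m : Fin d → ℤ => ∏ i, f (m i)) (S ^ d) := by
  induction d with
  | zero => simp
  | succ d ih =>
    rw [← (Fin.consEquiv fun _ : Fin (d + 1) => ℤ).hasSum_iff, pow_succ']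
    have hs := hf.summable.mul_of_nonneg ih.summable hf0 fun m =>
      Finset.prod_nonneg fun i _ => hf0 _
    refine (hf.mul ih hs).congr_fun fun p => ?_
    simp [Fin.prod_univ_succ, Fin.consEquiv]

/-- The sum over `n ≠ 0` is compared with the integral of `(1 + (μ x) ^ 2)⁻¹`, an arctangent. -/
theorem hasSum_inv_one_add_sq_le {μ : ℝ} (hμ : 0 < μ) :
    ∃ S, HasSum (fun n : ℤ => (1 + (μ * n) ^ 2)⁻¹) S ∧ S ≤ 1 + Real.pi / μ := by
  have hpart : ∀ N : ℕ, ∑ n ∈ Finset.range N, (1 + (μ * ((n : ℝ) + 1)) ^ 2)⁻¹ ≤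
      Real.pi / 2 / μ := by
    intro N
    have hanti : AntitoneOn (fun x : ℝ => (1 + (μ * x) ^ 2)⁻¹) (Set.Icc 0 (0 + N)) := by
      intro x hx y hy hxy
      have := hx.1
      simp only
      gcongr
    have h := hanti.sum_le_integral
    have h2 : ∫ x in (0 : ℝ)..(0 + N), (1 + (μ * x) ^ 2)⁻¹ = μ⁻¹ * Real.arctan (μ * N) := by
      rw [intervalIntegral.integral_comp_mul_left (fun x => (1 + x ^ 2)⁻¹) hμ.ne',
        integral_inv_one_add_sq]
      simp
    rw [h2] at h
    simp only [zero_add, Nat.cast_add, Nat.cast_one] at h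
    refine h.trans ?_
    rw [div_eq_inv_mul]
    gcongr
    exact (Real.arctan_lt_pi_div_two _).le
  have hs : Summable fun n : ℕ => (1 + (μ * ((n : ℝ) + 1)) ^ 2)⁻¹ :=
    summable_of_sum_range_le (fun n => by positivity) hpart
  have hle : ∑' n : ℕ, (1 + (μ * ((n : ℝ) + 1)) ^ 2)⁻¹ ≤ Real.pi / 2 / μ :=
    Real.tsum_le_of_sum_range_le (fun n => by positivity) hpart
  have h1 : HasSum (fun n : ℕ => (1 + (μ * ((n + 1 : ℕ) : ℤ)) ^ 2)⁻¹)
      (∑' n : ℕ, (1 + (μ * ((n : ℝ) + 1)) ^ 2)⁻¹) := by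
    convert hs.hasSum using 3 with n
    push_cast
    rfl
  have h2 : HasSum (fun n : ℕ => (1 + (μ * (-((n + 1 : ℕ) : ℤ) : ℤ)) ^ 2)⁻¹)
      (∑' n : ℕ, (1 + (μ * ((n : ℝ) + 1)) ^ 2)⁻¹) := by
    convert hs.hasSum using 3 with n
    push_cast
    ring
  have h3 := HasSum.of_add_one_of_neg_add_one (f := fun n : ℤ => (1 + (μ * n) ^ 2)⁻¹) h1
    (by convert h2 using 5; push_cast; ring)
  refine ⟨_, h3, ?_⟩
  have : Real.pi / 2 / μ + Real.pi / 2 / μ = Real.pi / μ := by ring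
  simp only [Int.cast_zero, mul_zero, ne_eq, OfNat.ofNat_ne_zero, not_false_eq_true, zero_pow,
    add_zero, inv_one]
  linarith

/-- The number of frequencies that `e^{-t|2πm|⁴}` does not cut off is of order `t^{-d/4}`. -/
theorem exists_tsum_exp_freq_le (d : ℕ) (U : ℝ) :
    ∃ C : ℝ, 0 < C ∧ ∀ t, 0 < t → t ≤ U →
      ∑' m : Fin d → ℤ, Real.exp (-t * freq m ^ 4) ≤ C * t ^ (-((d : ℝ) / 4)) := by
  refine ⟨(2 * (|U| ^ (1 / 4 : ℝ) + Real.pi)) ^ d, by positivity, fun t ht htU => ?_⟩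
  set μ : ℝ := t ^ (1 / 4 : ℝ) with hμd
  have hμ : 0 < μ := by positivity
  have hμ4 : μ ^ 4 = t := by
    rw [hμd, ← Real.rpow_natCast, ← Real.rpow_mul ht.le]
    norm_num
  obtain ⟨S, hS, hSle⟩ := hasSum_inv_one_add_sq_le hμ
  have hprod := hasSum_prod_pi d (fun n => by positivity) (hS.mul_left 2)
  have hterm : ∀ m : Fin d → ℤ, Real.exp (-t * freq m ^ 4) ≤
      ∏ i, 2 * (1 + (μ * (m i : ℝ)) ^ 2)⁻¹ := by
    intro m
    have h1 : ∑ i, t * (m i : ℝ) ^ 4 ≤ t * freq m ^ 4 := by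
      rw [← Finset.mul_sum, freq_pow_four]
      gcongr
      have h2 : ∑ i, (m i : ℝ) ^ 4 ≤ (∑ i, (m i : ℝ) ^ 2) ^ 2 := by
        have := Finset.sum_sq_le_sq_sum_of_nonneg (s := Finset.univ)
          (f := fun i => (m i : ℝ) ^ 2) (fun i _ => by positivity)
        simpa only [← pow_mul] using this
      refine h2.trans (le_mul_of_one_le_left (by positivity) (one_le_pow₀ ?_))
      linarith [Real.pi_gt_three]
    calc Real.exp (-t * freq m ^ 4) ≤ Real.exp (∑ i, -(t * (m i : ℝ) ^ 4)) := by
          rw [Real.exp_le_exp, Finset.sum_neg_distrib]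
          linarith
      _ = ∏ i, Real.exp (-(t * (m i : ℝ) ^ 4)) := Real.exp_sum _ _
      _ ≤ _ := by
        refine Finset.prod_le_prod (fun i _ => (Real.exp_pos _).le) fun i _ => ?_
        set x := μ * (m i : ℝ) with hx
        have hx4 : t * (m i : ℝ) ^ 4 = x ^ 4 := by rw [hx, mul_pow, hμ4]
        rw [hx4, Real.exp_neg, ← div_eq_mul_inv, le_div_iff₀ (by positivity),
          inv_mul_le_iff₀ (Real.exp_pos _)]
        have := Real.add_one_le_exp (x ^ 4)
        nlinarith [sq_nonneg (x ^ 2 - 1)]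
  have hle := (summable_exp_freq d ht).tsum_le_tsum hterm hprod.summable
  rw [hprod.tsum_eq] at hle
  refine hle.trans ?_
  have hμU : μ ≤ |U| ^ (1 / 4 : ℝ) :=
    Real.rpow_le_rpow ht.le (htU.trans (le_abs_self U)) (by norm_num)
  have h3 : t ^ (-((d : ℝ) / 4)) = (μ⁻¹) ^ d := by
    rw [hμd, ← Real.rpow_neg ht.le, ← Real.rpow_natCast, ← Real.rpow_mul ht.le]
    ring_nf
  rw [h3, ← mul_pow]
  have hS0 : 0 ≤ S := hS.nonneg fun n => by positivity
  refine pow_le_pow_left₀ (by positivity) ?_ d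
  rw [mul_assoc]
  refine mul_le_mul_of_nonneg_left (hSle.trans ?_) zero_le_two
  rw [add_mul, ← div_eq_mul_inv, ← div_eq_mul_inv]
  gcongr
  rwa [one_le_div hμ]

/-! ### The operators `P_t` and `P_t Δ` on `C(𝕋^d)` -/

theorem coeff_heatKernel {d : ℕ} {t : ℝ} (ht : 0 < t) (m : Fin d → ℤ) :
    coeff m (heatKernel d ht).1 = (Real.exp (-t * freq m ^ 4) : ℝ) :=
  coeff_cosSeries _ _ (fun m => by rw [norm_latticePoint_neg]) m

theorem coeff_testLaplacian_heatKernel {d : ℕ} {t : ℝ} (ht : 0 < t) (m : Fin d → ℤ) :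
    coeff m (testLaplacian (heatKernel d ht)).1 =
      ((-(freq m ^ 2 * Real.exp (-t * freq m ^ 4)) : ℝ) : ℂ) := by
  rw [coeff_testLaplacian, coeff_heatKernel]
  push_cast [freq]
  ring

open Classical in
/-- The operator `P_t` on continuous functions. -/
noncomputable def heatOp (d : ℕ) (t : ℝ) : C(Torus d, ℝ) →L[ℝ] C(Torus d, ℝ) :=
  if ht : 0 < t then conv (heatKernel d ht).1 else ContinuousLinearMap.id ℝ _

open Classical in
/-- The operator `P_t Δ` on continuous functions, for `t > 0`; it is set to `0` for `t ≤ 0`. -/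
noncomputable def lapHeatOp (d : ℕ) (t : ℝ) : C(Torus d, ℝ) →L[ℝ] C(Torus d, ℝ) :=
  if ht : 0 < t then conv (testLaplacian (heatKernel d ht)).1 else 0

theorem heatOp_of_pos {d : ℕ} {t : ℝ} (ht : 0 < t) : heatOp d t = conv (heatKernel d ht).1 :=
  dif_pos ht

theorem heatOp_zero {d : ℕ} : heatOp d 0 = ContinuousLinearMap.id ℝ _ := dif_neg (lt_irrefl _)

theorem lapHeatOp_of_pos {d : ℕ} {t : ℝ} (ht : 0 < t) :
    lapHeatOp d t = conv (testLaplacian (heatKernel d ht)).1 := dif_pos ht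

theorem coeff_heatOp {d : ℕ} {t : ℝ} (ht : 0 ≤ t) (m : Fin d → ℤ) (u : C(Torus d, ℝ)) :
    coeff m (heatOp d t u) = (Real.exp (-t * freq m ^ 4) : ℝ) * coeff m u := by
  rcases ht.eq_or_lt with rfl | ht
  · simp [heatOp_zero]
  · rw [heatOp_of_pos ht, coeff_conv, coeff_heatKernel]

theorem coeff_lapHeatOp {d : ℕ} {t : ℝ} (ht : 0 < t) (m : Fin d → ℤ) (u : C(Torus d, ℝ)) :
    coeff m (lapHeatOp d t u) =
      ((-(freq m ^ 2 * Real.exp (-t * freq m ^ 4)) : ℝ) : ℂ) * coeff m u := by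
  rw [lapHeatOp_of_pos ht, coeff_conv, coeff_testLaplacian_heatKernel]

theorem heatOp_lapHeatOp {d : ℕ} {s t : ℝ} (hs : 0 ≤ s) (ht : 0 < t) (u : C(Torus d, ℝ)) :
    heatOp d s (lapHeatOp d t u) = lapHeatOp d (s + t) u := by
  refine ext_coeff fun m => ?_
  rw [coeff_heatOp hs, coeff_lapHeatOp ht, coeff_lapHeatOp (by linarith), ← mul_assoc,
    ← Complex.ofReal_mul]
  congr 2
  rw [neg_add, add_mul, Real.exp_add]
  ring

theorem heatOp_heatOp {d : ℕ} {s t : ℝ} (hs : 0 ≤ s) (ht : 0 ≤ t) (u : C(Torus d, ℝ)) :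
    heatOp d s (heatOp d t u) = heatOp d (s + t) u := by
  refine ext_coeff fun m => ?_
  rw [coeff_heatOp hs, coeff_heatOp ht, coeff_heatOp (by linarith), ← mul_assoc,
    ← Complex.ofReal_mul]
  congr 2
  rw [neg_add, add_mul, Real.exp_add]

theorem conv_heatOp {d : ℕ} {t : ℝ} (ht : 0 ≤ t) (k u : C(Torus d, ℝ)) :
    conv k (heatOp d t u) = heatOp d t (conv k u) := by
  refine ext_coeff fun m => ?_
  rw [coeff_conv, coeff_heatOp ht, coeff_heatOp ht, coeff_conv]
  ring

theorem conv_heatOp' {d : ℕ} {t : ℝ} (ht : 0 ≤ t) (k u : C(Torus d, ℝ)) :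
    conv k (heatOp d t u) = conv (heatOp d t k) u := by
  refine ext_coeff fun m => ?_
  rw [coeff_conv, coeff_heatOp ht, coeff_conv, coeff_heatOp ht]
  ring

theorem conv_sub {d : ℕ} (k l : C(Torus d, ℝ)) : conv (k - l) = conv k - conv l := by
  ext1 u
  refine ext_coeff fun m => ?_
  rw [sub_apply, map_sub, coeff_conv, coeff_conv, coeff_conv, map_sub, sub_mul]

theorem rpow_mul_exp_neg_le {x p : ℝ} (hx : 0 ≤ x) (hp0 : 0 ≤ p) (hp : p ≤ 2) :
    x ^ p * Real.exp (-x) ≤ 2 := by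
  have h1 : x ^ p ≤ (1 + x) ^ 2 := by
    calc x ^ p ≤ (1 + x) ^ p := Real.rpow_le_rpow hx (by linarith) hp0
      _ ≤ (1 + x) ^ (2 : ℝ) := Real.rpow_le_rpow_of_exponent_le (by linarith) hp
      _ = (1 + x) ^ 2 := by norm_cast
  have h2 := Real.quadratic_le_exp_of_nonneg hx
  rw [Real.exp_neg, ← div_eq_mul_inv, div_le_iff₀ (Real.exp_pos _)]
  nlinarith

/-- A kernel whose symbol is at most `A|2πm|^{2+a} e^{-t|2πm|⁴}` convolves with norm at most a
constant times `A t^{-γ}`, `γ = (1 + a/2 + d/4)/2`. The proof bounds the `L²` norm of the kernel, and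
`γ < 1` if and only if `a < 2 - d/2`. -/
theorem exists_norm_conv_le (d : ℕ) (U : ℝ) {a : ℝ} (ha0 : 0 ≤ a) (ha : a ≤ 2) :
    ∃ C : ℝ, 0 < C ∧ ∀ t, 0 < t → t ≤ U → ∀ (k : C(Torus d, ℝ)) (A : ℝ), 0 ≤ A →
      (∀ m, ‖coeff m k‖ ≤ A * (freq m ^ (2 + a) * Real.exp (-t * freq m ^ 4))) →
      ‖conv k‖ ≤ A * C * t ^ (-((1 + a / 2 + d / 4) / 2)) := by
  obtain ⟨C, hC, hCs⟩ := exists_tsum_exp_freq_le d U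
  refine ⟨Real.sqrt (2 * C), by positivity, fun t ht htU k A hA hk => ?_⟩
  refine norm_conv_le k (by positivity)
    (fun m => A ^ 2 * (2 * t ^ (-(1 + a / 2))) * Real.exp (-t * freq m ^ 4))
    ((summable_exp_freq d ht).mul_left _) (fun m => ?_) ?_
  · refine (pow_le_pow_left₀ (norm_nonneg _) (hk m) 2).trans ?_
    have hf := freq_nonneg m
    set x := freq m ^ 4 with hx
    have hx0 : 0 ≤ x := by positivity
    have e1 : (freq m ^ (2 + a)) ^ 2 = x ^ (1 + a / 2) := by
      rw [hx, ← Real.rpow_natCast, ← Real.rpow_natCast, ← Real.rpow_mul hf, ← Real.rpow_mul hf]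
      congr 1
      push_cast
      ring
    have e2 := rpow_mul_exp_neg_le (x := t * x) (p := 1 + a / 2) (by positivity) (by linarith)
      (by linarith)
    rw [Real.mul_rpow ht.le hx0] at e2
    have e3 : Real.exp (-t * x) ^ 2 = Real.exp (-(t * x)) * Real.exp (-t * x) := by
      rw [sq, neg_mul]
    rw [mul_pow, mul_pow, e1, e3, Real.rpow_neg ht.le]
    have e4 : x ^ (1 + a / 2) * Real.exp (-(t * x)) ≤ 2 * (t ^ (1 + a / 2))⁻¹ := by
      rw [← div_eq_mul_inv, le_div_iff₀ (by positivity)]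
      linarith
    calc A ^ 2 * (x ^ (1 + a / 2) * (Real.exp (-(t * x)) * Real.exp (-t * x)))
        = A ^ 2 * (x ^ (1 + a / 2) * Real.exp (-(t * x))) * Real.exp (-t * x) := by ring
      _ ≤ _ := by gcongr
  · rw [tsum_mul_left]
    have e5 : (t ^ (-((1 + a / 2 + d / 4) / 2))) ^ 2 =
        t ^ (-(1 + a / 2)) * t ^ (-((d : ℝ) / 4)) := by
      rw [← Real.rpow_natCast, ← Real.rpow_mul ht.le, ← Real.rpow_add ht]
      congr 1
      push_cast
      ring
    rw [mul_pow, mul_pow, e5, Real.sq_sqrt (by positivity)]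
    calc A ^ 2 * (2 * t ^ (-(1 + a / 2))) * ∑' m : Fin d → ℤ, Real.exp (-t * freq m ^ 4)
        ≤ A ^ 2 * (2 * t ^ (-(1 + a / 2))) * (C * t ^ (-((d : ℝ) / 4))) := by
          gcongr
          exact hCs t ht htU
      _ = _ := by ring

/-- The smoothing estimates for `P_t Δ` on `C(𝕋^d)` and for its blocks. -/
theorem exists_norm_lapHeatOp_le {d : ℕ} (ρ : DyadicPartition d) (U : ℝ) {a : ℝ} (ha0 : 0 ≤ a)
    (ha : a ≤ 2) :
    ∃ C : ℝ, 0 < C ∧ ∀ t, 0 < t → t ≤ U →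
      ‖lapHeatOp d t‖ ≤ C * t ^ (-((1 + a / 2 + d / 4) / 2)) ∧
      ∀ j, ‖(conv (blockKernel ρ j).1).comp (lapHeatOp d t)‖ ≤
        ((2 : ℝ) ^ j) ^ (-a) * C * t ^ (-((1 + a / 2 + d / 4) / 2)) := by
  obtain ⟨C, hC, h⟩ := exists_norm_conv_le d U ha0 ha
  have hfr : ∀ m : Fin d → ℤ, freq m ^ 2 ≤ freq m ^ (2 + a) := by
    intro m
    rcases eq_or_ne m 0 with rfl | hm
    · rw [freq, latticePoint_zero, norm_zero, mul_zero, Real.zero_rpow (by linarith)]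
      norm_num
    · rw [← Real.rpow_natCast]
      exact Real.rpow_le_rpow_of_exponent_le (one_le_freq hm) (by push_cast; linarith)
  refine ⟨C, hC, fun t ht htU => ⟨?_, fun j => ?_⟩⟩
  · rw [lapHeatOp_of_pos ht]
    have := h t ht htU (testLaplacian (heatKernel d ht)).1 1 zero_le_one fun m => by
      rw [coeff_testLaplacian_heatKernel, Complex.norm_real, norm_neg, one_mul,
        Real.norm_of_nonneg (by have := freq_nonneg m; positivity)]
      exact mul_le_mul_of_nonneg_right (hfr m) (Real.exp_pos _).le
    rwa [one_mul] at this
  · have e : (conv (blockKernel ρ j).1).comp (lapHeatOp d t) =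
        conv (lapHeatOp d t (blockKernel ρ j).1) := by
      ext1 u
      refine ext_coeff fun m => ?_
      rw [ContinuousLinearMap.comp_apply, coeff_conv, coeff_conv, coeff_lapHeatOp ht,
        coeff_lapHeatOp ht]
      ring
    rw [e]
    refine h t ht htU _ _ (by positivity) fun m => ?_
    rw [coeff_lapHeatOp ht, coeff_blockKernel, ← Complex.ofReal_mul, Complex.norm_real, norm_mul,
      norm_neg, Real.norm_of_nonneg (by have := freq_nonneg m; positivity),
      Real.norm_of_nonneg (ρ.cutoff_nonneg _ _)]
    have hf := freq_nonneg m
    rcases eq_or_ne m 0 with rfl | hm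
    · have : freq (0 : Fin d → ℤ) = 0 := by
        rw [freq, latticePoint_zero, norm_zero, mul_zero]
      rw [this]
      simp only [ne_eq, OfNat.ofNat_ne_zero, not_false_eq_true, zero_pow, zero_mul]
      positivity
    rcases eq_or_ne (ρ.cutoff j (latticePoint m)) 0 with h0 | h0
    · rw [h0, mul_zero]
      positivity
    have h2 := ρ.two_pow_le_of_cutoff_ne_zero hm h0
    have hf1 := one_le_freq hm
    have h3 : 1 ≤ ((2 : ℝ) ^ j) ^ (-a) * freq m ^ a := by
      rw [Real.rpow_neg (by positivity), inv_mul_eq_div, one_le_div (by positivity)]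
      exact Real.rpow_le_rpow (by positivity) h2 ha0
    calc freq m ^ 2 * Real.exp (-t * freq m ^ 4) * ρ.cutoff j (latticePoint m)
        ≤ freq m ^ 2 * Real.exp (-t * freq m ^ 4) * 1 := by
          gcongr
          exact ρ.cutoff_le_one _ _
      _ ≤ freq m ^ 2 * Real.exp (-t * freq m ^ 4) * (((2 : ℝ) ^ j) ^ (-a) * freq m ^ a) := by
          gcongr
      _ = _ := by
          rw [Real.rpow_add (by linarith), Real.rpow_ofNat]
          ring

theorem abs_exp_sub_exp_le {s t r x : ℝ} (hx : 0 ≤ x) (hs : r ≤ s) (ht : r ≤ t) :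
    |Real.exp (-s * x) - Real.exp (-t * x)| ≤ |s - t| * (x * Real.exp (-r * x)) := by
  wlog h : s ≤ t generalizing s t
  · rw [abs_sub_comm, abs_sub_comm s t]
    exact this ht hs (le_of_not_ge h)
  have h1 : Real.exp (-t * x) ≤ Real.exp (-s * x) := Real.exp_le_exp.2 (by nlinarith)
  rw [abs_of_nonneg (by linarith), abs_sub_comm, abs_of_nonneg (by linarith)]
  have h2 : Real.exp (-t * x) = Real.exp (-s * x) * Real.exp (-((t - s) * x)) := by
    rw [← Real.exp_add]
    ring_nf
  have h3 := Real.add_one_le_exp (-((t - s) * x))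
  have h4 : Real.exp (-s * x) ≤ Real.exp (-r * x) := Real.exp_le_exp.2 (by nlinarith)
  rw [h2]
  calc Real.exp (-s * x) - Real.exp (-s * x) * Real.exp (-((t - s) * x))
      = Real.exp (-s * x) * (1 - Real.exp (-((t - s) * x))) := by ring
    _ ≤ Real.exp (-s * x) * ((t - s) * x) := by
        gcongr
        linarith
    _ ≤ Real.exp (-r * x) * ((t - s) * x) := by
        have : 0 ≤ (t - s) * x := mul_nonneg (by linarith) hx
        gcongr
    _ = _ := by ring

theorem continuousOn_of_norm_sub_le {F : Type*} [NormedAddCommGroup F] {f : ℝ → F} {s : Set ℝ}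
    {K : ℝ} (h : ∀ x ∈ s, ∀ y ∈ s, ‖f x - f y‖ ≤ |x - y| * K) : ContinuousOn f s := by
  intro y hy
  rw [ContinuousWithinAt, tendsto_iff_norm_sub_tendsto_zero]
  refine squeeze_zero' (Eventually.of_forall fun _ => norm_nonneg _)
    (eventually_nhdsWithin_of_forall fun x hx => h x hx y hy) ?_
  have : Continuous fun x => |x - y| * K := by fun_prop
  simpa using (this.tendsto y).mono_left nhdsWithin_le_nhds

theorem continuousOn_lapHeatOp (d : ℕ) : ContinuousOn (lapHeatOp d) (Set.Ioi 0) := by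
  intro t₀ ht₀
  have ht₀ : 0 < t₀ := ht₀
  set r := t₀ / 2
  have hr : 0 < r := by positivity
  refine ContinuousAt.continuousWithinAt (ContinuousOn.continuousAt (s := Set.Ioi r) ?_
    (Ioi_mem_nhds (by simp only [r]; linarith)))
  refine continuousOn_of_norm_sub_le (f := lapHeatOp d)
    (K := Real.sqrt (∑' m : Fin d → ℤ, freq m ^ 12 * Real.exp (-(2 * r) * freq m ^ 4)))
    fun s hs t ht => ?_
  have hs : r < s := hs
  have ht : r < t := ht
  rw [lapHeatOp_of_pos (hr.trans hs), lapHeatOp_of_pos (hr.trans ht), ← conv_sub]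
  have hsum := summable_freq_pow_mul_exp d (t := 2 * r) (by positivity) 12
  refine norm_conv_le _ (by positivity)
    (fun m => |s - t| ^ 2 * (freq m ^ 12 * Real.exp (-(2 * r) * freq m ^ 4)))
    (hsum.mul_left _) (fun m => ?_) ?_
  · rw [map_sub, coeff_testLaplacian_heatKernel, coeff_testLaplacian_heatKernel,
      ← Complex.ofReal_sub, Complex.norm_real, Real.norm_eq_abs]
    have h1 := abs_exp_sub_exp_le (x := freq m ^ 4) (by positivity) hs.le ht.le
    have h2 : |(-(freq m ^ 2 * Real.exp (-s * freq m ^ 4)) -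
        -(freq m ^ 2 * Real.exp (-t * freq m ^ 4)))| =
        freq m ^ 2 * |Real.exp (-s * freq m ^ 4) - Real.exp (-t * freq m ^ 4)| := by
      rw [← abs_of_nonneg (sq_nonneg (freq m)), ← abs_mul, abs_of_nonneg (sq_nonneg (freq m)),
        ← abs_neg]
      ring_nf
    rw [h2]
    have h3 : Real.exp (-(2 * r) * freq m ^ 4) = Real.exp (-r * freq m ^ 4) ^ 2 := by
      rw [← Real.exp_nat_mul]
      push_cast
      ring_nf
    calc (freq m ^ 2 * |Real.exp (-s * freq m ^ 4) - Real.exp (-t * freq m ^ 4)|) ^ 2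
        ≤ (freq m ^ 2 * (|s - t| * (freq m ^ 4 * Real.exp (-r * freq m ^ 4)))) ^ 2 := by gcongr
      _ = _ := by rw [h3]; ring
  · rw [tsum_mul_left, mul_pow, Real.sq_sqrt
      (tsum_nonneg fun m => by have := freq_nonneg m; positivity)]

theorem continuousOn_conv_heatOp {d : ℕ} (ρ : DyadicPartition d) (j : ℕ) (u : C(Torus d, ℝ)) :
    ContinuousOn (fun r => conv (blockKernel ρ j).1 (heatOp d r u)) (Set.Ici 0) := by
  have hsum : Summable fun m : Fin d → ℤ => ρ.cutoff j (latticePoint m) * freq m ^ 8 := by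
    refine ((ρ.summable_cutoff j 8).mul_left ((2 * Real.pi) ^ 8)).congr fun m => ?_
    rw [abs_of_nonneg (ρ.cutoff_nonneg _ _), freq]
    ring
  refine continuousOn_of_norm_sub_le
    (K := Real.sqrt (∑' m : Fin d → ℤ, ρ.cutoff j (latticePoint m) * freq m ^ 8) * ‖u‖)
    fun s hs t ht => ?_
  have hs : 0 ≤ s := hs
  have ht : 0 ≤ t := ht
  rw [conv_heatOp' hs, conv_heatOp' ht, ← sub_apply, ← conv_sub, ← mul_assoc]
  refine ContinuousLinearMap.le_of_opNorm_le _ ?_ u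
  refine norm_conv_le _ (by positivity)
    (fun m => |s - t| ^ 2 * (ρ.cutoff j (latticePoint m) * freq m ^ 8))
    (hsum.mul_left _) (fun m => ?_) ?_
  · rw [map_sub, coeff_heatOp hs, coeff_heatOp ht, coeff_blockKernel, ← Complex.ofReal_mul,
      ← Complex.ofReal_mul, ← Complex.ofReal_sub, ← sub_mul, Complex.norm_real, norm_mul,
      Real.norm_of_nonneg (ρ.cutoff_nonneg _ _), Real.norm_eq_abs, mul_pow]
    have h1 := abs_exp_sub_exp_le (x := freq m ^ 4) (by positivity) hs ht
    simp only [neg_zero, zero_mul, Real.exp_zero, mul_one] at h1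
    have h2 : ρ.cutoff j (latticePoint m) ^ 2 ≤ ρ.cutoff j (latticePoint m) :=
      pow_le_of_le_one (ρ.cutoff_nonneg _ _) (ρ.cutoff_le_one _ _) two_ne_zero
    calc _ ≤ (|s - t| * freq m ^ 4) ^ 2 * ρ.cutoff j (latticePoint m) := by gcongr
      _ = _ := by ring
  · rw [tsum_mul_left, mul_pow, Real.sq_sqrt
      (tsum_nonneg fun m => by have := ρ.cutoff_nonneg j (latticePoint m); positivity)]

/-! ### Uniform boundedness of `P_t` on `C(𝕋^d)` -/

/-- The second difference of the symbol in one coordinate. -/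
theorem abs_second_difference_le {τ b x : ℝ} (hτ : 0 < τ) (hb : 0 ≤ b) :
    |2 * Real.exp (-τ * (x ^ 2 + b) ^ 2) - Real.exp (-τ * ((x - 1) ^ 2 + b) ^ 2) -
        Real.exp (-τ * ((x + 1) ^ 2 + b) ^ 2)| ≤
      128 * Real.sqrt τ * Real.exp (τ / 2) * Real.exp (-τ * (x ^ 2 + b) ^ 2 / 16) := by
  set h : ℝ → ℝ := fun s => Real.exp (-τ * (s ^ 2 + b) ^ 2) with hh
  set h1 : ℝ → ℝ := fun s => -4 * τ * s * (s ^ 2 + b) * h s with hh1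
  set h2 : ℝ → ℝ := fun s => (-4 * τ * (3 * s ^ 2 + b) + 16 * τ ^ 2 * s ^ 2 * (s ^ 2 + b) ^ 2) * h s
    with hh2
  have d1 : ∀ s, HasDerivAt h (h1 s) s := by
    intro s
    have := ((((hasDerivAt_pow 2 s).add_const b).pow 2).const_mul (-τ)).exp
    refine this.congr_deriv ?_
    simp only [hh1, hh, Pi.pow_apply]
    push_cast
    ring
  have d2 : ∀ s, HasDerivAt h1 (h2 s) s := by
    intro s
    have := (((hasDerivAt_id s).const_mul (-4 * τ)).mul ((hasDerivAt_pow 2 s).add_const b)).mul (d1 s)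
    refine this.congr_deriv ?_
    simp only [hh1, hh2, id, Pi.mul_apply]
    push_cast
    ring
  -- The mean value theorem for `s ↦ h s - h (s - 1)` on `[x, x + 1]`, then for `h1`.
  obtain ⟨c, hc, hceq⟩ := exists_hasDerivAt_eq_slope (fun s => h s - h (s - 1))
    (fun s => h1 s - h1 (s - 1)) (show x < x + 1 by linarith)
    (fun s _ => (((d1 s).sub ((d1 (s - 1)).comp_sub_const s 1)).continuousAt).continuousWithinAt)
    (fun s _ => (d1 s).sub ((d1 (s - 1)).comp_sub_const s 1))
  obtain ⟨e, he, heeq⟩ := exists_hasDerivAt_eq_slope h1 h2 (show c - 1 < c by linarith)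
    (fun s _ => (d2 s).continuousAt.continuousWithinAt) (fun s _ => d2 s)
  have hkey : 2 * h x - h (x - 1) - h (x + 1) = -h2 e := by
    rw [heeq]
    simp only [sub_sub_cancel, div_one, add_sub_cancel_left, add_sub_cancel_right] at hceq ⊢
    linarith
  change |2 * h x - h (x - 1) - h (x + 1)| ≤ _
  rw [hkey, abs_neg]
  set N := e ^ 2 + b with hN
  have hN0 : 0 ≤ N := by positivity
  set z := Real.sqrt τ * N with hz
  have hz0 : 0 ≤ z := by positivity
  have hz2 : z ^ 2 = τ * N ^ 2 := by rw [hz, mul_pow, Real.sq_sqrt hτ.le]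
  have hst : Real.sqrt τ ^ 2 = τ := Real.sq_sqrt hτ.le
  have hpoly : |-4 * τ * (3 * e ^ 2 + b) + 16 * τ ^ 2 * e ^ 2 * N ^ 2| ≤
      Real.sqrt τ * (12 * z + 16 * z ^ 3) := by
    have e1 : Real.sqrt τ * (12 * z + 16 * z ^ 3) = 12 * τ * N + 16 * τ ^ 2 * N ^ 3 := by
      rw [hz]
      linear_combination (12 * N + 16 * N ^ 3 * (Real.sqrt τ ^ 2 + τ)) * hst
    rw [e1]
    refine (abs_add_le _ _).trans (add_le_add ?_ ?_)
    · rw [abs_of_nonpos (by nlinarith [mul_nonneg hτ.le hb, mul_nonneg hτ.le (sq_nonneg e)])]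
      nlinarith [mul_nonneg hτ.le hb]
    · rw [abs_of_nonneg (by positivity)]
      have : e ^ 2 ≤ N := by linarith
      calc 16 * τ ^ 2 * e ^ 2 * N ^ 2 ≤ 16 * τ ^ 2 * N * N ^ 2 := by gcongr
        _ = _ := by ring
  have hexp : 12 * z + 16 * z ^ 3 ≤ 128 * Real.exp (z ^ 2 / 2) := by
    have := Real.quadratic_le_exp_of_nonneg (x := z ^ 2 / 2) (by positivity)
    nlinarith [sq_nonneg (z - 1), sq_nonneg (z ^ 2 - z), sq_nonneg (z ^ 2)]
  have hx2 : x ^ 2 + b ≤ 2 * N + 2 := by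
    have a1 : |x - e| ≤ 1 := abs_le.2 ⟨by linarith [he.2, hc.2], by linarith [he.1, hc.1]⟩
    have a2 : (x - e) ^ 2 ≤ 1 := by
      rw [← sq_abs]
      exact pow_le_one₀ (abs_nonneg _) a1
    nlinarith [sq_nonneg (2 * e - x)]
  have hx3 : (x ^ 2 + b) ^ 2 ≤ 8 * N ^ 2 + 8 := by
    have : (x ^ 2 + b) ^ 2 ≤ (2 * N + 2) ^ 2 := pow_le_pow_left₀ (by positivity) hx2 2
    nlinarith [sq_nonneg (N - 1)]
  calc |h2 e| = |-4 * τ * (3 * e ^ 2 + b) + 16 * τ ^ 2 * e ^ 2 * N ^ 2| * Real.exp (-z ^ 2) := by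
        rw [hh2, abs_mul, hz2, ← neg_mul, abs_of_pos (Real.exp_pos _)]
    _ ≤ Real.sqrt τ * (128 * Real.exp (z ^ 2 / 2)) * Real.exp (-z ^ 2) := by
        gcongr
        exact hpoly.trans (by gcongr)
    _ = 128 * Real.sqrt τ * Real.exp (-z ^ 2 / 2) := by
        have : Real.exp (-z ^ 2 / 2) = Real.exp (z ^ 2 / 2) * Real.exp (-z ^ 2) := by
          rw [← Real.exp_add]
          ring_nf
        rw [this]
        ring
    _ ≤ 128 * Real.sqrt τ * Real.exp (τ / 2 + -τ * (x ^ 2 + b) ^ 2 / 16) := by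
        gcongr
        rw [hz2]
        nlinarith
    _ = _ := by
        rw [Real.exp_add]
        ring

/-- The function `x ↦ 2 - 2 cos (2πx_i)` on the torus. -/
noncomputable def sinWeight {d : ℕ} (i : Fin d) : C(Torus d, ℝ) :=
  ⟨fun x => 2 - 2 * (fourier 1 (x i) : ℂ).re, by fun_prop⟩

theorem sinWeight_nonneg {d : ℕ} (i : Fin d) (x : Torus d) : 0 ≤ sinWeight i x := by
  have h : (fourier 1 (x i) : ℂ).re ≤ 1 := by
    refine (Complex.re_le_norm _).trans ?_
    rw [fourier_apply, Circle.norm_coe]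
  change 0 ≤ 2 - 2 * (fourier 1 (x i) : ℂ).re
  linarith

/-- Multiplication by `2 - 2 cos (2πx_i)` is the negative second difference in the `i`-th
frequency. -/
theorem coeff_sinWeight_mul {d : ℕ} (i : Fin d) (u : C(Torus d, ℝ)) (m : Fin d → ℤ) :
    coeff m (sinWeight i * u) =
      2 * coeff m u - coeff (m - Pi.single i 1) u - coeff (m + Pi.single i 1) u := by
  simp only [coeff_apply]
  rw [← integral_const_mul, ← integral_sub (integrable_of_continuous (by fun_prop))
    (integrable_of_continuous (by fun_prop)), ← integral_sub
      (integrable_of_continuous (by fun_prop)) (integrable_of_continuous (by fun_prop))]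
  refine integral_congr_ae (ae_of_all _ fun x => ?_)
  have h1 : UnitAddTorus.mFourier (-(m - Pi.single i 1)) x =
      UnitAddTorus.mFourier (-m) x * fourier 1 (x i) := by
    rw [neg_sub', sub_neg_eq_add, UnitAddTorus.mFourier_add, UnitAddTorus.mFourier_single]
  have h2 : UnitAddTorus.mFourier (-(m + Pi.single i 1)) x =
      UnitAddTorus.mFourier (-m) x * starRingEnd ℂ (fourier 1 (x i)) := by
    rw [neg_add, UnitAddTorus.mFourier_add, UnitAddTorus.mFourier_neg (n := Pi.single i 1),
      UnitAddTorus.mFourier_single]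
  have h3 : ((sinWeight i * u) x : ℂ) =
      (2 - (fourier 1 (x i) + starRingEnd ℂ (fourier 1 (x i)))) * (u x : ℂ) := by
    change (((2 - 2 * (fourier 1 (x i) : ℂ).re) * u x : ℝ) : ℂ) = _
    push_cast
    rw [Complex.re_eq_add_conj]
    ring
  simp only [h1, h2, h3]
  ring

/-- Multiplication by `2 - 2 cos (2πx_i)` takes a second difference of the symbol
`exp (-t|2πm|⁴)`, which gains a factor `√t` because the symbol varies on the scale `t^{-1/4}`. -/
theorem coeff_sinWeight_mul_heatKernel_le {d : ℕ} {t : ℝ} (ht : 0 < t) (i : Fin d)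
    (m : Fin d → ℤ) :
    ‖coeff m (sinWeight i * (heatKernel d ht).1)‖ ≤
      128 * ((2 * Real.pi) ^ 2 * Real.sqrt t) * Real.exp (t * (2 * Real.pi) ^ 4 / 2) *
        Real.exp (-t * freq m ^ 4 / 16) := by
  set τ := t * (2 * Real.pi) ^ 4 with hτ
  set b := ∑ k ∈ Finset.univ.erase i, (m k : ℝ) ^ 2 with hb
  have hb0 : 0 ≤ b := Finset.sum_nonneg fun _ _ => sq_nonneg _
  have hsum : ∀ n : Fin d → ℤ, (∀ k, k ≠ i → n k = m k) →
      -t * freq n ^ 4 = -τ * ((n i : ℝ) ^ 2 + b) ^ 2 := by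
    intro n hn
    have : ∑ k, (n k : ℝ) ^ 2 = (n i : ℝ) ^ 2 + b := by
      rw [← Finset.add_sum_erase _ _ (Finset.mem_univ i), hb]
      congr 1
      exact Finset.sum_congr rfl fun k hk => by rw [hn k (Finset.ne_of_mem_erase hk)]
    rw [freq_pow_four, this, hτ]
    ring
  have e0 := hsum m fun _ _ => rfl
  have e1 := hsum (m - Pi.single i 1) fun k hk => by simp [hk]
  have e2 := hsum (m + Pi.single i 1) fun k hk => by simp [hk]
  have hsq : Real.sqrt τ = (2 * Real.pi) ^ 2 * Real.sqrt t := by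
    rw [hτ, mul_comm, Real.sqrt_mul (by positivity)]
    congr 1
    rw [show (2 * Real.pi) ^ 4 = ((2 * Real.pi) ^ 2) ^ 2 by ring, Real.sqrt_sq (by positivity)]
  rw [coeff_sinWeight_mul, coeff_heatKernel, coeff_heatKernel, coeff_heatKernel, e0, e1, e2]
  have := abs_second_difference_le (x := (m i : ℝ)) (τ := τ) (by positivity) hb0
  rw [hsq] at this
  refine le_of_eq_of_le ?_ this
  rw [← Real.norm_eq_abs, ← Complex.norm_real]
  push_cast
  simp

/-- The one-dimensional integral of `(1 + λ²(2 - 2 cos 2πx))^{-2/3}` is of order `1/λ`. -/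
theorem exists_integral_circle_le :
    ∃ C : ℝ, 0 < C ∧ ∀ l : ℝ, 0 < l →
      ∫ x : UnitAddCircle, (1 + l ^ 2 * (2 - 2 * (fourier 1 x : ℂ).re)) ^ (-(2 / 3) : ℝ) ≤
        C * l⁻¹ := by
  have hint : Integrable fun y : ℝ => (1 + y ^ 2) ^ (-(2 / 3) : ℝ) := by
    have := integrable_rpow_neg_one_add_norm_sq (E := ℝ) (μ := volume) (r := 4 / 3)
      (by simp; norm_num)
    convert this using 3 with y
    · simp
    · norm_num
  have hnn : ∀ y : ℝ, 0 ≤ (1 + y ^ 2) ^ (-(2 / 3) : ℝ) := fun y => by positivity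
  refine ⟨1 + ∫ y : ℝ, (1 + y ^ 2) ^ (-(2 / 3) : ℝ),
    add_pos_of_pos_of_nonneg one_pos (integral_nonneg fun y => hnn y), fun l hl => ?_⟩
  rw [← UnitAddCircle.intervalIntegral_preimage (-(1 / 2))]
  have hre : ∀ x : ℝ, ((fourier 1 (x : UnitAddCircle) : ℂ)).re = Real.cos (2 * Real.pi * x) := by
    intro x
    rw [fourier_coe_apply, ← Complex.exp_ofReal_mul_I_re]
    congr 2
    push_cast
    ring
  simp only [hre]
  have hcos : ∀ x : ℝ, |x| ≤ 1 / 2 → 16 * x ^ 2 ≤ 2 - 2 * Real.cos (2 * Real.pi * x) := by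
    intro x hx
    have := Real.cos_le_one_sub_mul_cos_sq (x := 2 * Real.pi * x) (by
      rw [abs_mul, abs_of_pos (by positivity)]
      nlinarith [Real.pi_pos])
    have e : 2 / Real.pi ^ 2 * (2 * Real.pi * x) ^ 2 = 8 * x ^ 2 := by
      field_simp
      ring
    linarith
  have hle : ∀ x : ℝ, |x| ≤ 1 / 2 →
      (1 + l ^ 2 * (2 - 2 * Real.cos (2 * Real.pi * x))) ^ (-(2 / 3) : ℝ) ≤
        (1 + (4 * l * x) ^ 2) ^ (-(2 / 3) : ℝ) := by
    intro x hx
    refine Real.rpow_le_rpow_of_nonpos (by positivity) ?_ (by norm_num)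
    nlinarith [mul_le_mul_of_nonneg_left (hcos x hx) (sq_nonneg l)]
  have hscale : Integrable fun x : ℝ => (1 + (4 * l * x) ^ 2) ^ (-(2 / 3) : ℝ) :=
    hint.comp_mul_left' (R := 4 * l) (by positivity)
  have hpos : ∀ x : ℝ, 0 < 1 + l ^ 2 * (2 - 2 * Real.cos (2 * Real.pi * x)) := fun x => by
    have : 0 ≤ l ^ 2 * (2 - 2 * Real.cos (2 * Real.pi * x)) :=
      mul_nonneg (sq_nonneg l) (by linarith [Real.cos_le_one (2 * Real.pi * x)])
    linarith
  calc ∫ x in (-(1 / 2) : ℝ)..(-(1 / 2) + 1),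
        (1 + l ^ 2 * (2 - 2 * Real.cos (2 * Real.pi * x))) ^ (-(2 / 3) : ℝ)
      ≤ ∫ x in (-(1 / 2) : ℝ)..(-(1 / 2) + 1), (1 + (4 * l * x) ^ 2) ^ (-(2 / 3) : ℝ) := by
        refine intervalIntegral.integral_mono_on (by norm_num) ?_ hscale.intervalIntegrable
          fun x hx => hle x (abs_le.2 ⟨hx.1, by linarith [hx.2]⟩)
        refine Continuous.intervalIntegrable ?_ _ _
        exact Continuous.rpow_const (by fun_prop) fun x => Or.inl (hpos x).ne'
    _ ≤ ∫ x : ℝ, (1 + (4 * l * x) ^ 2) ^ (-(2 / 3) : ℝ) := by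
        rw [intervalIntegral.integral_of_le (by norm_num)]
        exact setIntegral_le_integral hscale (ae_of_all _ fun x => by positivity)
    _ = (4 * l)⁻¹ * ∫ y : ℝ, (1 + y ^ 2) ^ (-(2 / 3) : ℝ) := by
        rw [Measure.integral_comp_mul_left (fun y : ℝ => (1 + y ^ 2) ^ (-(2 / 3) : ℝ)) (4 * l),
          abs_of_pos (by positivity), smul_eq_mul]
    _ ≤ (1 + ∫ y : ℝ, (1 + y ^ 2) ^ (-(2 / 3) : ℝ)) * l⁻¹ := by
        have h0 : 0 ≤ ∫ y : ℝ, (1 + y ^ 2) ^ (-(2 / 3) : ℝ) := integral_nonneg fun y => hnn y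
        rw [mul_inv, mul_comm]
        have : (0 : ℝ) < l⁻¹ := by positivity
        nlinarith [mul_nonneg h0 this.le]

/-- The weight `1 + λ² ∑_i (2 - 2 cos (2πx_i))`. -/
noncomputable def cosWeight (d : ℕ) (l : ℝ) : C(Torus d, ℝ) := 1 + l ^ 2 • ∑ i, sinWeight i

theorem cosWeight_apply {d : ℕ} (l : ℝ) (x : Torus d) :
    cosWeight d l x = 1 + ∑ i, l ^ 2 * sinWeight i x := by
  simp [cosWeight, Finset.mul_sum]

theorem one_le_cosWeight {d : ℕ} (l : ℝ) (x : Torus d) : 1 ≤ cosWeight d l x := by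
  rw [cosWeight_apply, le_add_iff_nonneg_right]
  exact Finset.sum_nonneg fun i _ => mul_nonneg (sq_nonneg l) (sinWeight_nonneg i x)

/-- The inverse of the weight, as a continuous function. -/
noncomputable def cosWeightInv (d : ℕ) (l : ℝ) : C(Torus d, ℝ) :=
  ⟨fun x => (cosWeight d l x)⁻¹, (cosWeight d l).continuous.inv₀ fun x =>
    (zero_lt_one.trans_le (one_le_cosWeight l x)).ne'⟩

theorem exists_integral_cosWeightInv_le {d : ℕ} (hd : d ≤ 3) :
    ∃ C : ℝ, 0 < C ∧ ∀ l : ℝ, 0 < l → ∫ x, cosWeightInv d l x ^ 2 ≤ (C * l⁻¹) ^ d := by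
  obtain ⟨C, hC, h⟩ := exists_integral_circle_le
  refine ⟨C, hC, fun l hl => ?_⟩
  set g : UnitAddCircle → ℝ := fun x =>
    (1 + l ^ 2 * (2 - 2 * (fourier 1 x : ℂ).re)) ^ (-(2 / 3) : ℝ)
  have hgw : ∀ (x : Torus d) i, g (x i) = (1 + l ^ 2 * sinWeight i x) ^ (-(2 / 3) : ℝ) :=
    fun _ _ => rfl
  have hpos : ∀ (x : Torus d) i, 1 ≤ 1 + l ^ 2 * sinWeight i x := fun x i =>
    le_add_of_nonneg_right (mul_nonneg (sq_nonneg l) (sinWeight_nonneg i x))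
  have hg0 : ∀ (x : Torus d) i, 0 ≤ g (x i) := fun x i => by
    rw [hgw]
    exact Real.rpow_nonneg (by linarith [hpos x i]) _
  have hgc : Continuous fun x : Torus d => ∏ i, g (x i) := by
    refine continuous_finsetProd _ fun i _ => ?_
    simp only [hgw]
    exact Continuous.rpow_const (by fun_prop) fun x => Or.inl (by linarith [hpos x i])
  -- Each factor `1 + A_i` is at most the weight, and `2d/3 ≤ 2`.
  have hle : ∀ x : Torus d, cosWeightInv d l x ^ 2 ≤ ∏ i, g (x i) := by
    intro x
    have hw := one_le_cosWeight l x
    have h1 : ∀ i ∈ (Finset.univ : Finset (Fin d)),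
        (cosWeight d l x) ^ (-(2 / 3) : ℝ) ≤ g (x i) := fun i _ => by
      rw [hgw]
      refine Real.rpow_le_rpow_of_nonpos (by linarith [hpos x i]) ?_ (by norm_num)
      rw [cosWeight_apply]
      gcongr
      exact Finset.single_le_sum (f := fun i => l ^ 2 * sinWeight i x)
        (fun i _ => mul_nonneg (sq_nonneg l) (sinWeight_nonneg i x)) (Finset.mem_univ i)
    have h2 := Finset.prod_le_prod (fun i _ => Real.rpow_nonneg (by linarith) _) h1
    refine le_trans ?_ h2
    rw [Finset.prod_const, Finset.card_univ, Fintype.card_fin, ← Real.rpow_natCast,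
      ← Real.rpow_natCast, ← Real.rpow_mul (by linarith)]
    change (cosWeight d l x)⁻¹ ^ ((2 : ℕ) : ℝ) ≤ _
    rw [Real.inv_rpow (by linarith), ← Real.rpow_neg (by linarith)]
    refine Real.rpow_le_rpow_of_exponent_le hw ?_
    have : (d : ℝ) ≤ 3 := by exact_mod_cast hd
    push_cast
    linarith
  calc ∫ x, cosWeightInv d l x ^ 2 ≤ ∫ x : Torus d, ∏ i, g (x i) :=
        integral_mono (integrable_of_continuous (by fun_prop)) (integrable_of_continuous hgc) hle
    _ = ∏ _i : Fin d, ∫ x, g x :=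
        integral_fintype_prod_volume_eq_prod (fun (_ : Fin d) (x : UnitAddCircle) => g x)
    _ = (∫ x, g x) ^ d := by simp
    _ ≤ (C * l⁻¹) ^ d := by
        refine pow_le_pow_left₀ (integral_nonneg fun x => ?_) (h l hl) d
        refine Real.rpow_nonneg ?_ _
        have := (Complex.re_le_norm (fourier 1 x)).trans (by rw [fourier_apply, Circle.norm_coe])
        have : 0 ≤ l ^ 2 * (2 - 2 * (fourier 1 x : ℂ).re) :=
          mul_nonneg (sq_nonneg l) (by linarith)
        linarith

/-- `P_t` is bounded on `C(𝕋^d)`, uniformly for `t ≤ U`: the `L¹` norm of `η_t` is bounded by the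
Cauchy-Schwarz inequality with the weight `1 + t^{-1/2} ∑_i (2 - 2 cos (2πx_i))`, which acts on the
symbol as a difference operator. -/
theorem exists_norm_heatOp_le {d : ℕ} (hd : d ≤ 3) (U : ℝ) :
    ∃ C : ℝ, 1 ≤ C ∧ ∀ t, 0 ≤ t → t ≤ U → ‖heatOp d t‖ ≤ C := by
  obtain ⟨C₀, hC₀, h₀⟩ := exists_tsum_exp_freq_le d U
  obtain ⟨C₁, hC₁, h₁⟩ := exists_integral_cosWeightInv_le hd
  set E := Real.exp (|U| * (2 * Real.pi) ^ 4 / 2) with hE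
  set D := 1 + d * (128 * (2 * Real.pi) ^ 2 * E) with hD
  have hD0 : 0 < D := by positivity
  set B := C₁ ^ d * (D ^ 2 * (C₀ * (1 / 8) ^ (-((d : ℝ) / 4)))) with hB
  refine ⟨1 + Real.sqrt B, by simp, fun t ht htU => ?_⟩
  rcases ht.eq_or_lt with rfl | ht
  · rw [heatOp_zero]
    refine ContinuousLinearMap.norm_id_le.trans (by simp)
  rw [heatOp_of_pos ht]
  refine (norm_conv_le_integral _).trans (le_trans ?_ (by linarith : Real.sqrt B ≤ _))
  set l : ℝ := t ^ (-(1 / 4) : ℝ) with hl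
  have hl0 : 0 < l := by positivity
  have hl2 : l ^ 2 * Real.sqrt t = 1 := by
    rw [hl, Real.sqrt_eq_rpow, ← Real.rpow_natCast, ← Real.rpow_mul ht.le, ← Real.rpow_add ht]
    norm_num
  set η := (heatKernel d ht).1
  have hfac : ∀ x, |η x| = |cosWeightInv d l x * (cosWeight d l * η) x| := by
    intro x
    have hw := one_le_cosWeight l x
    change _ = |(cosWeight d l x)⁻¹ * (cosWeight d l x * η x)|
    rw [inv_mul_cancel_left₀ (by linarith)]
  have hcoef : ∀ m, ‖coeff m (cosWeight d l * η)‖ ≤ D * Real.exp (-t * freq m ^ 4 / 16) := by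
    intro m
    have e : cosWeight d l * η = η + l ^ 2 • ∑ i, sinWeight i * η := by
      rw [cosWeight, add_mul, one_mul, smul_mul_assoc, Finset.sum_mul]
    rw [e, map_add, map_smul, map_sum]
    have b1 : ‖coeff m η‖ ≤ Real.exp (-t * freq m ^ 4 / 16) := by
      rw [coeff_heatKernel, Complex.norm_real, Real.norm_of_nonneg (Real.exp_pos _).le,
        Real.exp_le_exp]
      have : 0 ≤ t * freq m ^ 4 := by have := freq_nonneg m; positivity
      linarith
    have b2 : ∀ i ∈ (Finset.univ : Finset (Fin d)), ‖coeff m (sinWeight i * η)‖ ≤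
        128 * ((2 * Real.pi) ^ 2 * Real.sqrt t) * E * Real.exp (-t * freq m ^ 4 / 16) := by
      intro i _
      refine (coeff_sinWeight_mul_heatKernel_le ht i m).trans ?_
      rw [hE]
      gcongr
      exact htU.trans (le_abs_self U)
    have b3 := norm_sum_le_of_le _ b2
    rw [Finset.sum_const, Finset.card_univ, Fintype.card_fin, nsmul_eq_mul] at b3
    refine (norm_add_le _ _).trans ?_
    rw [norm_smul, Real.norm_of_nonneg (sq_nonneg l)]
    calc _ ≤ Real.exp (-t * freq m ^ 4 / 16) + l ^ 2 * (d * (128 * ((2 * Real.pi) ^ 2 *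
            Real.sqrt t) * E * Real.exp (-t * freq m ^ 4 / 16))) := by gcongr
      _ = Real.exp (-t * freq m ^ 4 / 16) + (l ^ 2 * Real.sqrt t) * (d * (128 *
            (2 * Real.pi) ^ 2 * E * Real.exp (-t * freq m ^ 4 / 16))) := by ring
      _ = D * Real.exp (-t * freq m ^ 4 / 16) := by
          rw [hl2, hD]
          ring
  have hL2 : ∫ x, (cosWeight d l * η) x ^ 2 ≤ D ^ 2 * (C₀ * (t / 8) ^ (-((d : ℝ) / 4))) := by
    have hs := summable_exp_freq d (t := t / 8) (by positivity)
    have hle := (hasSum_sq_coeff (cosWeight d l * η)).summable.tsum_le_tsum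
      (g := fun m => D ^ 2 * Real.exp (-(t / 8) * freq m ^ 4)) (fun m => by
        refine (pow_le_pow_left₀ (norm_nonneg _) (hcoef m) 2).trans (le_of_eq ?_)
        rw [mul_pow, ← Real.exp_nat_mul]
        push_cast
        ring_nf) (hs.mul_left _)
    rw [(hasSum_sq_coeff _).tsum_eq, tsum_mul_left] at hle
    refine hle.trans ?_
    gcongr
    exact h₀ _ (by positivity) (by linarith)
  have hCS := integral_abs_mul_le (cosWeightInv d l) (cosWeight d l * η)
  simp only [← hfac] at hCS
  refine Real.le_sqrt_of_sq_le (hCS.trans ?_)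
  have hpow : (l⁻¹) ^ d * (t / 8) ^ (-((d : ℝ) / 4)) = (1 / 8) ^ (-((d : ℝ) / 4)) := by
    have : (l⁻¹) ^ d = t ^ ((d : ℝ) / 4) := by
      rw [hl, ← Real.rpow_neg ht.le, ← Real.rpow_natCast, ← Real.rpow_mul ht.le]
      ring_nf
    rw [this, div_eq_mul_one_div t 8, Real.mul_rpow ht.le (by norm_num), ← mul_assoc,
      ← Real.rpow_add ht, add_neg_cancel, Real.rpow_zero, one_mul]
  calc _ ≤ (C₁ * l⁻¹) ^ d * (D ^ 2 * (C₀ * (t / 8) ^ (-((d : ℝ) / 4)))) := by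
        refine mul_le_mul (h₁ l hl0) hL2 (integral_nonneg fun _ => sq_nonneg _) (by positivity)
    _ = C₁ ^ d * (D ^ 2 * (C₀ * ((l⁻¹) ^ d * (t / 8) ^ (-((d : ℝ) / 4))))) := by ring
    _ = B := by rw [hpow]

/-! ### Singular Volterra equations in a Banach space -/

section Volterra

variable {E : Type*} [NormedAddCommGroup E] [NormedSpace ℝ E]

/-- The operators `S_t`, `t > 0`, are norm continuous in `t` and `‖S_t‖ ≤ C t^{-γ}` with `γ < 1`,
locally uniformly in `t ∈ [0, ∞)`. -/
structure IsSingularKernel (S : ℝ → E →L[ℝ] E) (γ : ℝ) : Prop where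
  lt_one : γ < 1
  continuousOn : ContinuousOn S (Set.Ioi 0)
  bound : ∀ U : ℝ, ∃ C : ℝ, 0 ≤ C ∧ ∀ t, 0 < t → t ≤ U → ‖S t‖ ≤ C * t ^ (-γ)

/-- The Volterra integral `∫_0^r S_{r-q} u(q) dq`. -/
noncomputable def volterra (S : ℝ → E →L[ℝ] E) (u : ℝ → E) (r : ℝ) : E :=
  ∫ q in (0 : ℝ)..r, S (r - q) (u q)

theorem volterra_congr {S : ℝ → E →L[ℝ] E} {u v : ℝ → E} {r : ℝ} (hr : 0 ≤ r)
    (h : ∀ q ∈ Set.Icc 0 r, u q = v q) : volterra S u r = volterra S v r := by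
  refine intervalIntegral.integral_congr fun q hq => ?_
  rw [Set.uIcc_of_le hr] at hq
  simp only [h q hq]

variable {S : ℝ → E →L[ℝ] E} {γ : ℝ}

theorem intervalIntegrable_rpow_sub (hγ : γ < 1) (a b r : ℝ) :
    IntervalIntegrable (fun q => (r - q) ^ (-γ)) volume a b := by
  have := (intervalIntegral.intervalIntegrable_rpow' (a := r - a) (b := r - b) (r := -γ)
    (by linarith)).comp_sub_left r
  simpa using this

theorem IsSingularKernel.intervalIntegrable (hS : IsSingularKernel S γ) {a r : ℝ} (har : a ≤ r)
    {u : ℝ → E} (hu : ContinuousOn u (Set.Icc a r)) :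
    IntervalIntegrable (fun q => S (r - q) (u q)) volume a r := by
  obtain ⟨C, hC, hb⟩ := hS.bound (r - a)
  obtain ⟨B, hB⟩ := isCompact_Icc.exists_bound_of_continuousOn hu
  have hg := ((intervalIntegrable_rpow_sub hS.lt_one a r r).const_mul C).mul_const B
  rw [intervalIntegrable_iff_integrableOn_Ioo_of_le har] at hg ⊢
  refine Integrable.mono' hg (ContinuousOn.aestronglyMeasurable ?_ measurableSet_Ioo) ?_
  · exact (hS.continuousOn.comp (by fun_prop) fun q hq => sub_pos.2 hq.2).clm_apply
      (hu.mono Set.Ioo_subset_Icc_self)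
  · refine (ae_restrict_iff' measurableSet_Ioo).2 (ae_of_all _ fun q hq => ?_)
    refine (ContinuousLinearMap.le_opNorm _ _).trans ?_
    have h0 := hb (r - q) (sub_pos.2 hq.2) (by linarith [hq.1])
    exact mul_le_mul h0 (hB q ⟨hq.1.le, hq.2.le⟩) (norm_nonneg _)
      ((norm_nonneg _).trans h0)

theorem IsSingularKernel.norm_integral_le {a r C B : ℝ} (hγ : γ < 1) (har : a ≤ r)
    (hC : ∀ t, 0 < t → t ≤ r - a → ‖S t‖ ≤ C * t ^ (-γ)) {u : ℝ → E}
    (hB : ∀ q ∈ Set.Ico a r, ‖u q‖ ≤ B) :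
    ‖∫ q in a..r, S (r - q) (u q)‖ ≤ C * B * ((r - a) ^ (1 - γ) / (1 - γ)) := by
  have hg := ((intervalIntegrable_rpow_sub hγ a r r).const_mul C).mul_const B
  have hle : ∀ q ∈ Set.Ico a r, ‖S (r - q) (u q)‖ ≤ C * (r - q) ^ (-γ) * B := fun q hq => by
    have h0 := hC (r - q) (sub_pos.2 hq.2) (by linarith [hq.1])
    exact (ContinuousLinearMap.le_opNorm _ _).trans
      (mul_le_mul h0 (hB q hq) (norm_nonneg _) ((norm_nonneg _).trans h0))
  have hne : ∀ᵐ q : ℝ, q ≠ r := by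
    simp [ae_iff, measure_singleton]
  have h1 := intervalIntegral.norm_integral_le_of_norm_le har
    (f := fun q => S (r - q) (u q)) (g := fun q => C * (r - q) ^ (-γ) * B)
    (by filter_upwards [hne] with q hq hqI
        exact hle q ⟨hqI.1.le, lt_of_le_of_ne hqI.2 hq⟩) hg
  refine h1.trans (le_of_eq ?_)
  rw [intervalIntegral.integral_mul_const, intervalIntegral.integral_const_mul,
    intervalIntegral.integral_comp_sub_left (fun x => x ^ (-γ)) r, sub_self,
    integral_rpow (Or.inl (by linarith)), show -γ + 1 = 1 - γ by ring,
    Real.zero_rpow (by linarith), sub_zero]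
  ring

/-- The substitution `s = r - q`, with the integral extended by zero to an interval that does not
depend on `r`: in this form continuity in `r` follows by dominated convergence. -/
theorem volterra_eq_integral (u : ℝ → E) {r T : ℝ} (hr : 0 ≤ r) (hrT : r ≤ T) :
    volterra S u r =
      ∫ s in Set.Ioo 0 T, (Set.Iio r).indicator (fun s => S s (u (r - s))) s := by
  have h1 : volterra S u r = ∫ s in (0 : ℝ)..r, S s (u (r - s)) := by
    have := intervalIntegral.integral_comp_sub_left (a := 0) (b := r)
      (fun s => S s (u (r - s))) r
    simp only [sub_sub_cancel, sub_self, sub_zero] at this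
    exact this
  rw [h1, intervalIntegral.integral_of_le hr, integral_Ioc_eq_integral_Ioo,
    setIntegral_indicator measurableSet_Iio]
  congr 2
  ext s
  simp only [Set.mem_Ioo, Set.mem_inter_iff, Set.mem_Iio]
  constructor
  · rintro ⟨h1, h2⟩
    exact ⟨⟨h1, by linarith⟩, h2⟩
  · rintro ⟨⟨h1, -⟩, h2⟩
    exact ⟨h1, h2⟩

theorem IsSingularKernel.continuousOn_volterra_of_continuous (hS : IsSingularKernel S γ) (T : ℝ)
    {u : ℝ → E} (hu : Continuous u) : ContinuousOn (volterra S u) (Set.Icc 0 T) := by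
  obtain ⟨C, hC, hb⟩ := hS.bound T
  obtain ⟨B, hB⟩ := (isCompact_Icc (a := -T) (b := T)).exists_bound_of_continuousOn hu.continuousOn
  suffices h : ContinuousOn (fun r => ∫ s in Set.Ioo 0 T,
      (Set.Iio r).indicator (fun s => S s (u (r - s))) s) (Set.Icc 0 T) from
    h.congr fun r hr => volterra_eq_integral u hr.1 hr.2
  intro r₀ hr₀
  refine continuousWithinAt_of_dominated (bound := fun s => C * s ^ (-γ) * B) ?_ ?_ ?_ ?_
  · refine eventually_nhdsWithin_of_forall fun r hr => ?_
    refine AEStronglyMeasurable.indicator ?_ measurableSet_Iio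
    refine ContinuousOn.aestronglyMeasurable ?_ measurableSet_Ioo
    exact (hS.continuousOn.mono fun s hs => hs.1).clm_apply (by fun_prop)
  · refine eventually_nhdsWithin_of_forall fun r hr => ?_
    refine (ae_restrict_iff' measurableSet_Ioo).2 (ae_of_all _ fun s hs => ?_)
    have h0 := hb s hs.1 hs.2.le
    refine (norm_indicator_le_norm_self _ _).trans ((ContinuousLinearMap.le_opNorm _ _).trans ?_)
    exact mul_le_mul h0 (hB _ ⟨by linarith [hs.2, hr.1], by linarith [hs.1, hr.2]⟩)
      (norm_nonneg _) ((norm_nonneg _).trans h0)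
  · rcases le_or_gt T 0 with hT | hT
    · simp [Set.Ioo_eq_empty_of_le hT]
    have := ((intervalIntegral.intervalIntegrable_rpow' (a := 0) (b := T) (r := -γ)
      (by linarith [hS.lt_one])).const_mul C).mul_const B
    rwa [intervalIntegrable_iff_integrableOn_Ioo_of_le hT.le] at this
  · have hne : ∀ᵐ s : ℝ, s ≠ r₀ := by simp [ae_iff, measure_singleton]
    filter_upwards [ae_restrict_of_ae hne] with s hs
    refine ContinuousAt.continuousWithinAt ?_
    rcases lt_or_gt_of_ne hs with h | h
    · have hc : ContinuousAt (fun r => S s (u (r - s))) r₀ := by fun_prop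
      refine hc.congr ?_
      filter_upwards [lt_mem_nhds h] with r hr
      rw [Set.indicator_of_mem (show s ∈ Set.Iio r from hr)]
    · refine continuousAt_const (y := (0 : E)) |>.congr ?_
      filter_upwards [gt_mem_nhds h] with r hr
      rw [Set.indicator_of_notMem (show s ∉ Set.Iio r from not_lt.2 (le_of_lt hr))]

theorem IsSingularKernel.continuousOn_volterra (hS : IsSingularKernel S γ) {T : ℝ} (hT : 0 ≤ T)
    {u : ℝ → E} (hu : ContinuousOn u (Set.Icc 0 T)) :
    ContinuousOn (volterra S u) (Set.Icc 0 T) := by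
  refine (hS.continuousOn_volterra_of_continuous T
    ((continuousOn_iff_continuous_domRestrict.1 hu).Icc_extend' (h := hT))).congr fun r hr => ?_
  refine volterra_congr hr.1 fun q hq => ?_
  rw [Set.IccExtend_of_mem hT _ ⟨hq.1, hq.2.trans hr.2⟩]
  rfl

theorem IsSingularKernel.integrableOn_norm (hS : IsSingularKernel S γ) {T : ℝ} (hT : 0 ≤ T) :
    IntegrableOn (fun s => ‖S s‖) (Set.Ioo 0 T) := by
  obtain ⟨C, hC, hb⟩ := hS.bound T
  have hg := (intervalIntegral.intervalIntegrable_rpow' (a := 0) (b := T) (r := -γ)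
      (by linarith [hS.lt_one])).const_mul C
  rw [intervalIntegrable_iff_integrableOn_Ioo_of_le hT] at hg
  refine Integrable.mono' hg (ContinuousOn.aestronglyMeasurable
    ((hS.continuousOn.mono fun s hs => hs.1).norm) measurableSet_Ioo) ?_
  refine (ae_restrict_iff' measurableSet_Ioo).2 (ae_of_all _ fun s hs => ?_)
  rw [norm_norm]
  exact hb s hs.1 hs.2.le

theorem IsSingularKernel.norm_volterra_le (hS : IsSingularKernel S γ) {T r : ℝ} (hr : 0 ≤ r)
    (hrT : r ≤ T) {u : ℝ → E} {B : ℝ} (hB : ∀ q, ‖u q‖ ≤ B) :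
    ‖volterra S u r‖ ≤ (∫ s in Set.Ioo 0 T, ‖S s‖) * B := by
  rw [volterra_eq_integral u hr hrT, ← integral_mul_const]
  refine norm_integral_le_of_norm_le ((hS.integrableOn_norm (hr.trans hrT)).mul_const B)
    (ae_of_all _ fun s => (norm_indicator_le_norm_self _ _).trans ?_)
  exact (ContinuousLinearMap.le_opNorm _ _).trans
    (mul_le_mul_of_nonneg_left (hB _) (norm_nonneg _))

/-- The exponentially weighted kernel `e^{-λt} S_t`. -/
theorem IsSingularKernel.exp_smul (hS : IsSingularKernel S γ) {l : ℝ} (hl : 0 ≤ l) :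
    IsSingularKernel (fun t => Real.exp (-l * t) • S t) γ where
  lt_one := hS.lt_one
  continuousOn := (show Continuous fun t => Real.exp (-l * t) by fun_prop).continuousOn.fun_smul
    hS.continuousOn
  bound U := by
    obtain ⟨C, hC, hb⟩ := hS.bound U
    refine ⟨C, hC, fun t ht htU => ?_⟩
    rw [norm_smul, Real.norm_of_nonneg (Real.exp_pos _).le]
    exact (mul_le_of_le_one_left (norm_nonneg _) (Real.exp_le_one_iff.2 (by nlinarith))).trans
      (hb t ht htU)

theorem IsSingularKernel.exists_exp_smul_le (hS : IsSingularKernel S γ) {T : ℝ} (hT : 0 ≤ T)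
    {ε : ℝ} (hε : 0 < ε) :
    ∃ l : ℝ, 0 ≤ l ∧ ∫ s in Set.Ioo 0 T, ‖Real.exp (-l * s) • S s‖ < ε := by
  have h : Tendsto (fun n : ℕ => ∫ s in Set.Ioo 0 T, ‖Real.exp (-(n : ℝ) * s) • S s‖) atTop
      (𝓝 (∫ s in Set.Ioo 0 T, (0 : ℝ))) := by
    refine tendsto_integral_of_dominated_convergence (fun s => ‖S s‖) (fun n => ?_)
      (hS.integrableOn_norm hT) (fun n => ?_) ?_
    · exact ((hS.exp_smul n.cast_nonneg).integrableOn_norm hT).aestronglyMeasurable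
    · refine (ae_restrict_iff' measurableSet_Ioo).2 (ae_of_all _ fun s hs => ?_)
      rw [norm_norm, norm_smul, Real.norm_of_nonneg (Real.exp_pos _).le]
      refine mul_le_of_le_one_left (norm_nonneg _) (Real.exp_le_one_iff.2 ?_)
      have : (0 : ℝ) ≤ n * s := mul_nonneg n.cast_nonneg hs.1.le
      linarith
    · refine (ae_restrict_iff' measurableSet_Ioo).2 (ae_of_all _ fun s hs => ?_)
      simp only [norm_smul, Real.norm_of_nonneg (Real.exp_pos _).le]
      have h1 : Tendsto (fun n : ℕ => Real.exp (-(n : ℝ) * s)) atTop (𝓝 0) := by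
        refine Real.tendsto_exp_atBot.comp ?_
        have := (tendsto_natCast_atTop_atTop (R := ℝ)).atTop_mul_const hs.1
        refine (tendsto_neg_atTop_atBot.comp this).congr fun n => ?_
        simp
      simpa using h1.mul_const ‖S s‖
  rw [integral_zero] at h
  obtain ⟨n, hn⟩ := (h.eventually (gt_mem_nhds hε)).exists
  exact ⟨n, n.cast_nonneg, hn⟩

theorem volterra_exp_smul (l : ℝ) (u : ℝ → E) (r : ℝ) :
    volterra (fun t => Real.exp (-l * t) • S t) (fun q => Real.exp (-l * q) • u q) r =
      Real.exp (-l * r) • volterra S u r := by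
  rw [volterra, volterra, ← intervalIntegral.integral_smul]
  refine intervalIntegral.integral_congr fun q _ => ?_
  simp only [smul_apply, map_smul, smul_smul, ← Real.exp_add]
  ring_nf

variable [CompleteSpace E]

/-- The contraction principle for `v = G + ∫_0^r S_{r-q} M(q, v(q)) dq` in `C([0, T], E)`, when the
Lipschitz constant of `M` times `∫_0^T ‖S_s‖ ds` is less than `1`. -/
theorem IsSingularKernel.existsUnique_of_small (hS : IsSingularKernel S γ) {T : ℝ} (hT : 0 ≤ T)
    {M : ℝ → E → E} (hM : Continuous (Function.uncurry M)) {L : ℝ} (hL0 : 0 ≤ L)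
    (hL : ∀ q v w, ‖M q v - M q w‖ ≤ L * ‖v - w‖)
    (hsmall : L * ∫ s in Set.Ioo 0 T, ‖S s‖ < 1) {G : ℝ → E}
    (hG : ContinuousOn G (Set.Icc 0 T)) :
    ∃! v : C(Set.Icc 0 T, E), ∀ r : Set.Icc 0 T,
      v r = G r + volterra S (fun q => M q (Set.IccExtend hT v q)) r := by
  have hext : ∀ v : C(Set.Icc 0 T, E), Continuous fun q => M q (Set.IccExtend hT v q) := fun v =>
    hM.comp (continuous_id.prodMk v.continuous.Icc_extend')
  set Φ : C(Set.Icc 0 T, E) → C(Set.Icc 0 T, E) := fun v =>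
    ⟨fun r => G r + volterra S (fun q => M q (Set.IccExtend hT v q)) r,
      continuousOn_iff_continuous_domRestrict.1
        (hG.add (hS.continuousOn_volterra_of_continuous T (hext v)))⟩ with hΦ
  set I := ∫ s in Set.Ioo 0 T, ‖S s‖
  have hI : 0 ≤ I := integral_nonneg fun _ => norm_nonneg _
  have hcontr : ContractingWith (L * I).toNNReal Φ := by
    refine ⟨by rw [← NNReal.coe_lt_coe, Real.coe_toNNReal _ (by positivity)]; simpa using hsmall,
      LipschitzWith.of_dist_le_mul fun v w => ?_⟩
    rw [Real.coe_toNNReal _ (by positivity), dist_eq_norm, dist_eq_norm,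
      ContinuousMap.norm_le _ (by positivity)]
    intro r
    have h1 : (Φ v - Φ w) r = volterra S
        (fun q => M q (Set.IccExtend hT v q) - M q (Set.IccExtend hT w q)) r := by
      change (G r + _) - (G r + _) = _
      rw [add_sub_add_left_eq_sub, volterra, volterra, volterra,
        ← intervalIntegral.integral_sub (hS.intervalIntegrable r.2.1 (hext v).continuousOn)
          (hS.intervalIntegrable r.2.1 (hext w).continuousOn)]
      simp only [map_sub]
    rw [h1]
    refine (hS.norm_volterra_le r.2.1 r.2.2 (B := L * ‖v - w‖) fun q => ?_).trans
      (le_of_eq (by ring))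
    refine (hL q _ _).trans (mul_le_mul_of_nonneg_left ?_ hL0)
    exact (v - w).norm_coe_le_norm (Set.projIcc 0 T hT q)
  refine ⟨hcontr.fixedPoint Φ, fun r => ?_, fun w hw => ?_⟩
  · exact congrArg (fun v : C(Set.Icc 0 T, E) => v r) hcontr.fixedPoint_isFixedPt.symm
  · exact hcontr.fixedPoint_unique (ContinuousMap.ext fun r => (hw r).symm)

/-- Global existence and uniqueness for a globally Lipschitz nonlinearity, by contraction for a norm
with an exponential weight in time. -/
theorem IsSingularKernel.existsUnique_of_lipschitz (hS : IsSingularKernel S γ) {T : ℝ} (hT : 0 ≤ T)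
    {N : E → E} {L : NNReal} (hN : LipschitzWith L N) {G : ℝ → E}
    (hG : ContinuousOn G (Set.Icc 0 T)) :
    (∃ f : ℝ → E, Continuous f ∧ ∀ r ∈ Set.Icc 0 T, f r = G r + volterra S (fun q => N (f q)) r) ∧
    ∀ f h : ℝ → E, ContinuousOn f (Set.Icc 0 T) → ContinuousOn h (Set.Icc 0 T) →
      (∀ r ∈ Set.Icc 0 T, f r = G r + volterra S (fun q => N (f q)) r) →
      (∀ r ∈ Set.Icc 0 T, h r = G r + volterra S (fun q => N (h q)) r) →
      ∀ r ∈ Set.Icc 0 T, f r = h r := by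
  obtain ⟨l, hl, hI⟩ := hS.exists_exp_smul_le hT (ε := ((L : ℝ) + 1)⁻¹) (by positivity)
  set M : ℝ → E → E := fun q v => Real.exp (-l * q) • N (Real.exp (l * q) • v) with hM
  have hMc : Continuous (Function.uncurry M) := by
    have := hN.continuous
    simp only [hM, Function.uncurry_def]
    fun_prop
  have hML : ∀ q v w, ‖M q v - M q w‖ ≤ L * ‖v - w‖ := by
    intro q v w
    rw [hM, ← smul_sub, norm_smul, Real.norm_of_nonneg (Real.exp_pos _).le]
    have h1 := hN.dist_le_mul (Real.exp (l * q) • v) (Real.exp (l * q) • w)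
    rw [dist_eq_norm, dist_eq_norm, ← smul_sub, norm_smul,
      Real.norm_of_nonneg (Real.exp_pos _).le] at h1
    calc _ ≤ Real.exp (-l * q) * (L * (Real.exp (l * q) * ‖v - w‖)) := by gcongr
      _ = (Real.exp (-l * q) * Real.exp (l * q)) * (L * ‖v - w‖) := by ring
      _ = L * ‖v - w‖ := by
        rw [← Real.exp_add, neg_mul, neg_add_cancel, Real.exp_zero, one_mul]
  have hsmall : (L : ℝ) * ∫ s in Set.Ioo 0 T, ‖Real.exp (-l * s) • S s‖ < 1 := by
    have h0 : 0 ≤ ∫ s in Set.Ioo 0 T, ‖Real.exp (-l * s) • S s‖ :=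
      integral_nonneg fun _ => norm_nonneg _
    have h1 : (0 : ℝ) < L + 1 := by positivity
    rw [← one_div, lt_div_iff₀ h1] at hI
    linarith
  have hexp : Continuous fun r => Real.exp (-l * r) := by fun_prop
  obtain ⟨v, hv, hvu⟩ := (hS.exp_smul hl).existsUnique_of_small hT hMc L.2 hML hsmall
    (G := fun r => Real.exp (-l * r) • G r) (hexp.continuousOn.fun_smul hG)
  have hcancel : ∀ (r : ℝ) (x : E), Real.exp (l * r) • Real.exp (-l * r) • x = x := fun r x => by
    rw [smul_smul, ← Real.exp_add, neg_mul, add_neg_cancel, Real.exp_zero, one_smul]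
  refine ⟨⟨fun r => Real.exp (l * r) • Set.IccExtend hT v r, ?_, fun r hr => ?_⟩, ?_⟩
  · exact Continuous.smul (by fun_prop) v.continuous.Icc_extend'
  · have h1 := hv ⟨r, hr⟩
    simp only [hM] at h1
    rw [volterra_exp_smul, ← smul_add] at h1
    simp only
    rw [Set.IccExtend_of_mem hT _ hr, h1, hcancel]
  · have key : ∀ f : ℝ → E, (hf : ContinuousOn f (Set.Icc 0 T)) →
        (∀ r ∈ Set.Icc 0 T, f r = G r + volterra S (fun q => N (f q)) r) →
        ∀ r (hr : r ∈ Set.Icc 0 T), f r = Real.exp (l * r) • v ⟨r, hr⟩ := by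
      intro f hf hfe r hr
      have hwc : Continuous fun r : Set.Icc 0 T => Real.exp (-l * r) • f r :=
        continuousOn_iff_continuous_domRestrict.1 (hexp.continuousOn.fun_smul hf)
      obtain ⟨w, hw⟩ : ∃ w : C(Set.Icc 0 T, E), ∀ r, w r = Real.exp (-l * r) • f r :=
        ⟨⟨_, hwc⟩, fun _ => rfl⟩
      have h1 := hvu w fun r => by
        rw [hw, volterra_congr r.2.1 (v := fun q => Real.exp (-l * q) • N (f q)) fun q hq => by
          rw [hM, Set.IccExtend_of_mem hT _ ⟨hq.1, hq.2.trans r.2.2⟩, hw]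
          simp only [hcancel], volterra_exp_smul, ← smul_add, ← hfe r r.2]
      rw [← h1, hw, hcancel]
    intro f h hf hh hfe hhe r hr
    rw [key f hf hfe r hr, key h hh hhe r hr]

end Volterra

/-! ### Maximal solutions and blow-up -/

/-- Every ball carries a globally Lipschitz map that agrees with `N` on it. -/
def HasLipschitzTruncations {E : Type*} [NormedAddCommGroup E] (N : E → E) : Prop :=
  ∀ R : ℝ, ∃ (N' : E → E) (L : NNReal), LipschitzWith L N' ∧ ∀ u, ‖u‖ ≤ R → N' u = N u

theorem HasLipschitzTruncations.continuous {E : Type*} [NormedAddCommGroup E]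
    {N : E → E} (hN : HasLipschitzTruncations N) : Continuous N := by
  refine continuous_iff_continuousAt.2 fun u => ?_
  obtain ⟨N', L, hL, he⟩ := hN (‖u‖ + 1)
  refine hL.continuous.continuousAt.congr ?_
  filter_upwards [continuous_norm.continuousAt.eventually (gt_mem_nhds (lt_add_one ‖u‖))] with v hv
  exact he v hv.le

theorem HasLipschitzTruncations.exists_bound {E : Type*} [NormedAddCommGroup E]
    {N : E → E} (hN : HasLipschitzTruncations N) (R : ℝ) :
    ∃ B : ℝ, 0 ≤ B ∧ ∀ u, ‖u‖ ≤ R → ‖N u‖ ≤ B := by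
  obtain ⟨N', L, hL, he⟩ := hN R
  refine ⟨‖N' 0‖ + L * |R|, by positivity, fun u hu => ?_⟩
  rw [← he u hu]
  have h1 := hL.dist_le_mul u 0
  rw [dist_eq_norm, dist_eq_norm, sub_zero] at h1
  have h2 := norm_add_le (N' u - N' 0) (N' 0)
  rw [sub_add_cancel] at h2
  have h3 : (L : ℝ) * ‖u‖ ≤ L * |R| := by
    gcongr
    exact hu.trans (le_abs_self R)
  linarith

section Maximal

variable {E : Type*} [NormedAddCommGroup E] [NormedSpace ℝ E]

/-- `f` is continuous on `[0, b)` and `f(r) = G(r) + ∫_0^r S_{r-q} N(f(q)) dq` there. -/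
structure IsVolterraSolution (S : ℝ → E →L[ℝ] E) (N : E → E) (G : ℝ → E) (b : EReal) (f : ℝ → E) :
    Prop where
  continuousOn : ∀ U : ℝ, 0 ≤ U → (U : EReal) < b → ContinuousOn f (Set.Icc 0 U)
  equation : ∀ r : ℝ, 0 ≤ r → (r : EReal) < b → f r = G r + volterra S (fun q => N (f q)) r

variable {S : ℝ → E →L[ℝ] E} {γ : ℝ} {N : E → E} {G : ℝ → E}

/-- The equation on `[0, T]` for a solution bounded by `R` is also solved with the truncated
nonlinearity. -/
theorem IsVolterraSolution.truncated {b : EReal} {f : ℝ → E} (h : IsVolterraSolution S N G b f)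
    {N' : E → E} {R T : ℝ} (hN' : ∀ u, ‖u‖ ≤ R → N' u = N u)
    (hR : ∀ r ∈ Set.Icc 0 T, ‖f r‖ ≤ R) (hT : (T : EReal) < b) :
    ∀ r ∈ Set.Icc 0 T, f r = G r + volterra S (fun q => N' (f q)) r := by
  intro r hr
  rw [h.equation r hr.1 (lt_of_le_of_lt (EReal.coe_le_coe_iff.2 hr.2) hT)]
  congr 1
  exact volterra_congr hr.1 fun q hq => (hN' _ (hR q ⟨hq.1, hq.2.trans hr.2⟩)).symm

/-- A continuous solution of the truncated equation that stays in the ball on `[0, b]` continues to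
solve the original equation beyond `b`. -/
theorem exists_isVolterraSolution_of_norm_lt {N' : E → E} {R T b : ℝ} (hbT : b < T)
    (hb : 0 ≤ b) (he : ∀ u, ‖u‖ ≤ R → N' u = N u) {f : ℝ → E} (hfc : Continuous f)
    (hf : ∀ r ∈ Set.Icc 0 T, f r = G r + volterra S (fun q => N' (f q)) r)
    (hR : ∀ r ∈ Set.Icc 0 b, ‖f r‖ < R) :
    ∃ b' : ℝ, b < b' ∧ IsVolterraSolution S N G b' f := by
  have h1 : ∀ᶠ r in 𝓝 b, ‖f r‖ < R :=
    hfc.norm.continuousAt.eventually (gt_mem_nhds (hR b ⟨hb, le_rfl⟩))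
  obtain ⟨δ, hδ, hδR⟩ := Metric.eventually_nhds_iff.1 h1
  refine ⟨min (b + δ) T, lt_min (by linarith) hbT, fun U _ _ => hfc.continuousOn, fun r h0 hr => ?_⟩
  have hr' : r < min (b + δ) T := EReal.coe_lt_coe_iff.1 hr
  rw [hf r ⟨h0, (hr'.trans_le (min_le_right _ _)).le⟩]
  congr 1
  refine volterra_congr h0 fun q hq => he _ ?_
  rcases le_or_gt q b with h | h
  · exact (hR q ⟨hq.1, h⟩).le
  · refine (hδR ?_).le
    rw [Real.dist_eq, abs_of_pos (by linarith)]
    linarith [hq.2, min_le_left (b + δ) T]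

variable [CompleteSpace E]

theorem IsVolterraSolution.unique (hS : IsSingularKernel S γ) (hN : HasLipschitzTruncations N)
    (hG : ContinuousOn G (Set.Ici 0)) {b b' : EReal} {f h : ℝ → E}
    (hf : IsVolterraSolution S N G b f) (hh : IsVolterraSolution S N G b' h) {r : ℝ} (hr : 0 ≤ r)
    (hrb : (r : EReal) < b) (hrb' : (r : EReal) < b') : f r = h r := by
  have hfc := hf.continuousOn r hr hrb
  have hhc := hh.continuousOn r hr hrb'
  obtain ⟨R₁, hR₁⟩ := isCompact_Icc.exists_bound_of_continuousOn hfc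
  obtain ⟨R₂, hR₂⟩ := isCompact_Icc.exists_bound_of_continuousOn hhc
  obtain ⟨N', L, hL, he⟩ := hN (max R₁ R₂)
  exact (hS.existsUnique_of_lipschitz hr hL (hG.mono Set.Icc_subset_Ici_self)).2 f h hfc hhc
    (hf.truncated he (fun q hq => (hR₁ q hq).trans (le_max_left _ _)) hrb)
    (hh.truncated he (fun q hq => (hR₂ q hq).trans (le_max_right _ _)) hrb') r ⟨hr, le_rfl⟩

/-- Local existence: the solution with a truncated nonlinearity starts at `G 0` and, being
continuous, stays for some time in the ball where the truncation changes nothing. -/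
theorem exists_local_isVolterraSolution (hS : IsSingularKernel S γ)
    (hN : HasLipschitzTruncations N) (hG : ContinuousOn G (Set.Ici 0)) :
    ∃ b : ℝ, 0 < b ∧ ∃ f, IsVolterraSolution S N G b f := by
  obtain ⟨N', L, hL, he⟩ := hN (‖G 0‖ + 1)
  obtain ⟨f, hfc, hf⟩ := (hS.existsUnique_of_lipschitz zero_le_one hL
    (hG.mono Set.Icc_subset_Ici_self)).1
  have h0 : f 0 = G 0 := by
    rw [hf 0 ⟨le_rfl, zero_le_one⟩, volterra, intervalIntegral.integral_same, add_zero]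
  obtain ⟨b, hb, h⟩ := exists_isVolterraSolution_of_norm_lt one_pos le_rfl he hfc hf fun r hr => by
    rw [le_antisymm hr.2 hr.1, h0]
    exact lt_add_one _
  exact ⟨b, hb, f, h⟩

/-- A bounded solution on a bounded interval is not maximal. -/
theorem IsVolterraSolution.exists_extension (hS : IsSingularKernel S γ)
    (hN : HasLipschitzTruncations N) (hG : ContinuousOn G (Set.Ici 0)) {b : ℝ} (hb : 0 < b)
    {f : ℝ → E} (hf : IsVolterraSolution S N G b f) {R : ℝ}
    (hR : ∀ r, 0 ≤ r → r < b → ‖f r‖ ≤ R) :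
    ∃ b' : ℝ, b < b' ∧ ∃ h, IsVolterraSolution S N G b' h := by
  obtain ⟨N', L, hL, he⟩ := hN (R + 1)
  obtain ⟨g, hgc, hg⟩ := (hS.existsUnique_of_lipschitz (T := b + 1) (by linarith) hL
    (hG.mono Set.Icc_subset_Ici_self)).1
  have heq : ∀ r, 0 ≤ r → r < b → g r = f r := by
    intro r hr hrb
    refine (hS.existsUnique_of_lipschitz hr hL (hG.mono Set.Icc_subset_Ici_self)).2 g f
      hgc.continuousOn (hf.continuousOn r hr (EReal.coe_lt_coe_iff.2 hrb))
      (fun q hq => hg q ⟨hq.1, by linarith [hq.2]⟩) ?_ r ⟨hr, le_rfl⟩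
    exact hf.truncated he (fun q hq => (hR q hq.1 (hq.2.trans_lt hrb)).trans (by linarith))
      (EReal.coe_lt_coe_iff.2 hrb)
  have hle : ∀ r ∈ Set.Ico 0 b, ‖g r‖ ≤ R := fun r hr => by
    rw [heq r hr.1 hr.2]
    exact hR r hr.1 hr.2
  have hle' : ∀ r ∈ Set.Icc 0 b, ‖g r‖ ≤ R := by
    rw [← closure_Ico hb.ne]
    exact fun r hr => closure_minimal (s := Set.Ico 0 b) (t := {r | ‖g r‖ ≤ R}) hle
      (isClosed_le hgc.norm continuous_const) hr
  obtain ⟨b', hb', h⟩ := exists_isVolterraSolution_of_norm_lt (by linarith) hb.le he hgc hg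
    fun r hr => (hle' r hr).trans_lt (lt_add_one R)
  exact ⟨b', hb', g, h⟩

/-- The equation restarted at time `s`, when `P_r S_t = S_{r+t}`. -/
theorem IsVolterraSolution.restart (hS : IsSingularKernel S γ) (hN : HasLipschitzTruncations N)
    {P : ℝ → E →L[ℝ] E} (hPS : ∀ s t, 0 ≤ s → 0 < t → ∀ u, P s (S t u) = S (s + t) u)
    {b : EReal} {f : ℝ → E} (hf : IsVolterraSolution S N G b f) {s r : ℝ} (hs : 0 ≤ s) (hr : 0 ≤ r)
    (hsr : ((s + r : ℝ) : EReal) < b) :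
    f (s + r) = P r (f s) + (G (s + r) - P r (G s)) +
      ∫ q in s..(s + r), S (s + r - q) (N (f q)) := by
  have hsb : (s : EReal) < b :=
    lt_of_le_of_lt (EReal.coe_le_coe_iff.2 (by linarith)) hsr
  have hc : ContinuousOn (fun q => N (f q)) (Set.Icc 0 (s + r)) :=
    hN.continuous.comp_continuousOn (hf.continuousOn (s + r) (by linarith) hsr)
  have hi := hS.intervalIntegrable (by linarith : 0 ≤ s + r) hc
  have h1 : P r (volterra S (fun q => N (f q)) s) = ∫ q in (0 : ℝ)..s, S (s + r - q) (N (f q)) := by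
    rw [volterra, ← ContinuousLinearMap.intervalIntegral_comp_comm _
      (hS.intervalIntegrable hs (hc.mono (Set.Icc_subset_Icc_right (by linarith))))]
    have hne : ∀ᵐ q : ℝ, q ≠ s := by simp [ae_iff, measure_singleton]
    refine intervalIntegral.integral_congr_ae ?_
    filter_upwards [hne] with q hq hqI
    rw [Set.uIoc_of_le hs] at hqI
    rw [hPS r (s - q) hr (sub_pos.2 (lt_of_le_of_ne hqI.2 hq))]
    congr 2
    ring
  have h2 : volterra S (fun q => N (f q)) (s + r) =
      (∫ q in (0 : ℝ)..s, S (s + r - q) (N (f q))) +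
        ∫ q in s..(s + r), S (s + r - q) (N (f q)) := by
    refine (intervalIntegral.integral_add_adjacent_intervals (hi.mono_set ?_)
      (hi.mono_set ?_)).symm
    · rw [Set.uIcc_of_le hs, Set.uIcc_of_le (by linarith)]
      exact Set.Icc_subset_Icc_right (by linarith)
    · rw [Set.uIcc_of_le (by linarith), Set.uIcc_of_le (by linarith)]
      exact Set.Icc_subset_Icc_left hs
  have h3 := hf.equation s hs hsb
  rw [hf.equation (s + r) (by linarith) hsr, h2, ← h1, h3, map_add]
  abel

/-- If a solution on `[0, b)` returns to a fixed ball at times arbitrarily close to `b`, it is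
bounded: from each such time on, the norm needs a time bounded below to leave a larger ball. -/
theorem IsVolterraSolution.exists_bound_of_frequently (hS : IsSingularKernel S γ)
    (hN : HasLipschitzTruncations N) {P : ℝ → E →L[ℝ] E}
    (hPS : ∀ s t, 0 ≤ s → 0 < t → ∀ u, P s (S t u) = S (s + t) u)
    (hP : ∀ U : ℝ, ∃ C : ℝ, 1 ≤ C ∧ ∀ t, 0 ≤ t → t ≤ U → ‖P t‖ ≤ C)
    (hGP : ∀ U : ℝ, ∃ D : ℝ, ∀ s r, 0 ≤ s → 0 ≤ r → s + r ≤ U → ‖G (s + r) - P r (G s)‖ ≤ D)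
    {b : ℝ} (hb : 0 < b) {f : ℝ → E} (hf : IsVolterraSolution S N G b f) {M : ℝ}
    (hM : ∃ᶠ q in 𝓝[<] b, ‖f q‖ < M) : ∃ R, ∀ r, 0 ≤ r → r < b → ‖f r‖ ≤ R := by
  obtain ⟨CP, hCP, hPb⟩ := hP b
  obtain ⟨D, hD⟩ := hGP b
  have hD0 : 0 ≤ D := (norm_nonneg _).trans (hD 0 0 le_rfl le_rfl (by linarith))
  obtain ⟨CS, hCS, hSb⟩ := hS.bound b
  have hM0 : 0 ≤ M := by
    obtain ⟨q, hq⟩ := hM.exists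
    exact (norm_nonneg _).trans hq.le
  set K := CP * M + D + 1 with hK
  have hMK : M < K := by nlinarith
  obtain ⟨B, hB, hNB⟩ := hN.exists_bound K
  have hγ := hS.lt_one
  obtain ⟨δ, hδ, hδb⟩ : ∃ δ : ℝ, 0 < δ ∧ ∀ x, 0 ≤ x → x < δ →
      CS * B * (x ^ (1 - γ) / (1 - γ)) < 1 := by
    have hc : Continuous fun x : ℝ => CS * B * (x ^ (1 - γ) / (1 - γ)) := by
      have := Real.continuous_rpow_const (q := 1 - γ) (by linarith)
      fun_prop
    have h0 : CS * B * ((0 : ℝ) ^ (1 - γ) / (1 - γ)) < 1 := by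
      rw [Real.zero_rpow (by linarith)]
      simp
    obtain ⟨δ, hδ, h⟩ := Metric.eventually_nhds_iff.1 (hc.continuousAt.eventually (gt_mem_nhds h0))
    refine ⟨δ, hδ, fun x hx hxδ => h ?_⟩
    rw [Real.dist_eq, sub_zero, abs_of_nonneg hx]
    exact hxδ
  obtain ⟨s, hs, hsI⟩ := (hM.and_eventually (Ioo_mem_nhdsLT
    (show max 0 (b - δ) < b from max_lt hb (by linarith)))).exists
  have hs0 : 0 < s := (le_max_left _ _).trans_lt hsI.1
  have hsδ : b - δ < s := (le_max_right _ _).trans_lt hsI.1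
  have hsb : s < b := hsI.2
  have hcont : ∀ U, U < b → ContinuousOn f (Set.Icc 0 U) := fun U hU => by
    rcases le_or_gt 0 U with h | h
    · exact hf.continuousOn U h (EReal.coe_lt_coe_iff.2 hU)
    · rw [Set.Icc_eq_empty (not_le.2 h)]
      exact continuousOn_empty _
  have hlate : ∀ r, s ≤ r → r < b → ‖f r‖ ≤ K := by
    intro r hsr hrb
    by_contra! hlt
    -- The first time `c ∈ [s, r]` at which the norm is at least `K`.
    set Z := Set.Icc s r ∩ {x | K ≤ ‖f x‖} with hZ
    have hfr : ContinuousOn (fun x => ‖f x‖) (Set.Icc s r) :=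
      ((hcont r hrb).mono (Set.Icc_subset_Icc_left hs0.le)).norm
    have hZc : IsCompact Z := isCompact_Icc.of_isClosed_subset
      (hfr.preimage_isClosed_of_isClosed isClosed_Icc isClosed_Ici) Set.inter_subset_left
    obtain ⟨c, ⟨⟨hsc, hcr⟩, hcK⟩, hmin⟩ := hZc.exists_isLeast ⟨r, ⟨hsr, le_rfl⟩, hlt.le⟩
    have hcK : K ≤ ‖f c‖ := hcK
    have hbefore : ∀ q ∈ Set.Ico s c, ‖N (f q)‖ ≤ B := fun q hq => by
      refine hNB _ (le_of_not_gt fun h => ?_)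
      exact absurd (hmin ⟨⟨hq.1, hq.2.le.trans hcr⟩, h.le⟩) (not_le.2 hq.2)
    have hre := hf.restart hS hN hPS hs0.le (sub_nonneg.2 hsc)
      (by rw [add_sub_cancel]; exact EReal.coe_lt_coe_iff.2 (hcr.trans_lt hrb))
    rw [add_sub_cancel] at hre
    have e1 : ‖P (c - s) (f s)‖ ≤ CP * M :=
      (ContinuousLinearMap.le_opNorm _ _).trans (mul_le_mul (hPb _ (by linarith) (by linarith))
        hs.le (norm_nonneg _) (by linarith))
    have e2 := hD s (c - s) hs0.le (by linarith) (by linarith)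
    rw [add_sub_cancel] at e2
    have e3 := (IsSingularKernel.norm_integral_le hγ hsc
      (fun t ht htc => hSb t ht (by linarith)) hbefore).trans_lt
      (hδb (c - s) (by linarith) (by linarith))
    have e4 : ‖f c‖ < K := by
      rw [hre]
      refine (norm_add_le _ _).trans_lt ?_
      have := norm_add_le (P (c - s) (f s)) (G c - P (c - s) (G s))
      rw [hK]
      linarith
    exact absurd hcK (not_le.2 e4)
  obtain ⟨R, hR⟩ := isCompact_Icc.exists_bound_of_continuousOn (hcont s hsb)
  refine ⟨max R K, fun r hr hrb => ?_⟩
  rcases le_total r s with h | h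
  · exact (hR r ⟨hr, h⟩).trans (le_max_left _ _)
  · exact (hlate r h hrb).trans (le_max_right _ _)

/-- Existence of the maximal solution, uniqueness, and blow-up. -/
theorem exists_maximal_isVolterraSolution (hS : IsSingularKernel S γ)
    (hN : HasLipschitzTruncations N) (hG : ContinuousOn G (Set.Ici 0)) {P : ℝ → E →L[ℝ] E}
    (hPS : ∀ s t, 0 ≤ s → 0 < t → ∀ u, P s (S t u) = S (s + t) u)
    (hP : ∀ U : ℝ, ∃ C : ℝ, 1 ≤ C ∧ ∀ t, 0 ≤ t → t ≤ U → ‖P t‖ ≤ C)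
    (hGP : ∀ U : ℝ, ∃ D : ℝ, ∀ s r, 0 ≤ s → 0 ≤ r → s + r ≤ U → ‖G (s + r) - P r (G s)‖ ≤ D) :
    ∃ β : EReal, 0 < β ∧ ∃ f : ℝ → E, IsVolterraSolution S N G β f ∧
      (∀ (β' : EReal) (h : ℝ → E), 0 < β' → IsVolterraSolution S N G β' h →
        β' ≤ β ∧ ∀ r : ℝ, 0 ≤ r → (r : EReal) < β' → h r = f r) ∧
      (∀ b : ℝ, β = (b : EReal) → Tendsto (fun q => ‖f q‖) (𝓝[<] b) atTop) := by
  classical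
  set A : Set EReal := {b | 0 < b ∧ ∃ f, IsVolterraSolution S N G b f} with hA
  have hex : ∀ r : ℝ, (r : EReal) < sSup A →
      ∃ b : EReal, ∃ f, (r : EReal) < b ∧ IsVolterraSolution S N G b f := fun r hr => by
    obtain ⟨b, ⟨-, f, hf⟩, hrb⟩ := lt_sSup_iff.1 hr
    exact ⟨b, f, hrb, hf⟩
  choose bd sol hbd hsol using hex
  set f : ℝ → E := fun r => if hr : (r : EReal) < sSup A then sol r hr r else 0 with hfdef
  have hagree : ∀ (b : EReal) (h : ℝ → E), IsVolterraSolution S N G b h → b ≤ sSup A →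
      ∀ r : ℝ, 0 ≤ r → (r : EReal) < b → h r = f r := by
    intro b h hh hbA r hr hrb
    have hrA := hrb.trans_le hbA
    rw [hfdef]
    simp only [dif_pos hrA]
    exact hh.unique hS hN hG (hsol r hrA) hr hrb (hbd r hrA)
  have hle : ∀ (b : EReal) (h : ℝ → E), 0 < b → IsVolterraSolution S N G b h → b ≤ sSup A :=
    fun b h h0 hh => le_sSup ⟨h0, h, hh⟩
  have hf : IsVolterraSolution S N G (sSup A) f := by
    have key : ∀ U : ℝ, 0 ≤ U → (U : EReal) < sSup A → ∃ h : ℝ → E, ∃ b : EReal,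
        (U : EReal) < b ∧ IsVolterraSolution S N G b h ∧ ∀ r ∈ Set.Icc 0 U, f r = h r := by
      intro U hU0 hU
      obtain ⟨b, ⟨h0, h, hh⟩, hUb⟩ := lt_sSup_iff.1 hU
      exact ⟨h, b, hUb, hh, fun r hr => (hagree b h hh (hle b h h0 hh) r hr.1
        (lt_of_le_of_lt (EReal.coe_le_coe_iff.2 hr.2) hUb)).symm⟩
    refine ⟨fun U hU0 hU => ?_, fun r hr0 hr => ?_⟩
    · obtain ⟨h, b, hUb, hh, he⟩ := key U hU0 hU
      exact (hh.continuousOn U hU0 hUb).congr he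
    · obtain ⟨h, b, hrb, hh, he⟩ := key r hr0 hr
      rw [he r ⟨hr0, le_rfl⟩, hh.equation r hr0 hrb]
      congr 1
      exact volterra_congr hr0 fun q hq => by rw [he q hq]
  obtain ⟨b₀, hb₀, f₀, hf₀⟩ := exists_local_isVolterraSolution hS hN hG
  have hpos : 0 < sSup A :=
    (EReal.coe_pos.2 hb₀).trans_le (hle b₀ f₀ (EReal.coe_pos.2 hb₀) hf₀)
  refine ⟨sSup A, hpos, f, hf, fun β' h hβ' hh =>
    ⟨hle β' h hβ' hh, hagree β' h hh (hle β' h hβ' hh)⟩, fun b hb => ?_⟩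
  rw [hb] at hf hpos
  have hb0 : 0 < b := EReal.coe_pos.1 hpos
  by_contra hnot
  rw [tendsto_atTop] at hnot
  push Not at hnot
  obtain ⟨M, hM⟩ := hnot
  obtain ⟨R, hR⟩ := hf.exists_bound_of_frequently hS hN hPS hP hGP hb0
    (M := M) (hM.mono fun q hq => by simpa using hq)
  obtain ⟨b', hbb', h, hh⟩ := hf.exists_extension hS hN hG hb0 hR
  have := hle b' h (EReal.coe_pos.2 (hb0.trans hbb')) hh
  rw [hb] at this
  exact absurd (EReal.coe_le_coe_iff.1 this) (not_le.2 hbb')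

end Maximal

/-! ### The Cahn-Hilliard nonlinearity -/

/-- The nonlinearity `u ↦ u³ - u` on `C(𝕋^d)`. -/
def cubicTerm {d : ℕ} (u : C(Torus d, ℝ)) : C(Torus d, ℝ) := u ^ 3 - u

theorem hasLipschitzTruncations_cubicTerm (d : ℕ) :
    HasLipschitzTruncations (cubicTerm : C(Torus d, ℝ) → C(Torus d, ℝ)) := by
  intro R
  set c : ℝ → ℝ := fun x => max (min x |R|) (-|R|) with hc
  have hcc : Continuous c := by fun_prop
  have hcR : ∀ x, |c x| ≤ |R| := fun x => abs_le.2 ⟨le_max_right _ _,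
    max_le (min_le_right _ _) (by linarith [abs_nonneg R])⟩
  have hcl : ∀ x y, |c x - c y| ≤ |x - y| := fun x y =>
    (abs_max_sub_max_le_abs _ _ _).trans
      ((abs_min_sub_min_le_max _ _ _ _).trans (by simp))
  refine ⟨fun u => ⟨fun x => c (u x) ^ 3 - c (u x), by fun_prop⟩, (3 * |R| ^ 2 + 1).toNNReal,
    LipschitzWith.of_dist_le_mul fun u v => ?_, fun u hu => ?_⟩
  · rw [Real.coe_toNNReal _ (by positivity), dist_eq_norm, dist_eq_norm,
      ContinuousMap.norm_le _ (by positivity)]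
    intro x
    set y := c (u x)
    set z := c (v x)
    change |(y ^ 3 - y) - (z ^ 3 - z)| ≤ _
    have h1 : (y ^ 3 - y) - (z ^ 3 - z) = (y ^ 2 + y * z + z ^ 2 - 1) * (y - z) := by ring
    have hy : |y| ≤ |R| := hcR _
    have hz : |z| ≤ |R| := hcR _
    have h2 : |y ^ 2 + y * z + z ^ 2 - 1| ≤ 3 * |R| ^ 2 + 1 := by
      have b1 : |y ^ 2| ≤ |R| ^ 2 := by rw [abs_pow]; gcongr
      have b2 : |y * z| ≤ |R| ^ 2 := by rw [abs_mul, sq]; gcongr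
      have b3 : |z ^ 2| ≤ |R| ^ 2 := by rw [abs_pow]; gcongr
      rw [abs_le] at *
      constructor <;> linarith
    rw [h1, abs_mul]
    gcongr
    exact (hcl _ _).trans ((u - v).norm_coe_le_norm x)
  · ext x
    have hx : |u x| ≤ |R| := (u.norm_coe_le_norm x).trans (hu.trans (le_abs_self R))
    have : c (u x) = u x := by
      rw [hc]
      simp only
      rw [min_eq_left (abs_le.1 hx).2, max_eq_left (abs_le.1 hx).1]
    change c (u x) ^ 3 - c (u x) = u x ^ 3 - u x
    rw [this]

/-! ### Regularity in `𝒞^α` -/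

theorem isSingularKernel_lapHeatOp {d : ℕ} (ρ : DyadicPartition d) {a : ℝ} (ha0 : 0 ≤ a)
    (ha : a < 2 - (d : ℝ) / 2) : IsSingularKernel (lapHeatOp d) ((1 + a / 2 + d / 4) / 2) where
  lt_one := by linarith
  continuousOn := continuousOn_lapHeatOp d
  bound U := by
    have hd0 : (0 : ℝ) ≤ d := d.cast_nonneg
    obtain ⟨C, hC, h⟩ := exists_norm_lapHeatOp_le ρ U ha0 (by linarith)
    exact ⟨C, hC.le, fun t ht htU => (h t ht htU).1⟩

theorem ContinuousInHolder.congr {d : ℕ} {ρ : DyadicPartition d} {α U : ℝ}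
    {f g : ℝ → TorusDistribution d} (h : ContinuousInHolder ρ α U f)
    (hfg : ∀ r ∈ Set.Icc 0 U, g r = f r) : ContinuousInHolder ρ α U g := by
  refine ⟨fun r hr => by rw [hfg r hr]; exact h.1 r hr, fun r hr => ?_⟩
  refine (h.2 r hr).congr' (eventually_nhdsWithin_of_forall fun s hs => ?_)
  simp only [hfg r hr, hfg s hs]

theorem block_add {d : ℕ} (ρ : DyadicPartition d) (j : ℕ) (S T : TorusDistribution d) :
    block ρ j (S + T) = block ρ j S + block ρ j T := rfl

theorem weightedBlockNorm_add_le {d : ℕ} (ρ : DyadicPartition d) (α : ℝ)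
    (S T : TorusDistribution d) (j : ℕ) :
    weightedBlockNorm ρ α (S + T) j ≤ weightedBlockNorm ρ α S j + weightedBlockNorm ρ α T j := by
  unfold weightedBlockNorm
  rw [block_add, ← mul_add]
  gcongr
  exact norm_add_le _ _

theorem holderNorm_add_le {d : ℕ} (ρ : DyadicPartition d) (α : ℝ) (S T : TorusDistribution d) :
    holderNorm ρ α (S + T) ≤ holderNorm ρ α S + holderNorm ρ α T := by
  refine iSup_le fun j => (ENNReal.ofReal_le_ofReal (weightedBlockNorm_add_le ρ α S T j)).trans ?_
  rw [ENNReal.ofReal_add (weightedBlockNorm_nonneg ρ α S j) (weightedBlockNorm_nonneg ρ α T j)]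
  exact add_le_add (le_iSup (fun j => ENNReal.ofReal (weightedBlockNorm ρ α S j)) j)
    (le_iSup (fun j => ENNReal.ofReal (weightedBlockNorm ρ α T j)) j)

theorem ContinuousInHolder.add {d : ℕ} {ρ : DyadicPartition d} {α U : ℝ}
    {f g : ℝ → TorusDistribution d} (hf : ContinuousInHolder ρ α U f)
    (hg : ContinuousInHolder ρ α U g) : ContinuousInHolder ρ α U fun r => f r + g r := by
  refine ⟨fun r hr => ?_, fun r hr => ?_⟩
  · have h := Tendsto.add (hf.1 r hr) (hg.1 r hr)
    rw [add_zero] at h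
    exact squeeze_zero (fun j => weightedBlockNorm_nonneg ρ α _ j)
      (fun j => weightedBlockNorm_add_le ρ α _ _ j) h
  · have h := (hf.2 r hr).add (hg.2 r hr)
    rw [add_zero] at h
    refine tendsto_of_tendsto_of_tendsto_of_le_of_le tendsto_const_nhds h (fun _ => zero_le)
      fun s => ?_
    have e : f s + g s - (f r + g r) = (f s - f r) + (g s - g r) :=
      Subtype.ext (add_sub_add_comm (f s).1 (g s).1 (f r).1 (g r).1)
    simp only [e]
    exact holderNorm_add_le ρ α _ _

theorem continuousInHolder_heatOp {d : ℕ} (hd : d ≤ 3) (ρ : DyadicPartition d) {α : ℝ}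
    {v : C(Torus d, ℝ)} (hv : ofFunction v ∈ HolderBesov ρ α) (U : ℝ) :
    ContinuousInHolder ρ α U fun r => ofFunction (heatOp d r v) := by
  obtain ⟨C, hC, hb⟩ := exists_norm_heatOp_le hd U
  refine continuousInHolder_of_block ρ (τ := fun j => C * weightedBlockNorm ρ α (ofFunction v) j)
    (by simpa using Tendsto.const_mul C hv)
    (fun j => (continuousOn_conv_heatOp ρ j v).mono Set.Icc_subset_Ici_self) fun j r hr => ?_
  unfold weightedBlockNorm
  rw [block_ofFunction, block_ofFunction, conv_heatOp hr.1, mul_left_comm]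
  gcongr
  exact ContinuousLinearMap.le_of_opNorm_le _ (hb r hr.1 hr.2) _

/-- The Duhamel term is more regular than `𝒞^α`: its `j`-th block is of order `2^{-aj}`, uniformly
in time, for any `a < 2 - d/2`. -/
theorem continuousInHolder_volterra {d : ℕ} (ρ : DyadicPartition d) {α a U : ℝ} (hα : 0 < α)
    (hαa : α < a) (ha : a < 2 - (d : ℝ) / 2) (hU : 0 ≤ U) {u : ℝ → C(Torus d, ℝ)}
    (hu : ContinuousOn u (Set.Icc 0 U)) :
    ContinuousInHolder ρ α U fun r => ofFunction (volterra (lapHeatOp d) u r) := by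
  have hd0 : (0 : ℝ) ≤ d := d.cast_nonneg
  have hS := isSingularKernel_lapHeatOp ρ (hα.trans hαa).le ha
  obtain ⟨C, hC, hb⟩ := exists_norm_lapHeatOp_le ρ U (hα.trans hαa).le (by linarith)
  obtain ⟨B, hB⟩ := isCompact_Icc.exists_bound_of_continuousOn hu
  have hB0 : 0 ≤ B := (norm_nonneg _).trans (hB 0 ⟨le_rfl, hU⟩)
  set γ : ℝ := (1 + a / 2 + d / 4) / 2 with hγd
  have hγ : γ < 1 := hS.lt_one
  set D := C * B * (U ^ (1 - γ) / (1 - γ)) with hD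
  refine continuousInHolder_of_block ρ
    (τ := fun j => (2 : ℝ) ^ (α * ((j : ℝ) - 1)) * (((2 : ℝ) ^ j) ^ (-a) * D)) ?_ (fun j => ?_)
    fun j r hr => ?_
  · have h : (2 : ℝ) ^ (α - a) < 1 := Real.rpow_lt_one_of_one_lt_of_neg one_lt_two (by linarith)
    have h2 := (tendsto_pow_atTop_nhds_zero_of_lt_one (by positivity) h).const_mul
      ((2 : ℝ) ^ (-α) * D)
    rw [mul_zero] at h2
    refine h2.congr fun j => ?_
    have e : (2 : ℝ) ^ (-α) * ((2 : ℝ) ^ (α - a)) ^ j =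
        (2 : ℝ) ^ (α * ((j : ℝ) - 1)) * ((2 : ℝ) ^ j) ^ (-a) := by
      rw [← Real.rpow_natCast, ← Real.rpow_natCast, ← Real.rpow_mul zero_le_two,
        ← Real.rpow_mul zero_le_two, ← Real.rpow_add two_pos, ← Real.rpow_add two_pos]
      ring_nf
    linear_combination D * e
  · exact (conv (blockKernel ρ j).1).continuous.comp_continuousOn (hS.continuousOn_volterra hU hu)
  · unfold weightedBlockNorm
    rw [block_ofFunction]
    refine mul_le_mul_of_nonneg_left ?_ (by positivity)
    have hur := hu.mono (Set.Icc_subset_Icc_right hr.2)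
    rw [volterra, ← ContinuousLinearMap.intervalIntegral_comp_comm _
      (hS.intervalIntegrable hr.1 hur)]
    have h1 := IsSingularKernel.norm_integral_le
      (S := fun t => (conv (blockKernel ρ j).1).comp (lapHeatOp d t)) (u := u)
      (C := ((2 : ℝ) ^ j) ^ (-a) * C) (B := B) hγ hr.1
      (fun t ht htr => (hb t ht (by linarith [hr.2])).2 j)
      (fun q hq => hB q ⟨hq.1, hq.2.le.trans hr.2⟩)
    refine h1.trans ?_
    have h2 : (r - 0) ^ (1 - γ) ≤ U ^ (1 - γ) := by
      rw [sub_zero]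
      exact Real.rpow_le_rpow hr.1 hr.2 (by linarith)
    have h3 : 0 < 1 - γ := by linarith
    rw [hD, mul_assoc, mul_assoc, mul_assoc]
    gcongr

/-! ### Mild solutions and the Volterra equation in `C(𝕋^d)` -/

theorem testLaplacian_reflect {d : ℕ} (k : TestFunction d) (x : Torus d) :
    (testLaplacian (reflect k x)).1 = (reflect (testLaplacian k) x).1 := by
  refine ext_coeff fun m => ?_
  rw [coeff_testLaplacian, coeff_reflect, coeff_reflect, coeff_testLaplacian, norm_latticePoint_neg]
  ring

theorem convolve_distLaplacian {d : ℕ} (k : TestFunction d) (u : C(Torus d, ℝ)) :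
    convolve k (distLaplacian (ofFunction u)) = conv (testLaplacian k).1 u := by
  ext x
  change ∫ y, u y * (testLaplacian (reflect k x)).1 y = _
  rw [testLaplacian_reflect]
  rfl

theorem semigroup_ofFunction {d : ℕ} {r : ℝ} (hr : 0 ≤ r) (v : C(Torus d, ℝ)) :
    semigroup r (ofFunction v) = ofFunction (heatOp d r v) := by
  rcases hr.eq_or_lt with rfl | hr
  · rw [heatOp_zero, semigroup, dif_neg (lt_irrefl _)]
    rfl
  · rw [heatOp_of_pos hr, semigroup, dif_pos hr, convolve_ofFunction]

theorem semigroup_distLaplacian {d : ℕ} {r : ℝ} (hr : 0 < r) (u : C(Torus d, ℝ)) :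
    semigroup r (distLaplacian (cube (ofFunction u) - ofFunction u)) =
      ofFunction (lapHeatOp d r (cubicTerm u)) := by
  have e : ofFunction (u ^ 3) - ofFunction u = ofFunction (cubicTerm u) :=
    (map_sub ofFunction _ _).symm
  rw [cube_ofFunction, e, semigroup, dif_pos hr, convolve_distLaplacian, lapHeatOp_of_pos hr]

/-- The pairing of continuous functions with a test function. -/
noncomputable def pairing {d : ℕ} (φ : TestFunction d) : C(Torus d, ℝ) →L[ℝ] ℝ :=
  LinearMap.mkContinuous
    { toFun := fun u => (ofFunction u).1 φ
      map_add' := fun u v => by rw [map_add]; rfl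
      map_smul' := fun c u => by rw [map_smul]; rfl } ‖φ.1‖ fun u => by
    have := norm_integral_le_of_norm_le_const (μ := (volume : Measure (Torus d)))
      (f := fun x => u x * φ.1 x) (C := ‖φ.1‖ * ‖u‖) (ae_of_all _ fun x => by
        rw [norm_mul, mul_comm]
        exact mul_le_mul (φ.1.norm_coe_le_norm x) (u.norm_coe_le_norm x) (norm_nonneg _)
          (norm_nonneg _))
    rw [probReal_univ, mul_one] at this
    exact this

/-- The integral of the mild formulation, taken after pairing with test functions, is the Bochner
integral in `C(𝕋^d)`. -/
theorem hasDistIntegral_volterra {d : ℕ} {γ : ℝ} (hS : IsSingularKernel (lapHeatOp d) γ)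
    {f : ℝ → TorusDistribution d} {u : ℝ → C(Torus d, ℝ)} {r : ℝ} (hr : 0 ≤ r)
    (hu : ContinuousOn u (Set.Icc 0 r)) (hf : ∀ q ∈ Set.Icc 0 r, f q = ofFunction (u q)) :
    HasDistIntegral (fun q => semigroup (r - q) (distLaplacian (cube (f q) - f q))) 0 r
      (ofFunction (volterra (lapHeatOp d) (fun q => cubicTerm (u q)) r)) := by
  intro φ
  have hi := hS.intervalIntegrable hr
    ((hasLipschitzTruncations_cubicTerm d).continuous.comp_continuousOn hu)
  have hne : ∀ᵐ q : ℝ, q ≠ r := by simp [ae_iff, measure_singleton]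
  have hae : ∀ᵐ q : ℝ, q ∈ Set.uIoc 0 r →
      pairing φ (lapHeatOp d (r - q) (cubicTerm (u q))) =
        (semigroup (r - q) (distLaplacian (cube (f q) - f q))).1 φ := by
    filter_upwards [hne] with q hq hqI
    rw [Set.uIoc_of_le hr] at hqI
    rw [hf q ⟨hqI.1.le, hqI.2⟩,
      semigroup_distLaplacian (sub_pos.2 (lt_of_le_of_ne hqI.2 hq))]
    rfl
  refine ⟨?_, ?_⟩
  · refine IntervalIntegrable.congr_ae (f := fun q =>
      pairing φ (lapHeatOp d (r - q) (cubicTerm (u q)))) ?_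
      ((ae_restrict_iff' measurableSet_uIoc).2 hae)
    exact ⟨(pairing φ).integrable_comp hi.1, (pairing φ).integrable_comp hi.2⟩
  · rw [← intervalIntegral.integral_congr_ae hae]
    exact ((pairing φ).intervalIntegral_comp_comm hi).symm

theorem HasDistIntegral.unique {d : ℕ} {F : ℝ → TorusDistribution d} {a b : ℝ}
    {I J : TorusDistribution d} (hI : HasDistIntegral F a b I) (hJ : HasDistIntegral F a b J) :
    I = J := by
  ext φ
  rw [(hI φ).2, (hJ φ).2]

/-- The mild solutions are the distributions given by the solutions of the Volterra equation in
`C(𝕋^d)`. -/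
theorem IsMildSolution.isVolterraSolution {d : ℕ} {ρ : DyadicPartition d} {α γ : ℝ} (hα : 0 < α)
    (hS : IsSingularKernel (lapHeatOp d) γ) {v : C(Torus d, ℝ)} {w : ℝ → C(Torus d, ℝ)}
    {g₂ : ℝ → TorusDistribution d} (hw : ∀ r, 0 ≤ r → ofFunction (w r) = g₂ r) {b : EReal}
    {h : ℝ → TorusDistribution d} (hh : IsMildSolution ρ α (ofFunction v) g₂ b h) :
    ∃ u : ℝ → C(Torus d, ℝ), (∀ r : ℝ, 0 ≤ r → (r : EReal) < b → h r = ofFunction (u r)) ∧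
      IsVolterraSolution (lapHeatOp d) cubicTerm (fun r => heatOp d r v + w r) b u := by
  have hex : ∀ r : ℝ, ∃ u : C(Torus d, ℝ), 0 ≤ r → (r : EReal) < b → h r = ofFunction u := by
    intro r
    by_cases hr : 0 ≤ r ∧ (r : EReal) < b
    · obtain ⟨u, hu⟩ := exists_ofFunction ρ hα
        ((hh.continuousInHolder r hr.1 hr.2).1 r ⟨hr.1, le_rfl⟩)
      exact ⟨u, fun _ _ => hu.symm⟩
    · exact ⟨0, fun h1 h2 => absurd ⟨h1, h2⟩ hr⟩
  choose u hu using hex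
  have huI : ∀ U : ℝ, (U : EReal) < b → ∀ r ∈ Set.Icc 0 U, h r = ofFunction (u r) :=
    fun U hU r hr => hu r hr.1 (lt_of_le_of_lt (EReal.coe_le_coe_iff.2 hr.2) hU)
  have hc : ∀ U : ℝ, 0 ≤ U → (U : EReal) < b → ContinuousOn u (Set.Icc 0 U) := fun U h0 hU =>
    ((hh.continuousInHolder U h0 hU).congr fun r hr => (huI U hU r hr).symm).continuousOn hα
  refine ⟨u, hu, hc, fun r hr hrb => ?_⟩
  obtain ⟨I, hI, he⟩ := hh.equation r hr hrb
  rw [hI.unique (hasDistIntegral_volterra hS hr (hc r hr hrb) (huI r hrb)), hu r hr hrb,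
    semigroup_ofFunction hr, ← hw r hr, ← map_add, ← map_add] at he
  exact ofFunction_injective d he

/-- A solution of the Volterra equation in `C(𝕋^d)` is a mild solution: `P_r g₁` and the Duhamel
term are continuous in time with values in `𝒞^α`. -/
theorem IsVolterraSolution.isMildSolution {d : ℕ} (hd : d ≤ 3) {ρ : DyadicPartition d} {α a : ℝ}
    (hα : 0 < α) (hαa : α < a) (ha : a < 2 - (d : ℝ) / 2) {v : C(Torus d, ℝ)}
    (hv : ofFunction v ∈ HolderBesov ρ α) {w : ℝ → C(Torus d, ℝ)} {g₂ : ℝ → TorusDistribution d}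
    (hg₂ : ∀ U : ℝ, 0 ≤ U → ContinuousInHolder ρ α U g₂)
    (hw : ∀ r, 0 ≤ r → ofFunction (w r) = g₂ r) {b : EReal} {u : ℝ → C(Torus d, ℝ)}
    (hu : IsVolterraSolution (lapHeatOp d) cubicTerm (fun r => heatOp d r v + w r) b u) :
    IsMildSolution ρ α (ofFunction v) g₂ b fun r => ofFunction (u r) where
  continuousInHolder U h0 hU := by
    have hc := (hasLipschitzTruncations_cubicTerm d).continuous.comp_continuousOn
      (hu.continuousOn U h0 hU)
    refine (((continuousInHolder_heatOp hd ρ hv U).add (hg₂ U h0)).add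
      (continuousInHolder_volterra ρ hα hαa ha h0 hc)).congr fun r hr => ?_
    rw [hu.equation r hr.1 (lt_of_le_of_lt (EReal.coe_le_coe_iff.2 hr.2) hU), map_add, map_add,
      hw r hr.1]
    rfl
  equation r hr hrb := by
    refine ⟨_, hasDistIntegral_volterra (isSingularKernel_lapHeatOp ρ (hα.trans hαa).le ha) hr
      (hu.continuousOn r hr hrb) fun q _ => rfl, ?_⟩
    rw [semigroup_ofFunction hr, ← hw r hr, ← map_add, ← map_add]
    exact congrArg _ (hu.equation r hr hrb)

end CahnHilliard

open CahnHilliard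
theorem mainTheorem4 (d : ℕ) (hd : d = 1 ∨ d = 2 ∨ d = 3) (ρ : DyadicPartition d)
    (α : ℝ) (hα : α ∈ Set.Ioo (0 : ℝ) (2 - (d : ℝ) / 2))
    (g₁ : TorusDistribution d) (hg₁ : g₁ ∈ HolderBesov ρ α)
    (g₂ : ℝ → TorusDistribution d) (hg₂ : ∀ U : ℝ, 0 ≤ U → ContinuousInHolder ρ α U g₂) :
    ∃ β : EReal, 0 < β ∧ ∃ f : ℝ → TorusDistribution d,
      IsMildSolution ρ α g₁ g₂ β f ∧
      (∀ (β' : EReal) (h : ℝ → TorusDistribution d), 0 < β' → IsMildSolution ρ α g₁ g₂ β' h →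
        β' ≤ β ∧ ∀ r : ℝ, 0 ≤ r → (r : EReal) < β' → h r = f r) ∧
      (∀ b : ℝ, β = (b : EReal) →
        Tendsto (fun q => holderNorm ρ α (f q)) (𝓝[<] b) (𝓝 ⊤)) := by
  have hd3 : d ≤ 3 := by omega
  obtain ⟨hα0, hα2⟩ := hα
  obtain ⟨a, hαa, ha⟩ := exists_between hα2
  have hS := isSingularKernel_lapHeatOp ρ (hα0.trans hαa).le ha
  obtain ⟨v, rfl⟩ := exists_ofFunction ρ hα0 hg₁
  have hex : ∀ r, ∃ u, 0 ≤ r → ofFunction u = g₂ r := fun r => by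
    by_cases hr : 0 ≤ r
    · obtain ⟨u, hu⟩ := exists_ofFunction ρ hα0 ((hg₂ r hr).1 r ⟨hr, le_rfl⟩)
      exact ⟨u, fun _ => hu⟩
    · exact ⟨0, fun h => absurd h hr⟩
  choose w hw using hex
  have hwc : ∀ U, ContinuousOn w (Set.Icc 0 U) := fun U => by
    rcases le_or_gt 0 U with hU | hU
    · exact ((hg₂ U hU).congr fun r hr => hw r hr.1).continuousOn hα0
    · rw [Set.Icc_eq_empty (not_le.2 hU)]
      exact continuousOn_empty _
  have hG : ContinuousOn (fun r => heatOp d r v + w r) (Set.Ici 0) := by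
    intro r hr
    have h1 : ContinuousOn (fun r => heatOp d r v + w r) (Set.Icc 0 (r + 1)) :=
      ((continuousInHolder_heatOp hd3 ρ hg₁ (r + 1)).continuousOn hα0).add (hwc (r + 1))
    refine (h1 r ⟨hr, (lt_add_one r).le⟩).mono_of_mem_nhdsWithin ?_
    exact mem_nhdsWithin_iff_exists_mem_nhds_inter.2
      ⟨Set.Iio (r + 1), Iio_mem_nhds (lt_add_one r), fun x hx => ⟨hx.2, hx.1.le⟩⟩
  have hGP : ∀ U : ℝ, ∃ D : ℝ, ∀ s r, 0 ≤ s → 0 ≤ r → s + r ≤ U →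
      ‖(heatOp d (s + r) v + w (s + r)) - heatOp d r (heatOp d s v + w s)‖ ≤ D := by
    intro U
    obtain ⟨B, hB⟩ := isCompact_Icc.exists_bound_of_continuousOn (hwc U)
    obtain ⟨C, hC, hb⟩ := exists_norm_heatOp_le hd3 U
    refine ⟨B + C * B, fun s r hs hr hsr => ?_⟩
    rw [map_add, heatOp_heatOp hr hs, add_comm r s, add_sub_add_left_eq_sub]
    refine (norm_sub_le _ _).trans (add_le_add (hB _ ⟨by linarith, hsr⟩) ?_)
    refine (ContinuousLinearMap.le_opNorm _ _).trans ?_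
    exact mul_le_mul (hb r hr (by linarith)) (hB s ⟨hs, by linarith⟩) (norm_nonneg _) (by linarith)
  obtain ⟨β, hβ, u, hu, hmax, hblow⟩ := exists_maximal_isVolterraSolution hS
    (hasLipschitzTruncations_cubicTerm d) hG (P := heatOp d)
    (fun s t hs ht u => heatOp_lapHeatOp hs ht u) (exists_norm_heatOp_le hd3) hGP
  refine ⟨β, hβ, fun r => ofFunction (u r), hu.isMildSolution hd3 hα0 hαa ha hg₁ hg₂ hw,
    fun β' h hβ' hh => ?_, fun b hb => ?_⟩
  · obtain ⟨u', hu', hsol⟩ := hh.isVolterraSolution hα0 hS hw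
    obtain ⟨hle, heq⟩ := hmax β' u' hβ' hsol
    exact ⟨hle, fun r hr hrb => by rw [hu' r hr hrb, heq r hr hrb]⟩
  · rw [ENNReal.tendsto_nhds_top_iff_nnreal]
    intro H
    filter_upwards [(hblow b hb).eventually_gt_atTop (embeddingConst α * H)] with q hq
    by_contra! hle
    rw [← ENNReal.ofReal_coe_nnreal] at hle
    exact absurd (norm_le_of_holderNorm_le ρ hα0 H.2 hle) (not_le.2 hq)
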